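/- Let $n\ge 4$ and let $\mathfrak g=\mathfrak{so}(2n+1,\mathbb C)$ with its usual Cartan subalgebra $\mathfrak h$, roots $\Delta=\{\pm\varepsilon_j\pm\varepsilon_k\ (j<k),\ \pm\varepsilon_j\}$, simple roots $\alpha_j=\varepsilon_j-\varepsilon_{j+1}$ $(j<n)$, $\alpha_n=\varepsilon_n$, and Killing form $\kappa$. Let $\mathfrak q$ be the maximal parabolic subalgebra of type $B_n(n-1)$, i.e. the one determined by $\alpha_{n-1}$, with fundamental weight $\lambda_{\mathfrak q}=\varepsilon_1+\dots+\varepsilon_{n-1}$. Let $H_{\mathfrak q}\in\mathfrak h$ be the element with $\varepsilon_j(H_{\mathfrak q})=1$ for $j<n$ and $\varepsilon_n(H_{\mathfrak q})=0$, let $\mathfrak g(k)$ be the $k$-eigenspace of $\operatorname{ad}H_{\mathfrak q}$, and put $\mathfrak l=\mathfrak g(0)$, $\mathfrak n=\mathfrak g(1)\oplus\mathfrak g(2)$, $\mathfrak z(\mathfrak n)=\mathfrak g(2)$, $\mathfrak q=\mathfrak l\oplus\mathfrak n$, $\bar{\mathfrak n}=\mathfrak g(-1)\oplus\mathfrak g(-2)$.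 Let $\mathfrak l_{n\gamma}\cong\mathfrak{sl}(2,\mathbb C)$ be the ideal of $\mathfrak l$ spanned by $\mathfrak g_{\pm\alpha_n}$ and $[\mathfrak g_{\alpha_n},\mathfrak g_{-\alpha_n}]$, and let $\gamma=\varepsilon_1+\varepsilon_2$, $\mu=\varepsilon_1+\varepsilon_n$, $\epsilon_{n\gamma}=\varepsilon_2$. Let $\mathfrak g_0$ be a real form of $\mathfrak g$ for which $\mathfrak q$ and $\bar{\mathfrak n}$ are defined over $\mathbb R$, and let $\bar N_0$ be the analytic group with Lie algebra $\bar{\mathfrak n}_0=\bar{\mathfrak n}\cap\mathfrak g_0$. For $s\in\mathbb C$ let $\mathcal L_s$ be the trivial line bundle over $\bar N_0$ on which $\mathfrak g$ acts by $$(Y\bullet f)(\bar n)=s\,\lambda_{\mathfrak q}\big((\operatorname{Ad}(\bar n^{-1})Y)_{\mathfrak q}\big)f(\bar n)-\big(R\big((\operatorname{Ad}(\bar n^{-1})Y)_{\bar{\mathfrak n}}\big)f\big)(\bar n),\qquad f\in C^\infty(\bar N_0),$$ where subscripts denote components in $\mathfrak g=\bar{\mathfrak n}\oplus\mathfrak q$,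 $\lambda_{\mathfrak q}$ is extended to a character of $\mathfrak q$, and $R$ is the $\mathbb C$-linear extension to $\bar{\mathfrak n}$ of the infinitesimal right translation by $\bar{\mathfrak n}_0$. (This is the infinitesimal left translation on sections of the line bundle on $G_0/Q_0$ with character $\chi^s$, $d\chi^s=s\lambda_{\mathfrak q}$.) Operators $D_1,\dots,D_d$ on $C^\infty(\bar N_0)$ form a conformally invariant system on $\mathcal L_s$ if they are linearly independent at each point and $[X\bullet,D_i]\in\sum_jC^\infty(\bar N_0)D_j$ for all $X\in\mathfrak g_0$ and all $i$. Put $\omega=\sum_{\gamma_j}X_{\gamma_j}^*\otimes X_{\gamma_j}$, summed over the roots of $\mathfrak g(2)$, where $X_{\gamma_j}$ are root vectors and $X_{\gamma_j}^*\in\mathfrak g(-2)$ their $\kappa$-dual vectors, and $\tau_2(X)=\tfrac12(\operatorname{ad}(X)^2\otimes\mathrm{Id})\,\omega$ for $X\in\mathfrak g(1)$. Let $W=\mathfrak l_{n\gamma}\otimes\mathfrak z(\mathfrak n)$ and let $W^*=\mathfrak l_{n\gamma}\otimes\mathfrak g(-2)$ be its dual with respect to $\kappa$. For $Y^*\in W^*$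 the function $X\mapsto Y^*(\tau_2(X))$ is a homogeneous polynomial of degree $2$ on $\mathfrak g(1)$; regard it as an element of $\operatorname{Sym}^2(\mathfrak g(-1))$ by means of $\kappa$, and let $\Omega_2(Y^*)$ be the image of this element under symmetrization into $\mathcal U(\bar{\mathfrak n})$ followed by $R$. The $\Omega_2|_{W^*}$ system is the list $\Omega_2(Y_1^*),\dots,\Omega_2(Y_d^*)$ for a basis $Y_1^*,\dots,Y_d^*$ of $W^*$. Then: 1. $W=V(\mu+\epsilon_{n\gamma})$ is a special constituent of $\mathfrak l\otimes\mathfrak z(\mathfrak n)$ of Type 1b. That is, $W$ is a simple $\mathfrak l$-submodule with highest weight $\mu+\epsilon_{n\gamma}\ne\gamma$, where $\mu$ is the highest weight of $\mathfrak g(1)$ and $\epsilon_{n\gamma}$ is a root of $\mathfrak g(1)$; moreover $\mu+\epsilon_{n\gamma}$ is not a root, $\epsilon_{n\gamma}\ne\mu$, and $\mu$ or $\epsilon_{n\gamma}$ is short. 2. For every such real form, every basis of $W^*$ and every $s\in\mathbb C$, the $\Omega_2|_{W^*}$ system is conformally invariant on $\mathcal L_s$ if and only if $s=1$. 3. This value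 is given by the Type 1a formula: $1=\tfrac12\,|\Delta_{\mu+\epsilon_{n\gamma}}(\mathfrak g(1))|-1$, where $\Delta_\nu(\mathfrak g(1))$ is the set of roots $\alpha$ of $\mathfrak g(1)$ with $\nu-\alpha\in\Delta$. -/

import Mathlib

open scoped TensorProduct ContDiff Matrix

noncomputable section

namespace OmegaB

/-! ## The Lie algebra of type `B_n`, `n = m + 1`, its roots and its grading -/

/-- The index set `{0} ∪ {1, …, n} ∪ {1', …, n'}` with `n = m + 1`. -/
abbrev Idx (m : ℕ) : Type := Unit ⊕ Fin (m + 1) ⊕ Fin (m + 1)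

/-- Complex square matrices of size `2n + 1`. -/
abbrev Mat (m : ℕ) : Type := Matrix (Idx m) (Idx m) ℂ

/-- `𝔤 = 𝔰𝔬(2n + 1, ℂ)`, `n = m + 1`, in Mathlib's split realization: the matrices that are skew for
the symmetric form `JB`. -/
abbrev g (m : ℕ) := LieAlgebra.Orthogonal.typeB (Fin (m + 1)) ℂ

/-- The involution of the index set that fixes `0` and exchanges `j` and `j'`. -/
def dualIdx {m : ℕ} : Idx m → Idx m
  | Sum.inl _ => Sum.inl ()
  | Sum.inr (Sum.inl j) => Sum.inr (Sum.inr j)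
  | Sum.inr (Sum.inr j) => Sum.inr (Sum.inl j)

/-- The entry of `JB` at `(a, dualIdx a)`; all other entries of `JB` vanish. -/
def jCoeff {m : ℕ} : Idx m → ℂ
  | Sum.inl _ => 2
  | Sum.inr _ => 1

lemma dualIdx_dualIdx {m : ℕ} (a : Idx m) : dualIdx (dualIdx a) = a := by
  rcases a with _ | _ | _ <;> rfl

lemma jCoeff_dualIdx {m : ℕ} (a : Idx m) : jCoeff (dualIdx a) = jCoeff a := by
  rcases a with _ | _ | _ <;> rfl

lemma jCoeff_ne_zero {m : ℕ} (a : Idx m) : jCoeff a ≠ 0 := by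
  rcases a with _ | _ <;> simp [jCoeff]

lemma JB_apply {m : ℕ} (a b : Idx m) :
    LieAlgebra.Orthogonal.JB (Fin (m + 1)) ℂ a b = if b = dualIdx a then jCoeff a else 0 := by
  rcases a with _ | a | a <;> rcases b with _ | b | b <;>
    simp [LieAlgebra.Orthogonal.JB, LieAlgebra.Orthogonal.JD, dualIdx, jCoeff, Matrix.one_apply,
      eq_comm]

/-- Membership in `𝔤`, entry by entry. -/
lemma mem_g_iff {m : ℕ} (A : Mat m) :
    A ∈ g m ↔ ∀ a b, A (dualIdx b) a * jCoeff b = -(jCoeff a * A (dualIdx a) b) := by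
  have h1 : ∀ a b, (Aᵀ * LieAlgebra.Orthogonal.JB (Fin (m + 1)) ℂ) a b
      = A (dualIdx b) a * jCoeff b := by
    intro a b
    rw [Matrix.mul_apply, Finset.sum_eq_single (dualIdx b)]
    · simp [JB_apply, dualIdx_dualIdx, jCoeff_dualIdx]
    · intro c _ hc
      rw [JB_apply, if_neg, mul_zero]
      rintro rfl
      exact hc (dualIdx_dualIdx c).symm
    · simp
  have h2 : ∀ a b, (LieAlgebra.Orthogonal.JB (Fin (m + 1)) ℂ * (-A)) a b
      = -(jCoeff a * A (dualIdx a) b) := by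
    intro a b
    rw [Matrix.mul_apply, Finset.sum_eq_single (dualIdx a)]
    · simp [JB_apply]
    · intro c _ hc
      rw [JB_apply, if_neg hc, zero_mul]
    · simp
  change A ∈ skewAdjointMatricesLieSubalgebra (LieAlgebra.Orthogonal.JB (Fin (m + 1)) ℂ) ↔ _
  rw [mem_skewAdjointMatricesLieSubalgebra,
    mem_skewAdjointMatricesSubmodule, Matrix.IsSkewAdjoint, Matrix.IsAdjointPair,
    ← Matrix.ext_iff]
  simp only [h1, h2]

/-- The element `E_{a,b} - (J_a / J_b) E_{b*,a*}` of `𝔤`. Up to sign and scale, the root vectors of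
`𝔤` are the elements `rootVec a b` with `a ≠ b`, `a ≠ b*`; the root is `wt a - wt b`. -/
def rootVec {m : ℕ} (a b : Idx m) : g m :=
  ⟨Matrix.single a b 1 - (jCoeff a / jCoeff b) • Matrix.single (dualIdx b) (dualIdx a) 1, by
    rw [mem_g_iff]
    intro c d
    have ha := jCoeff_ne_zero a
    have hb := jCoeff_ne_zero b
    have key : ∀ x y : Idx m, dualIdx x = y ↔ x = dualIdx y := fun x y =>
      ⟨fun h => by rw [← h, dualIdx_dualIdx], fun h => by rw [h, dualIdx_dualIdx]⟩
    have key2 : ∀ x y : Idx m, dualIdx x = dualIdx y ↔ x = y := fun x y => by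
      rw [key, dualIdx_dualIdx]
    simp only [Matrix.sub_apply, Matrix.smul_apply, Matrix.single_apply, smul_eq_mul, key2]
    by_cases h1 : a = dualIdx d ∧ b = c
    · obtain ⟨rfl, rfl⟩ := h1
      by_cases h2 : b = d
      · subst h2
        simp [jCoeff_dualIdx, dualIdx_dualIdx]
        field_simp
        ring
      · have h3 : ¬ d = b := fun h => h2 h.symm
        have h4 : ¬ (dualIdx d = dualIdx b ∧ b = d) := fun h => h2 h.2
        simp [h2, h3, dualIdx_dualIdx, jCoeff_dualIdx]
        field_simp
    · by_cases h2 : b = d ∧ dualIdx a = c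
      · obtain ⟨rfl, rfl⟩ := h2
        have h3 : ¬ (a = dualIdx b ∧ b = dualIdx a) := h1
        have h5 : ¬ (a = dualIdx b) := fun h => h3 ⟨h, by rw [h, dualIdx_dualIdx]⟩
        have h6 : ¬ (b = dualIdx a) := fun h => h5 (by rw [h, dualIdx_dualIdx])
        simp [h5, h6, dualIdx_dualIdx, jCoeff_dualIdx]
        field_simp
      · have h3 : ¬ (a = dualIdx c ∧ b = d) := fun h => h2 ⟨h.2, by rw [h.1, dualIdx_dualIdx]⟩
        have h4 : ¬ (b = c ∧ dualIdx a = d) :=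
          fun h => h1 ⟨by rw [← h.2, dualIdx_dualIdx], h.1⟩
        have h5 : ¬ (b = d ∧ dualIdx a = c) := h2
        simp [h1, h3, h4, h5]⟩

/-- Linear functionals on the Cartan subalgebra in the coordinates `ε_1, …, ε_n`. -/
abbrev Weight (m : ℕ) : Type := Fin (m + 1) → ℂ

/-- The functional `ε_j`. -/
def eps {m : ℕ} (j : Fin (m + 1)) : Weight m := Pi.single j 1

/-- Diagonal entries `(0, h, -h)` of the elements of the Cartan subalgebra. -/
def diagEntry {m : ℕ} (h : Fin (m + 1) → ℂ) : Idx m → ℂ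
  | Sum.inl _ => 0
  | Sum.inr (Sum.inl j) => h j
  | Sum.inr (Sum.inr j) => -h j

lemma diagEntry_dualIdx {m : ℕ} (h : Fin (m + 1) → ℂ) (a : Idx m) :
    diagEntry h (dualIdx a) = -diagEntry h a := by
  rcases a with _ | _ | _ <;> simp [dualIdx, diagEntry]

/-- The element `H(h_1, …, h_n)` of the Cartan subalgebra `𝔥` of diagonal matrices in `𝔤`. -/
def cartan {m : ℕ} (h : Fin (m + 1) → ℂ) : g m :=
  ⟨Matrix.diagonal (diagEntry h), by
    rw [mem_g_iff]
    intro a b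
    by_cases hab : b = dualIdx a
    · subst hab
      simp [dualIdx_dualIdx, jCoeff_dualIdx, diagEntry_dualIdx, mul_comm]
    · have h2 : ¬ dualIdx b = a := fun h => hab (by rw [← h, dualIdx_dualIdx])
      have h3 : ¬ dualIdx a = b := fun h => hab h.symm
      simp [h2, h3]⟩

/-- The value `λ(H(h))` of a functional on the Cartan subalgebra. -/
def evalWeight {m : ℕ} (lam : Weight m) (h : Fin (m + 1) → ℂ) : ℂ := ∑ j, lam j * h j

/-- The space `𝔤_α` of vectors of weight `α` in `𝔤`. -/
def rootSpace {m : ℕ} (α : Weight m) : Submodule ℂ (g m) :=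
  ⨅ h : Fin (m + 1) → ℂ,
    Module.End.eigenspace (LieAlgebra.ad ℂ (g m) (cartan h)) (evalWeight α h)

/-- The set `Δ` of roots of `𝔤` with respect to the diagonal Cartan subalgebra. -/
def roots (m : ℕ) : Set (Weight m) := {α | α ≠ 0 ∧ rootSpace α ≠ ⊥}

/-- `Δ(W)`, the set of the roots whose root space lies in `W`. -/
def rootsIn {m : ℕ} (W : Submodule ℂ (g m)) : Set (Weight m) :=
  {α | α ∈ roots m ∧ rootSpace α ≤ W}

/-- `Δ_ν(W) = {α ∈ Δ(W) | ν - α ∈ Δ}`. -/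
def rootsInSub {m : ℕ} (ν : Weight m) (W : Submodule ℂ (g m)) : Set (Weight m) :=
  {α | α ∈ rootsIn W ∧ ν - α ∈ roots m}

/-- The positive system `Δ⁺ = {ε_j ± ε_k | j < k} ∪ {ε_j}`; its simple roots are
`α_j = ε_j - ε_{j+1}` for `j < n`, and `α_n = ε_n`. -/
def posRoots (m : ℕ) : Set (Weight m) :=
  {α | (∃ j k, j < k ∧ (α = eps j - eps k ∨ α = eps j + eps k)) ∨ ∃ j, α = eps j}

/-- Squared length of a weight, for a positive multiple of the inner product that the Killing form
induces on the real span of the roots. -/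
def sqLength {m : ℕ} (α : Weight m) : ℝ := ∑ j, ‖α j‖ ^ 2

/-- A root is short if there is a longer root. -/
def IsShortRoot {m : ℕ} (α : Weight m) : Prop :=
  α ∈ roots m ∧ ∃ β ∈ roots m, sqLength α < sqLength β

/-- The element `H_𝔮` with `β(H_𝔮) = 2⟨λ_𝔮, β⟩ / ‖α_𝔮‖²`, where `α_𝔮 = α_{n-1}` and
`λ_𝔮 = λ_{n-1} = ε_1 + ⋯ + ε_{n-1}`. -/
def Hq (m : ℕ) : g m := cartan (fun j => if j = Fin.last m then 0 else 1)

/-- `𝔤(k)`, the `k`-eigenspace of `ad H_𝔮`. -/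
def gr (m : ℕ) (k : ℤ) : Submodule ℂ (g m) :=
  Module.End.eigenspace (LieAlgebra.ad ℂ (g m) (Hq m)) (k : ℂ)

/-- The maximal parabolic subalgebra `𝔮 = 𝔩 ⊕ 𝔫 = 𝔤(0) ⊕ 𝔤(1) ⊕ 𝔤(2)` of type `B_n(n-1)`. -/
def qq (m : ℕ) : Submodule ℂ (g m) := gr m 0 ⊔ gr m 1 ⊔ gr m 2

/-- The opposite nilradical `𝔫̄ = 𝔤(-1) ⊕ 𝔤(-2)`. -/
def nbar (m : ℕ) : Submodule ℂ (g m) := gr m (-1) ⊔ gr m (-2)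

/-- The eigenvalue of `H_𝔮` on the basis vector with index `a`. -/
def deg {m : ℕ} : Idx m → ℤ
  | Sum.inl _ => 0
  | Sum.inr (Sum.inl j) => if j = Fin.last m then 0 else 1
  | Sum.inr (Sum.inr j) => if j = Fin.last m then 0 else -1

lemma deg_dualIdx {m : ℕ} (a : Idx m) : deg (dualIdx a) = -deg a := by
  rcases a with _ | j | j
  · simp [dualIdx, deg]
  · by_cases h : j = Fin.last m <;> simp [dualIdx, deg, h]
  · by_cases h : j = Fin.last m <;> simp [dualIdx, deg, h]

lemma deg_cast {m : ℕ} (a : Idx m) :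
    ((deg a : ℤ) : ℂ) = diagEntry (fun j => if j = Fin.last m then 0 else 1) a := by
  rcases a with _ | j | j
  · simp [deg, diagEntry]
  · by_cases h : j = Fin.last m <;> simp [diagEntry, deg, h]
  · by_cases h : j = Fin.last m <;> simp [diagEntry, deg, h]

lemma mem_gr_iff {m : ℕ} (k : ℤ) (X : g m) :
    X ∈ gr m k ↔ ∀ a b, (X : Mat m) a b ≠ 0 → deg a - deg b = k := by
  rw [gr, Module.End.mem_eigenspace_iff, LieAlgebra.ad_apply, Subtype.ext_iff, ← Matrix.ext_iff]
  refine forall_congr' fun a => forall_congr' fun b => ?_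
  have h1 : ((⁅Hq m, X⁆ : g m) : Mat m) a b = ((deg a - deg b : ℤ) : ℂ) * (X : Mat m) a b := by
    change ((Hq m : Mat m) * (X : Mat m) - (X : Mat m) * (Hq m : Mat m)) a b = _
    rw [Matrix.sub_apply, Hq, cartan, Matrix.diagonal_mul, Matrix.mul_diagonal]
    push_cast
    rw [deg_cast, deg_cast]
    ring
  have h2 : (((k : ℂ) • X : g m) : Mat m) a b = (k : ℂ) * (X : Mat m) a b := rfl
  rw [h1, h2]
  constructor
  · intro h h0
    exact_mod_cast mul_right_cancel₀ h0 h
  · intro h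
    by_cases h0 : (X : Mat m) a b = 0
    · simp [h0]
    · rw [h h0]

/-- The projection of `𝔤` onto `𝔤(k)` along the other graded pieces. -/
def grProj (m : ℕ) (k : ℤ) : g m →ₗ[ℂ] g m where
  toFun X := ⟨Matrix.of fun a b => if deg a - deg b = k then (X : Mat m) a b else 0, by
    have hX := (mem_g_iff (X : Mat m)).1 X.2
    rw [mem_g_iff]
    intro a b
    have h : deg (dualIdx b) - deg a = deg (dualIdx a) - deg b := by
      rw [deg_dualIdx, deg_dualIdx]; ring
    simp only [Matrix.of_apply, h]
    split_ifs
    · exact hX a b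
    · simp⟩
  map_add' X Y := by
    ext a b
    change (if deg a - deg b = k then (X : Mat m) a b + (Y : Mat m) a b else 0)
      = (if deg a - deg b = k then (X : Mat m) a b else 0)
        + (if deg a - deg b = k then (Y : Mat m) a b else 0)
    split_ifs <;> simp
  map_smul' c X := by
    ext a b
    change (if deg a - deg b = k then c * (X : Mat m) a b else 0)
      = c * (if deg a - deg b = k then (X : Mat m) a b else 0)
    split_ifs <;> simp

lemma grProj_mem {m : ℕ} (k : ℤ) (X : g m) : grProj m k X ∈ gr m k := by
  rw [mem_gr_iff]
  intro a b h
  by_contra hk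
  exact h (if_neg hk)

/-- The component in `𝔫̄` with respect to `𝔤 = 𝔫̄ ⊕ 𝔮`. -/
def nbarPart {m : ℕ} (X : g m) : nbar m :=
  ⟨grProj m (-1) X + grProj m (-2) X, Submodule.add_mem_sup (grProj_mem _ _) (grProj_mem _ _)⟩

/-- The component in `𝔮` with respect to `𝔤 = 𝔫̄ ⊕ 𝔮`. -/
def qPart {m : ℕ} (X : g m) : qq m :=
  ⟨grProj m 0 X + grProj m 1 X + grProj m 2 X, Submodule.add_mem_sup
    (Submodule.add_mem_sup (grProj_mem _ _) (grProj_mem _ _)) (grProj_mem _ _)⟩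

lemma nbarPart_add_qPart {m : ℕ} (X : g m) : (nbarPart X : g m) + (qPart X : g m) = X := by
  ext a b
  have hd : ∀ c : Idx m, deg c = -1 ∨ deg c = 0 ∨ deg c = 1 := by
    rintro (_ | j | j)
    · simp [deg]
    · by_cases h : j = Fin.last m <;> simp [deg, h]
    · by_cases h : j = Fin.last m <;> simp [deg, h]
  change ((if deg a - deg b = -1 then (X : Mat m) a b else 0)
      + (if deg a - deg b = -2 then (X : Mat m) a b else 0))
      + ((if deg a - deg b = 0 then (X : Mat m) a b else 0)
      + (if deg a - deg b = 1 then (X : Mat m) a b else 0)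
      + (if deg a - deg b = 2 then (X : Mat m) a b else 0)) = (X : Mat m) a b
  rcases hd a with ha | ha | ha <;> rcases hd b with hb | hb | hb <;> simp [ha, hb]

/-- The character `λ_𝔮 = dχ` of `𝔮`: it is `ε_1 + ⋯ + ε_{n-1}` on the Cartan subalgebra, and it
vanishes on `[𝔩, 𝔩]` and on `𝔫`. It is the trace of the `𝔤𝔩(n-1)`-block. -/
def lamQ {m : ℕ} (Z : qq m) : ℂ :=
  ∑ j : Fin m, ((Z : g m) : Mat m) (Sum.inr (Sum.inl j.castSucc)) (Sum.inr (Sum.inl j.castSucc))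

/-! ## The special constituent and its dual -/

/-- Weights of the form "highest weight of `V` as an `𝔩`-module": some non-zero vector of `V` has
this weight and is killed by the positive root spaces of `𝔩`. -/
def IsHighestWeight {m : ℕ} {M : Type*} [AddCommGroup M] [Module ℂ M] [LieRingModule (g m) M]
    (V : Submodule ℂ M) (ν : Weight m) : Prop :=
  ∃ v ∈ V, v ≠ 0 ∧ (∀ h : Fin (m + 1) → ℂ, ⁅cartan h, v⁆ = evalWeight ν h • v) ∧
    ∀ α ∈ posRoots m, rootSpace α ≤ gr m 0 → ∀ X ∈ rootSpace α, ⁅X, v⁆ = 0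

/-- `V` is stable under `𝔩 = 𝔤(0)`. -/
def IsLStable {m : ℕ} {M : Type*} [AddCommGroup M] [Module ℂ M] [LieRingModule (g m) M]
    (V : Submodule ℂ M) : Prop :=
  ∀ X ∈ gr m 0, ∀ v ∈ V, ⁅X, v⁆ ∈ V

/-- `V` is a simple `𝔩`-submodule. -/
def IsLSimple {m : ℕ} {M : Type*} [AddCommGroup M] [Module ℂ M] [LieRingModule (g m) M]
    (V : Submodule ℂ M) : Prop :=
  V ≠ ⊥ ∧ IsLStable (m := m) V ∧
    ∀ U : Submodule ℂ M, U ≤ V → IsLStable (m := m) U → U = ⊥ ∨ U = V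

/-- The subspace `A ⊗ B` of `𝔤 ⊗ 𝔤`. -/
def tens {m : ℕ} (A B : Submodule ℂ (g m)) : Submodule ℂ (g m ⊗[ℂ] g m) :=
  Submodule.map₂ (TensorProduct.mk ℂ (g m) (g m)) A B

/-- The index `0`. -/
def idx0 (m : ℕ) : Idx m := Sum.inl ()

/-- The index `n`. -/
def idxN (m : ℕ) : Idx m := Sum.inr (Sum.inl (Fin.last m))

/-- The simple ideal `𝔩_{nγ} = span {X_{α_n}, H_{α_n}, X_{-α_n}} ≅ 𝔰𝔩(2)` of `[𝔩, 𝔩]`, the one that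
does not contain the root space of `α_γ = α_2`. -/
def lng (m : ℕ) : Submodule ℂ (g m) :=
  Submodule.span ℂ {rootVec (idxN m) (idx0 m),
    ⁅rootVec (idxN m) (idx0 m), rootVec (idx0 m) (idxN m)⁆, rootVec (idx0 m) (idxN m)}

/-- `V(μ + ε_{nγ}) = 𝔩_{nγ} ⊗ 𝔷(𝔫)`, with `𝔷(𝔫) = 𝔤(2)`. -/
def Wng (m : ℕ) : Submodule ℂ (g m ⊗[ℂ] g m) := tens (lng m) (gr m 2)

/-- `V(μ + ε_{nγ})^* = 𝔩_{nγ} ⊗ 𝔷(𝔫̄)`, the dual by means of the Killing form, with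
`𝔷(𝔫̄) = 𝔤(-2)`. -/
def WngDual (m : ℕ) : Submodule ℂ (g m ⊗[ℂ] g m) := tens (lng m) (gr m (-2))

/-- The highest root `γ = ε_1 + ε_2`. -/
def gam (m : ℕ) : Weight m := eps 0 + eps 1

/-- `μ = ε_1 + ε_n`. -/
def mu (m : ℕ) : Weight m := eps 0 + eps (Fin.last m)

/-- `ε_{nγ} = ε_2`. -/
def epsNG (m : ℕ) : Weight m := eps 1

/-- `W` is a special constituent of `𝔩 ⊗ 𝔷(𝔫)`, of Type 1b and with highest weight `μ + ε`: it is a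
simple `𝔩`-submodule with highest weight `μ + ε ≠ γ`, where `μ` is the highest weight of `𝔤(1)` and
`ε ∈ Δ(𝔤(1))`, and moreover `μ + ε` is not a root, `ε ≠ μ`, and `μ` or `ε` is short. -/
structure IsSpecialType1b (m : ℕ) (W : Submodule ℂ (g m ⊗[ℂ] g m)) (μ ε : Weight m) : Prop where
  le : W ≤ tens (gr m 0) (gr m 2)
  simple : IsLSimple (m := m) W
  highestWeight_g1 : IsHighestWeight (gr m 1) μ
  mem : ε ∈ rootsIn (gr m 1)
  highestWeight : IsHighestWeight W (μ + ε)
  ne_gam : μ + ε ≠ gam m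
  not_root : μ + ε ∉ roots m
  ne : ε ≠ μ
  short : IsShortRoot μ ∨ IsShortRoot ε

/-! ## The maps `τ₂` and `τ̃₂` -/

/-- The element dual to the root vector `rootVec a b` with respect to the Killing form: the multiple
`X^*` of the opposite root vector `rootVec b a` with `κ(X^*, rootVec a b) = 1`. -/
def rootVecDual {m : ℕ} (a b : Idx m) : g m :=
  (killingForm ℂ (g m) (rootVec b a) (rootVec a b))⁻¹ • rootVec b a

/-- The index `j`, for `j < n`. -/
def idxP {m : ℕ} (j : Fin m) : Idx m := Sum.inr (Sum.inl j.castSucc)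

/-- The index `j'`, for `j < n`. -/
def idxM {m : ℕ} (j : Fin m) : Idx m := Sum.inr (Sum.inr j.castSucc)

/-- `ω = ∑ X_γ^* ⊗ X_γ` over the roots `γ = ε_j + ε_k`, `j < k < n`, of `𝔷(𝔫) = 𝔤(2)`. -/
def omegaElt (m : ℕ) : g m ⊗[ℂ] g m :=
  ∑ p : Fin m × Fin m with p.1 < p.2,
    rootVecDual (idxP p.1) (idxM p.2) ⊗ₜ[ℂ] rootVec (idxP p.1) (idxM p.2)

/-- `τ₂(X) = ½ (ad(X)² ⊗ Id) ω`. -/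
def tau2 {m : ℕ} (X : g m) : g m ⊗[ℂ] g m :=
  (1 / 2 : ℂ) • LinearMap.rTensor (g m) (LieAlgebra.ad ℂ (g m) X ^ 2) (omegaElt m)

/-- `τ̃₂(Y^*)(X) = Y^*(τ₂(X))`, where `Y^* ∈ W^* ⊂ 𝔤 ⊗ 𝔤` acts on `𝔤 ⊗ 𝔤` through the Killing form. -/
def tau2Tilde {m : ℕ} (Ystar : g m ⊗[ℂ] g m) (X : g m) : ℂ :=
  LinearMap.BilinForm.tmul (killingForm ℂ (g m)) (killingForm ℂ (g m)) Ystar (tau2 X)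

/-- The three indices `0, n, n'` of degree `0`. -/
def midIdx {m : ℕ} : Fin 3 → Idx m :=
  ![Sum.inl (), Sum.inr (Sum.inl (Fin.last m)), Sum.inr (Sum.inr (Fin.last m))]

/-- The root vectors of `𝔤(1)`, a basis of `𝔤(1)`. The roots are
`ε_j`, `ε_j - ε_n`, `ε_j + ε_n` for `j < n`. -/
def x1 {m : ℕ} (p : Fin m × Fin 3) : g m := rootVec (idxP p.1) (midIdx p.2)

/-- The basis of `𝔤(-1)` dual to `x1` with respect to the Killing form. -/
def x1Dual {m : ℕ} (p : Fin m × Fin 3) : g m := rootVecDual (idxP p.1) (midIdx p.2)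

lemma rootVec_mem_gr {m : ℕ} (a b : Idx m) : rootVec a b ∈ gr m (deg a - deg b) := by
  rw [mem_gr_iff]
  intro c d h
  by_contra hne
  apply h
  have h1 : ¬ (a = c ∧ b = d) := by rintro ⟨rfl, rfl⟩; exact hne rfl
  have h2 : ¬ (dualIdx b = c ∧ dualIdx a = d) := by
    rintro ⟨rfl, rfl⟩
    apply hne
    rw [deg_dualIdx, deg_dualIdx]
    ring
  simp [rootVec, h1, h2]

lemma x1Dual_mem {m : ℕ} (p : Fin m × Fin 3) : x1Dual p ∈ nbar m := by
  refine Submodule.mem_sup_left (Submodule.smul_mem _ _ ?_)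
  have h := rootVec_mem_gr (midIdx p.2) (idxP p.1)
  have h0 : deg (midIdx p.2 : Idx m) = 0 := by
    obtain ⟨_, t⟩ := p
    fin_cases t <;> simp [midIdx, deg]
  have h1 : deg (idxP p.1) = 1 := by simp [idxP, deg, Fin.castSucc_ne_last]
  rw [h0, h1] at h
  simpa using h

/-- The coefficients of the homogeneous quadratic polynomial `P = τ̃₂(Y^*)` on `𝔤(1)`: by
polarization, `P = ∑ polarCoeff p q · κ(x1Dual p, ·) κ(x1Dual q, ·)`, so that under
`𝒫²(𝔤(1)) ≅ Sym²(𝔤(-1))` it corresponds to `∑ polarCoeff p q · (x1Dual p)(x1Dual q)`. -/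
def polarCoeff {m : ℕ} (Ystar : g m ⊗[ℂ] g m) (p q : Fin m × Fin 3) : ℂ :=
  (1 / 2 : ℂ) * (tau2Tilde Ystar (x1 p + x1 q) - tau2Tilde Ystar (x1 p) - tau2Tilde Ystar (x1 q))

/-! ## Real forms, the group `N̄₀`, and differential operators for `ℒ_s` -/

/-- A real form `𝔤₀` of `𝔤`, given by its conjugation (`𝔤₀` is the set of fixed points), for which
`𝔮` and the opposite nilradical `𝔫̄` are defined over `ℝ`. -/
structure RealForm (m : ℕ) where
  conj : g m →ₛₗ[starRingEnd ℂ] g m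
  conj_conj : ∀ X, conj (conj X) = X
  conj_lie : ∀ X Y, conj ⁅X, Y⁆ = ⁅conj X, conj Y⁆
  conj_mem_qq : ∀ X ∈ qq m, conj X ∈ qq m
  conj_mem_nbar : ∀ X ∈ nbar m, conj X ∈ nbar m

variable {m : ℕ} (ρ : RealForm m)

/-- `𝔫̄₀ = 𝔫̄ ∩ 𝔤₀`. -/
def nbar0 : Submodule ℝ (g m) where
  carrier := {X | X ∈ nbar m ∧ ρ.conj X = X}
  add_mem' := by
    rintro X Y ⟨hX, hX'⟩ ⟨hY, hY'⟩
    exact ⟨Submodule.add_mem _ hX hY, by rw [map_add, hX', hY']⟩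
  zero_mem' := ⟨Submodule.zero_mem _, map_zero _⟩
  smul_mem' := by
    rintro r X ⟨hX, hX'⟩
    have h : r • X = (r : ℂ) • X := (Complex.coe_smul r X).symm
    refine ⟨?_, ?_⟩
    · rw [h]; exact Submodule.smul_mem _ _ hX
    · rw [h, LinearMap.map_smulₛₗ, hX', Complex.conj_ofReal]

/-- The analytic subgroup `N̄₀` with Lie algebra `𝔫̄₀`, as a group of matrices. -/
def NBar : Subgroup (Mat m)ˣ :=
  Subgroup.closure {u | ∃ X ∈ nbar0 ρ, (u : Mat m) = NormedSpace.exp (X : Mat m)}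

lemma exp_preserves (X : g m) :
    (NormedSpace.exp (X : Mat m))ᵀ * LieAlgebra.Orthogonal.JB (Fin (m + 1)) ℂ
      * NormedSpace.exp (X : Mat m) = LieAlgebra.Orthogonal.JB (Fin (m + 1)) ℂ := by
  set J := LieAlgebra.Orthogonal.JB (Fin (m + 1)) ℂ with hJ
  have hX : (X : Mat m)ᵀ * J = J * (-(X : Mat m)) := by
    have h := X.2
    change (X : Mat m) ∈ skewAdjointMatricesLieSubalgebra J at h
    rwa [mem_skewAdjointMatricesLieSubalgebra, mem_skewAdjointMatricesSubmodule] at h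
  have hunit : IsUnit J := by
    refine IsUnit.of_mul_eq_one
      (Matrix.of fun a b => if b = dualIdx a then (jCoeff a)⁻¹ else 0) ?_
    ext a b
    rw [Matrix.mul_apply, Finset.sum_eq_single (dualIdx a)]
    · by_cases hab : a = b
      · subst hab
        simp [hJ, JB_apply, dualIdx_dualIdx, jCoeff_dualIdx, jCoeff_ne_zero]
      · have hba : ¬ b = a := fun h => hab h.symm
        simp [hJ, JB_apply, dualIdx_dualIdx, hab, hba]
    · intro c _ hc
      simp [hJ, JB_apply, hc]
    · simp
  have hdet : IsUnit J.det := (Matrix.isUnit_iff_isUnit_det _).1 hunit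
  have hXT : (X : Mat m)ᵀ = J * (-(X : Mat m)) * J⁻¹ := by
    rw [← hX, Matrix.mul_assoc, Matrix.mul_nonsing_inv _ hdet, Matrix.mul_one]
  have hE : IsUnit (NormedSpace.exp (X : Mat m)).det :=
    (Matrix.isUnit_iff_isUnit_det _).1 (Matrix.isUnit_exp _)
  rw [← Matrix.exp_transpose, hXT, Matrix.exp_conj _ _ hunit, Matrix.exp_neg,
    Matrix.mul_assoc (J * _), Matrix.nonsing_inv_mul _ hdet, Matrix.mul_one, Matrix.mul_assoc,
    Matrix.nonsing_inv_mul _ hE, Matrix.mul_one]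

/-- The matrices in `N̄₀` preserve the symmetric form. -/
lemma NBar_preserves (u : (Mat m)ˣ) (hu : u ∈ NBar ρ) :
    (u : Mat m)ᵀ * LieAlgebra.Orthogonal.JB (Fin (m + 1)) ℂ * (u : Mat m)
      = LieAlgebra.Orthogonal.JB (Fin (m + 1)) ℂ := by
  induction hu using Subgroup.closure_induction with
  | mem u hu =>
    obtain ⟨X, -, hX⟩ := hu
    rw [hX]
    exact exp_preserves X
  | one => simp
  | mul u v _ _ hu hv =>
    rw [Units.val_mul, Matrix.transpose_mul]
    calc _ = (v : Mat m)ᵀ * ((u : Mat m)ᵀ * LieAlgebra.Orthogonal.JB (Fin (m + 1)) ℂ * u) * v := by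
          simp only [Matrix.mul_assoc]
      _ = _ := by rw [hu, hv]
  | inv u _ hu =>
    have h1 : ((u⁻¹ : (Mat m)ˣ) : Mat m)ᵀ * (u : Mat m)ᵀ = 1 := by
      rw [← Matrix.transpose_mul, Units.mul_inv, Matrix.transpose_one]
    calc _ = ((u⁻¹ : (Mat m)ˣ) : Mat m)ᵀ
          * ((u : Mat m)ᵀ * LieAlgebra.Orthogonal.JB (Fin (m + 1)) ℂ * u)
          * ((u⁻¹ : (Mat m)ˣ) : Mat m) := by rw [hu]
      _ = (((u⁻¹ : (Mat m)ˣ) : Mat m)ᵀ * (u : Mat m)ᵀ) * LieAlgebra.Orthogonal.JB (Fin (m + 1)) ℂ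
          * ((u : Mat m) * ((u⁻¹ : (Mat m)ˣ) : Mat m)) := by simp only [Matrix.mul_assoc]
      _ = _ := by rw [h1, Units.mul_inv, Matrix.one_mul, Matrix.mul_one]

/-- The exponential map `𝔫̄₀ → N̄₀`. -/
def expN (X : nbar0 ρ) : NBar ρ :=
  ⟨(Matrix.isUnit_exp ((X : g m) : Mat m)).unit, Subgroup.subset_closure ⟨X, X.2, rfl⟩⟩

/-- `Ad(u⁻¹) Y = u⁻¹ Y u`. -/
def adInv (u : NBar ρ) (Y : g m) : g m :=
  ⟨((u : (Mat m)ˣ)⁻¹ : (Mat m)ˣ) * (Y : Mat m) * ((u : (Mat m)ˣ) : Mat m), by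
    obtain ⟨u, hu⟩ := u
    have h := NBar_preserves ρ u hu
    have hY := Y.2
    change _ ∈ skewAdjointMatricesLieSubalgebra (LieAlgebra.Orthogonal.JB (Fin (m + 1)) ℂ) at hY
    change _ ∈ skewAdjointMatricesLieSubalgebra (LieAlgebra.Orthogonal.JB (Fin (m + 1)) ℂ)
    rw [mem_skewAdjointMatricesLieSubalgebra, mem_skewAdjointMatricesSubmodule,
      Matrix.IsSkewAdjoint, Matrix.IsAdjointPair] at hY ⊢
    set J := LieAlgebra.Orthogonal.JB (Fin (m + 1)) ℂ
    have h1 : ((u⁻¹ : (Mat m)ˣ) : Mat m)ᵀ * (u : Mat m)ᵀ = 1 := by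
      rw [← Matrix.transpose_mul, Units.mul_inv, Matrix.transpose_one]
    have h2 : ((u⁻¹ : (Mat m)ˣ) : Mat m)ᵀ * J = J * u := by
      calc ((u⁻¹ : (Mat m)ˣ) : Mat m)ᵀ * J = ((u⁻¹ : (Mat m)ˣ) : Mat m)ᵀ * ((u : Mat m)ᵀ * J * u) := by
            rw [h]
        _ = (((u⁻¹ : (Mat m)ˣ) : Mat m)ᵀ * (u : Mat m)ᵀ) * (J * u) := by
            simp only [Matrix.mul_assoc]
        _ = J * u := by rw [h1, Matrix.one_mul]
    have h3 : (u : Mat m)ᵀ * J = J * ((u⁻¹ : (Mat m)ˣ) : Mat m) := by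
      calc (u : Mat m)ᵀ * J = (u : Mat m)ᵀ * J * (u * ((u⁻¹ : (Mat m)ˣ) : Mat m)) := by
            rw [Units.mul_inv, Matrix.mul_one]
        _ = ((u : Mat m)ᵀ * J * u) * ((u⁻¹ : (Mat m)ˣ) : Mat m) := by simp only [Matrix.mul_assoc]
        _ = _ := by rw [h]
    rw [Matrix.transpose_mul, Matrix.transpose_mul]
    calc (u : Mat m)ᵀ * ((Y : Mat m)ᵀ * ((u⁻¹ : (Mat m)ˣ) : Mat m)ᵀ) * J
        = (u : Mat m)ᵀ * ((Y : Mat m)ᵀ * (((u⁻¹ : (Mat m)ˣ) : Mat m)ᵀ * J)) := by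
          simp only [Matrix.mul_assoc]
      _ = (u : Mat m)ᵀ * ((Y : Mat m)ᵀ * J * u) := by rw [h2]; simp only [Matrix.mul_assoc]
      _ = ((u : Mat m)ᵀ * J) * (-(Y : Mat m) * u) := by rw [hY]; simp only [Matrix.mul_assoc]
      _ = J * (-(((u⁻¹ : (Mat m)ˣ) : Mat m) * (Y : Mat m) * u)) := by
          rw [h3]; simp only [Matrix.mul_assoc, Matrix.neg_mul, Matrix.mul_neg]⟩

/-- Smooth functions on `N̄₀`, that is, smooth sections of the trivial bundle `ℒ_s` over `N̄₀`. The
manifold structure is given by the global chart `exp : 𝔫̄₀ → N̄₀`: a function is smooth if it is smooth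
in the coordinates `t ↦ exp (t_1 v_1 + ⋯ + t_d v_d)` for every `v_1, …, v_d ∈ 𝔫̄₀`. -/
def IsSmooth (f : NBar ρ → ℂ) : Prop :=
  ∀ (d : ℕ) (v : Fin d → nbar0 ρ),
    ContDiff ℝ ∞ (fun t : Fin d → ℝ => f (expN ρ (∑ i, t i • v i)))

/-- Infinitesimal right translation by `X ∈ 𝔫̄₀`: `(R(X) f)(u) = d/dt f(u exp(tX))` at `t = 0`. -/
def rightReal (X : nbar0 ρ) (f : NBar ρ → ℂ) (u : NBar ρ) : ℂ :=
  deriv (fun t : ℝ => f (u * expN ρ (t • X))) 0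

/-- The real part of `Z ∈ 𝔫̄` with respect to `𝔫̄ = 𝔫̄₀ ⊕ i 𝔫̄₀`. -/
def rePart (Z : nbar m) : nbar0 ρ :=
  ⟨(1 / 2 : ℂ) • ((Z : g m) + ρ.conj Z),
    Submodule.smul_mem _ _ (Submodule.add_mem _ Z.2 (ρ.conj_mem_nbar _ Z.2)), by
      have h2 : starRingEnd ℂ 2 = 2 := map_ofNat _ 2
      rw [LinearMap.map_smulₛₗ, map_add, ρ.conj_conj, add_comm (ρ.conj (Z : g m))]
      simp [h2]⟩

/-- The imaginary part of `Z ∈ 𝔫̄` with respect to `𝔫̄ = 𝔫̄₀ ⊕ i 𝔫̄₀`. -/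
def imPart (Z : nbar m) : nbar0 ρ :=
  ⟨(-Complex.I / 2 : ℂ) • ((Z : g m) - ρ.conj Z),
    Submodule.smul_mem _ _ (Submodule.sub_mem _ Z.2 (ρ.conj_mem_nbar _ Z.2)), by
      rw [LinearMap.map_smulₛₗ, map_sub, ρ.conj_conj, ← neg_sub, smul_neg, ← neg_smul]
      have h2 : starRingEnd ℂ 2 = 2 := map_ofNat _ 2
      simp [neg_div, h2]⟩

lemma rePart_add_imPart (Z : nbar m) :
    ((rePart ρ Z : g m) + Complex.I • (imPart ρ Z : g m)) = Z := by
  change (1 / 2 : ℂ) • ((Z : g m) + ρ.conj Z)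
    + Complex.I • (-Complex.I / 2 : ℂ) • ((Z : g m) - ρ.conj Z) = Z
  have h : Complex.I * (-Complex.I / 2) = 1 / 2 := by
    rw [mul_div_assoc', mul_neg, Complex.I_mul_I, neg_neg]
  rw [smul_smul, h]
  module

/-- The right translation `R`, extended `ℂ`-linearly to `𝔫̄`. -/
def right (Z : nbar m) (f : NBar ρ → ℂ) (u : NBar ρ) : ℂ :=
  rightReal ρ (rePart ρ Z) f u + Complex.I * rightReal ρ (imPart ρ Z) f u

/-- The action of `Y ∈ 𝔤` on sections of `ℒ_s` over `N̄₀`. If `F` is the extension of `f` to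
`N̄₀ Q₀` with `F(u q) = χ^s(q⁻¹) f(u)`, then
`(Y • f)(u) = d/dt F(exp(-tY) u) = d/dt F(u exp(-t Ad(u⁻¹)Y))` at `t = 0`; decomposing
`Ad(u⁻¹)Y` along `𝔤 = 𝔫̄ ⊕ 𝔮` and using `dχ^s = s λ_𝔮`, this is
`s λ_𝔮((Ad(u⁻¹)Y)_𝔮) f(u) - (R((Ad(u⁻¹)Y)_𝔫̄) f)(u)`. -/
def act (s : ℂ) (Y : g m) (f : NBar ρ → ℂ) (u : NBar ρ) : ℂ :=
  s * lamQ (qPart (adInv ρ u Y)) * f u - right ρ (nbarPart (adInv ρ u Y)) f u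

/-- The differential operator `Ω₂(Y^*) = R(σ(τ̃₂(Y^*)))`. Here the symmetrization is
`σ(x y) = ½ (x y + y x)` for `x, y ∈ 𝔤(-1)`, and `R(x y) = R(x) R(y)`. -/
def Omega2 (Ystar : g m ⊗[ℂ] g m) (f : NBar ρ → ℂ) (u : NBar ρ) : ℂ :=
  ∑ p : Fin m × Fin 3, ∑ q : Fin m × Fin 3, polarCoeff Ystar p q * ((1 / 2 : ℂ) *
    (right ρ ⟨x1Dual p, x1Dual_mem p⟩ (right ρ ⟨x1Dual q, x1Dual_mem q⟩ f) u
      + right ρ ⟨x1Dual q, x1Dual_mem q⟩ (right ρ ⟨x1Dual p, x1Dual_mem p⟩ f) u))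

/-- A finite list of differential operators on sections of `ℒ_s` over `N̄₀` is a conformally invariant
system if it is linearly independent at each point, and if for each `X ∈ 𝔤₀` every commutator
`[X, D_i]` is a combination of the `D_j` whose coefficients are smooth functions. -/
def IsConformallyInvariant (s : ℂ) {d : ℕ} (D : Fin d → (NBar ρ → ℂ) → NBar ρ → ℂ) : Prop :=
  (∀ (u : NBar ρ) (c : Fin d → ℂ),
    (∀ f, IsSmooth ρ f → ∑ i, c i * D i f u = 0) → ∀ i, c i = 0) ∧
  ∀ X : g m, ρ.conj X = X → ∀ i, ∃ C : Fin d → NBar ρ → ℂ, (∀ j, IsSmooth ρ (C j)) ∧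
    ∀ f, IsSmooth ρ f → ∀ u,
      act ρ s X (D i f) u - D i (act ρ s X f) u = ∑ j, C j u * D j f u

end OmegaB

end

/-! Put m = n - 1. Sorting the indices of the matrices by degree identifies 𝔤(1) with ℂ^m ⊗ ℂ³, on
which 𝔩 acts as 𝔤𝔩(m) ⊕ 𝔰𝔬(3). Here 𝔩_{nγ} = 𝔰𝔬(3) ≅ Λ²ℂ³, and 𝔤(±2) is Λ²ℂ^m or its dual. The
polynomials τ̃₂(Y^*), Y^* ∈ W^*, therefore lie in the summand Λ² ⊗ Λ² of the quadratic polynomials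
on ℂ^m ⊗ ℂ³: their coefficients are skew in the outer index and in the middle index separately
(`polarCoeff_antisymm`, `polarCoeff_antisymm'`).

Conformal invariance. Fix Y ∈ 𝔤 and put W = Ad(u⁻¹)Y. An operator f ↦ α(W)f - R(βW)f has a
commutator with R(Z), Z ∈ 𝔫̄, of the same shape (`Op_R_sub_R_Op`). Iterating this expresses [Y•,
R(Z₁)R(Z₂)] at u through W (`actS_RR_sub`). Contract with the coefficients of Y^* and split W by
degree (`sum_commForm`). The 𝔫̄-part contributes nothing. The 𝔤(0)-part W₀ contributes Ω₂([W₀,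
Y^*]), which stays in the system by equivariance (`quadL_lie`). The 𝔤(2)-part contributes a
contraction of skew coefficients with the symmetric form on ℂ³, which is zero. The 𝔤(1)-part
contributes a first order operator: the character gives -2s times a fixed expression, and the double
bracket [Z₂, [Z₁, W]] gives a contraction, again zero, plus two exchanges of indices that each give
+1 by skewness. The total factor is 2(1 - s) (`sum_commForm_one`), so the system closes at s = 1.

If s ≠ 1, matrix coefficients whose second derivatives along 𝔤(-1) vanish at the identity force the
first order term to vanish for every W in the real form, hence for every W in 𝔤 by complex
linearity; one explicit Y^* contradicts this (`contract_eq_zero`,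
`eq_one_of_isConformallyInvariant`). Products of two such matrix coefficients detect all the
coefficients of Y^*, which gives pointwise linear independence (`eq_zero_of_quadL_evalB`).

The analysis is elementary because products of three elements of 𝔫̄ vanish as matrices: the
Baker-Campbell-Hausdorff series stops after one bracket, exp parametrizes N̄₀, and right
translations become affine vector fields.

For the module W, the ideal 𝔩_{nγ} acts on the first tensor factor only and the 𝔤𝔩(m)-block on the
second only, so raising, spreading and lowering generate W from any non-zero vector
(`eq_Wng_of_stable`). A highest weight vector is X_{α_n} ⊗ X_γ. The roots counted in the last claim
are ε_1, ε_2, ε_1 + ε_n and ε_2 + ε_n. -/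

noncomputable section

namespace OmegaB

variable {m : ℕ}

/-! ## The symmetric form and the root vectors -/

/-- The matrix of the symmetric form. -/
abbrev J (m : ℕ) : Mat m := LieAlgebra.Orthogonal.JB (Fin (m + 1)) ℂ

/-- The inverse of the matrix of the symmetric form. -/
def JInv (m : ℕ) : Mat m := Matrix.of fun a b => if b = dualIdx a then (jCoeff a)⁻¹ else 0

lemma dualIdx_eq_iff {a b : Idx m} : dualIdx a = b ↔ a = dualIdx b :=
  ⟨fun h => by rw [← h, dualIdx_dualIdx], fun h => by rw [h, dualIdx_dualIdx]⟩

lemma J_apply (a b : Idx m) : J m a b = if b = dualIdx a then jCoeff a else 0 := JB_apply a b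

/-- The inclusion of `𝔤` in the matrices. -/
def coeMat (m : ℕ) : g m →ₗ[ℂ] Mat m where
  toFun X := X
  map_add' _ _ := rfl
  map_smul' _ _ := rfl

lemma J_mul_JInv : J m * JInv m = 1 := by
  ext a b
  rw [Matrix.mul_apply, Finset.sum_eq_single (dualIdx a)]
  · by_cases hab : a = b
    · subst hab
      simp [JInv, J_apply, dualIdx_dualIdx, jCoeff_dualIdx, jCoeff_ne_zero]
    · have hba : ¬ b = a := fun h => hab h.symm
      simp [JInv, J_apply, dualIdx_dualIdx, hab, hba]
  · intro c _ hc
    simp [J_apply, hc]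
  · simp

lemma JInv_mul_J : JInv m * J m = 1 := mul_eq_one_comm.1 J_mul_JInv

lemma J_transpose : (J m)ᵀ = J m := by
  ext a b
  rw [Matrix.transpose_apply, J_apply, J_apply]
  by_cases h : b = dualIdx a
  · subst h; simp [dualIdx_dualIdx, jCoeff_dualIdx]
  · have : ¬ a = dualIdx b := fun h' => h (by rw [h', dualIdx_dualIdx])
    simp [h, this]

lemma JInv_transpose : (JInv m)ᵀ = JInv m := by
  ext a b
  simp only [Matrix.transpose_apply, JInv, Matrix.of_apply]
  by_cases h : b = dualIdx a
  · subst h; simp [dualIdx_dualIdx, jCoeff_dualIdx]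
  · have : ¬ a = dualIdx b := fun h' => h (by rw [h', dualIdx_dualIdx])
    simp [h, this]

lemma mem_g_iff_transpose (A : Mat m) : A ∈ g m ↔ Aᵀ * J m = -(J m * A) := by
  change A ∈ skewAdjointMatricesLieSubalgebra (J m) ↔ _
  rw [mem_skewAdjointMatricesLieSubalgebra, mem_skewAdjointMatricesSubmodule,
    Matrix.IsSkewAdjoint, Matrix.IsAdjointPair, Matrix.mul_neg]

lemma transpose_mul_J (X : g m) : (X : Mat m)ᵀ * J m = -(J m * (X : Mat m)) :=
  (mem_g_iff_transpose _).1 X.2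

lemma mul_JInv (X : g m) : (X : Mat m) * JInv m = -(JInv m * (X : Mat m)ᵀ) := by
  have h := transpose_mul_J X
  calc (X : Mat m) * JInv m = JInv m * (J m * (X : Mat m)) * JInv m := by
        rw [← Matrix.mul_assoc, JInv_mul_J, Matrix.one_mul]
    _ = JInv m * (-((X : Mat m)ᵀ * J m)) * JInv m := by rw [h, neg_neg]
    _ = -(JInv m * (X : Mat m)ᵀ * (J m * JInv m)) := by
        simp only [Matrix.mul_neg, Matrix.neg_mul, Matrix.mul_assoc]
    _ = _ := by rw [J_mul_JInv, Matrix.mul_one]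

/-- Twice the projection of the matrices onto `𝔤`. -/
def skewPart (m : ℕ) : Mat m →ₗ[ℂ] g m where
  toFun M := ⟨M - JInv m * Mᵀ * J m, by
    rw [mem_g_iff_transpose, Matrix.transpose_sub, Matrix.transpose_mul, Matrix.transpose_mul,
      Matrix.transpose_transpose, J_transpose, JInv_transpose, Matrix.sub_mul, Matrix.mul_sub,
      Matrix.mul_assoc, Matrix.mul_assoc, JInv_mul_J, Matrix.mul_one, Matrix.mul_assoc,
      ← Matrix.mul_assoc (J m) (JInv m), J_mul_JInv, Matrix.one_mul, neg_sub]⟩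
  map_add' M N := by
    ext1
    change M + N - JInv m * (M + N)ᵀ * J m
      = (M - JInv m * Mᵀ * J m) + (N - JInv m * Nᵀ * J m)
    rw [Matrix.transpose_add, Matrix.mul_add, Matrix.add_mul]
    abel
  map_smul' c M := by
    ext1
    change c • M - JInv m * (c • M)ᵀ * J m = c • (M - JInv m * Mᵀ * J m)
    rw [Matrix.transpose_smul, Matrix.mul_smul, Matrix.smul_mul, smul_sub]

lemma coe_skewPart (M : Mat m) : (skewPart m M : Mat m) = M - JInv m * Mᵀ * J m := rfl

lemma coe_lie (X Y : g m) :
    ((⁅X, Y⁆ : g m) : Mat m) = (X : Mat m) * (Y : Mat m) - (Y : Mat m) * (X : Mat m) := rfl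

lemma skewPart_coe (X : g m) : skewPart m X = (2 : ℂ) • X := by
  ext1
  change (X : Mat m) - JInv m * (X : Mat m)ᵀ * J m = (2 : ℂ) • (X : Mat m)
  rw [Matrix.mul_assoc, transpose_mul_J, Matrix.mul_neg, ← Matrix.mul_assoc, JInv_mul_J,
    Matrix.one_mul, two_smul, sub_neg_eq_add]

/-- The twisted transpose `M ↦ JInv Mᵀ J` turns the commutator with X ∈ 𝔤 into itself, since X
anticommutes past `JInv` and `J` up to transposition. Brackets with root vectors thereby reduce to
products with matrix units. -/
lemma lie_skewPart (X : g m) (M : Mat m) :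
    ⁅X, skewPart m M⁆ = skewPart m ((X : Mat m) * M - M * (X : Mat m)) := by
  ext1
  rw [coe_lie, coe_skewPart, coe_skewPart, Matrix.transpose_sub, Matrix.transpose_mul,
    Matrix.transpose_mul]
  have h1 : (X : Mat m) * (JInv m * Mᵀ * J m) = -(JInv m * ((X : Mat m)ᵀ * Mᵀ) * J m) := by
    rw [← Matrix.mul_assoc, ← Matrix.mul_assoc, mul_JInv]
    simp only [Matrix.neg_mul, Matrix.mul_assoc]
  have h2 : JInv m * Mᵀ * J m * (X : Mat m) = -(JInv m * (Mᵀ * (X : Mat m)ᵀ) * J m) := by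
    rw [Matrix.mul_assoc, ← neg_eq_iff_eq_neg.2 (transpose_mul_J X)]
    simp only [Matrix.mul_neg, Matrix.mul_assoc]
  rw [Matrix.mul_sub, Matrix.sub_mul, h1, h2, Matrix.mul_sub, Matrix.sub_mul]
  abel

lemma rootVec_eq_skewPart (a b : Idx m) : rootVec a b = skewPart m (Matrix.single a b 1) := by
  ext1
  rw [coe_skewPart, Matrix.transpose_single]
  change _ - _ = _
  congr 1
  ext c d
  change ((jCoeff a / jCoeff b) • Matrix.single (dualIdx b) (dualIdx a) 1 : Mat m) c d = _
  rw [Matrix.mul_apply, Finset.sum_eq_single a]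
  · rw [Matrix.mul_apply, Finset.sum_eq_single b]
    · rw [J_apply]
      have h : (b = dualIdx c) ↔ dualIdx b = c := by rw [dualIdx_eq_iff]
      simp only [Matrix.smul_apply, Matrix.single_apply, JInv, Matrix.of_apply, smul_eq_mul, h,
        eq_comm (a := d)]
      by_cases h1 : dualIdx b = c
      · subst h1
        by_cases h2 : dualIdx a = d <;> simp [h2, jCoeff_dualIdx]
        field_simp
      · simp [h1]
    · intro e _ he
      simp [he.symm]
    · simp
  · intro e _ he
    rw [Matrix.mul_apply]
    simp [he.symm]
  · simp

/-- The bracket of an element of `𝔤` with a root vector. -/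
lemma lie_rootVec (X : g m) (c d : Idx m) :
    ⁅X, rootVec c d⁆ = ∑ i, (X : Mat m) i c • rootVec i d - ∑ i, (X : Mat m) d i • rootVec c i := by
  simp only [rootVec_eq_skewPart, lie_skewPart, ← map_smul, ← map_sum, ← map_sub]
  congr 2
  · ext a b
    simp [Matrix.sum_apply, Matrix.single_apply, Matrix.mul_apply, ite_and]
  · ext a b
    simp [Matrix.sum_apply, Matrix.single_apply, Matrix.mul_apply, ite_and]

lemma rootVec_apply (a b c d : Idx m) : (rootVec a b : Mat m) c d
    = (if a = c ∧ b = d then 1 else 0)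
      - (if dualIdx b = c ∧ dualIdx a = d then jCoeff a / jCoeff b else 0) := by
  change (Matrix.single a b (1 : ℂ)
    - (jCoeff a / jCoeff b) • Matrix.single (dualIdx b) (dualIdx a) (1 : ℂ)) c d = _
  simp [Matrix.single_apply]

/-- The symmetry of the entries of the elements of `𝔤`. -/
lemma coe_apply_dualIdx (X : g m) (a b : Idx m) :
    (X : Mat m) (dualIdx b) (dualIdx a) = -(jCoeff a / jCoeff b * (X : Mat m) a b) := by
  have h := (mem_g_iff (X : Mat m)).1 X.2 (dualIdx a) b
  rw [dualIdx_dualIdx, jCoeff_dualIdx] at h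
  have := jCoeff_ne_zero b
  field_simp
  linear_combination h

/-- Every root is carried by a pair of indices and by the dual pair; the corresponding vectors
differ by a scalar only. -/
lemma rootVec_dualIdx (a b : Idx m) :
    rootVec (dualIdx b) (dualIdx a) = -(jCoeff b / jCoeff a) • rootVec a b := by
  ext c d
  change (rootVec (dualIdx b) (dualIdx a) : Mat m) c d
    = -(jCoeff b / jCoeff a) * (rootVec a b : Mat m) c d
  rw [rootVec_apply, rootVec_apply]
  have := jCoeff_ne_zero a
  have := jCoeff_ne_zero b
  simp only [dualIdx_dualIdx, jCoeff_dualIdx]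
  split_ifs <;> field_simp <;> ring

/-! ## The Killing form -/

/-- This is the trace of the operator `M ↦ C M D` in the basis of matrix units; the next lemma is
the same for `M ↦ C Mᵀ D`. -/
lemma sum_mul_single_mul (C D : Mat m) :
    ∑ i, ∑ j, (C * Matrix.single i j 1 * D : Mat m) i j = C.trace * D.trace := by
  simp [Matrix.mul_apply, Matrix.single_apply, Matrix.trace, Finset.sum_mul_sum, ite_and,
    -Fintype.sum_sum_type]

lemma sum_mul_single_mul_transpose (C D : Mat m) :
    ∑ i, ∑ j, (C * Matrix.single j i 1 * D : Mat m) i j = (C * Dᵀ).trace := by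
  simp [Matrix.mul_apply, Matrix.single_apply, Matrix.trace, ite_and, -Fintype.sum_sum_type]

lemma trace_mat_eq (T : Mat m →ₗ[ℂ] Mat m) :
    LinearMap.trace ℂ _ T = ∑ i, ∑ j, T (Matrix.single i j 1) i j := by
  rw [LinearMap.trace_eq_matrix_trace ℂ (Matrix.stdBasis ℂ (Idx m) (Idx m)), Matrix.trace,
    Fintype.sum_prod_type]
  refine Finset.sum_congr rfl fun i _ => Finset.sum_congr rfl fun j _ => ?_
  rw [Matrix.diag_apply, LinearMap.toMatrix_apply, Matrix.stdBasis_eq_single]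
  rfl

lemma trace_coe (X : g m) : (X : Mat m).trace = 0 := by
  have h : (X : Mat m).trace = -(X : Mat m).trace := by
    calc (X : Mat m).trace = ((X : Mat m)ᵀ * (J m * JInv m)).trace := by
          rw [J_mul_JInv, Matrix.mul_one, Matrix.trace_transpose]
      _ = (-(J m * (X : Mat m)) * JInv m).trace := by rw [← Matrix.mul_assoc, transpose_mul_J]
      _ = _ := by
          rw [Matrix.neg_mul, Matrix.trace_neg, Matrix.trace_mul_comm, ← Matrix.mul_assoc,
            JInv_mul_J, Matrix.one_mul]
  linear_combination (1 / 2 : ℂ) * h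

lemma coe_skewPart_single (i j : Idx m) :
    (skewPart m (Matrix.single i j 1) : Mat m)
      = Matrix.single i j 1 - JInv m * Matrix.single j i 1 * J m := by
  rw [coe_skewPart, Matrix.transpose_single]

/-- The Killing form of `𝔰𝔬(2n + 1)` is `2n - 1` times the trace form. -/
lemma killingForm_eq (X Y : g m) :
    killingForm ℂ (g m) X Y = (2 * m + 1 : ℂ) * ((X : Mat m) * (Y : Mat m)).trace := by
  set T : g m →ₗ[ℂ] g m := LieAlgebra.ad ℂ (g m) X ∘ₗ LieAlgebra.ad ℂ (g m) Y with hT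
  -- Half of `skewPart` is a left inverse of the inclusion `coeMat`, so by cyclicity the trace of T
  -- on 𝔤 becomes a trace on all matrices.
  have hid : T = (T ∘ₗ ((1 / 2 : ℂ) • skewPart m)) ∘ₗ (coeMat m) := by
    ext1 Z
    change T Z = T ((1 / 2 : ℂ) • skewPart m (Z : Mat m))
    rw [skewPart_coe, smul_smul]
    norm_num
  rw [killingForm_apply_apply, ← hT, hid, LinearMap.trace_comp_comm', trace_mat_eq]
  set A := (X : Mat m) with hA
  set B := (Y : Mat m) with hB
  have hval : ∀ i j, ((coeMat m) ∘ₗ T ∘ₗ ((1 / 2 : ℂ) • skewPart m)) (Matrix.single i j 1)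
      = (1 / 2 : ℂ) • ((A * B * Matrix.single i j 1 * 1 - A * Matrix.single i j 1 * B
        - B * Matrix.single i j 1 * A + 1 * Matrix.single i j 1 * (B * A))
        - ((A * B * JInv m) * Matrix.single j i 1 * J m
          - (A * JInv m) * Matrix.single j i 1 * (J m * B)
          - (B * JInv m) * Matrix.single j i 1 * (J m * A)
          + JInv m * Matrix.single j i 1 * (J m * (B * A)))) := by
    intro i j
    change ((⁅X, ⁅Y, (1 / 2 : ℂ) • skewPart m (Matrix.single i j 1)⁆⁆ : g m) : Mat m) = _
    rw [lie_smul, lie_smul]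
    change (1 / 2 : ℂ) • ((⁅X, ⁅Y, skewPart m (Matrix.single i j 1)⁆⁆ : g m) : Mat m) = _
    rw [coe_lie, coe_lie, coe_skewPart_single]
    congr 1
    simp only [Matrix.mul_sub, Matrix.sub_mul, Matrix.mul_assoc, Matrix.one_mul, Matrix.mul_one,
      ← hA, ← hB]
    abel
  have hAt : Aᵀ * J m = -(J m * A) := transpose_mul_J X
  have hBt : Bᵀ * J m = -(J m * B) := transpose_mul_J Y
  have hcyc : ∀ C : Mat m, (JInv m * (J m * C)).trace = C.trace := fun C => by
    rw [← Matrix.mul_assoc, JInv_mul_J, Matrix.one_mul]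
  -- The four transposed terms together contribute -4 tr(AB). Of the other four, two contribute (2m
  -- + 3) tr(AB) each and two are products of vanishing traces. Half of the total is (2m + 1)
  -- tr(AB).
  have e1 : (A * B * JInv m * (J m)ᵀ).trace = (A * B).trace := by
    rw [J_transpose, Matrix.mul_assoc _ (JInv m), JInv_mul_J, Matrix.mul_one]
  have e2 : (A * JInv m * (J m * B)ᵀ).trace = -(A * B).trace := by
    rw [Matrix.transpose_mul, J_transpose, hBt, Matrix.mul_neg, Matrix.trace_neg,
      Matrix.mul_assoc, ← Matrix.mul_assoc (JInv m), JInv_mul_J, Matrix.one_mul]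
  have e3 : (B * JInv m * (J m * A)ᵀ).trace = -(A * B).trace := by
    rw [Matrix.transpose_mul, J_transpose, hAt, Matrix.mul_neg, Matrix.trace_neg,
      Matrix.mul_assoc, ← Matrix.mul_assoc (JInv m), JInv_mul_J, Matrix.one_mul,
      Matrix.trace_mul_comm]
  have e4 : (JInv m * (J m * (B * A))ᵀ).trace = (A * B).trace := by
    rw [Matrix.transpose_mul, J_transpose, Matrix.transpose_mul, Matrix.mul_assoc, hBt,
      Matrix.mul_neg, ← Matrix.mul_assoc, hAt, Matrix.neg_mul, neg_neg, Matrix.mul_assoc, hcyc]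
  have htr : (1 : Mat m).trace = (2 * m + 3 : ℂ) := by
    simp [Matrix.trace_one]
    ring
  simp only [hval, Matrix.smul_apply, Matrix.sub_apply, Matrix.add_apply, smul_eq_mul,
    ← Finset.mul_sum, Finset.sum_sub_distrib, Finset.sum_add_distrib, sum_mul_single_mul,
    sum_mul_single_mul_transpose, e1, e2, e3, e4, htr]
  rw [Matrix.trace_mul_comm B A, trace_coe X, trace_coe Y]
  ring

/-- The two matrix units in a root vector read off dual entries of X, and skewness makes their
contributions equal; this is the factor 2. -/
lemma killingForm_rootVec (X : g m) (a b : Idx m) :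
    killingForm ℂ (g m) X (rootVec a b) = (2 * (2 * m + 1) : ℂ) * (X : Mat m) b a := by
  rw [killingForm_eq, Matrix.trace]
  have h : ∀ i, ((X : Mat m) * (rootVec a b : Mat m)).diag i
      = (if i = b then (X : Mat m) b a else 0)
        - (if i = dualIdx a then jCoeff a / jCoeff b * (X : Mat m) (dualIdx a) (dualIdx b) else 0) := by
    intro i
    rw [Matrix.diag_apply, Matrix.mul_apply]
    simp only [rootVec_apply, mul_sub, Finset.sum_sub_distrib, mul_ite, mul_one, mul_zero]
    congr 1
    · simp only [ite_and, Finset.sum_ite_eq, Finset.mem_univ, if_true, eq_comm (a := b)]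
      split_ifs with h
      · rw [h]
      · rfl
    · simp only [ite_and, Finset.sum_ite_eq, Finset.mem_univ, if_true, eq_comm (a := dualIdx a)]
      split_ifs with h
      · rw [h]; ring
      · rfl
  simp only [h, Finset.sum_sub_distrib, Finset.sum_ite_eq', Finset.mem_univ, if_true]
  rw [coe_apply_dualIdx]
  have := jCoeff_ne_zero a
  have := jCoeff_ne_zero b
  field_simp
  ring

/-- The Killing form of a root vector with the opposite one. -/
def kap (m : ℕ) : ℂ := 2 * (2 * m + 1)

lemma kap_ne_zero : kap m ≠ 0 := by
  rw [kap]
  exact_mod_cast (by positivity : (2 * (2 * m + 1) : ℕ) ≠ 0)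

lemma rootVecDual_eq {a b : Idx m} (h : b ≠ dualIdx a) :
    rootVecDual a b = (kap m)⁻¹ • rootVec b a := by
  have h2 : dualIdx a ≠ b := fun h' => h h'.symm
  rw [rootVecDual, killingForm_rootVec, rootVec_apply]
  simp [h2, kap]

/-! ## The opposite nilradical and its exponential map -/

lemma deg_cases (c : Idx m) : deg c = -1 ∨ deg c = 0 ∨ deg c = 1 := by
  rcases c with _ | j | j
  · simp [deg]
  · by_cases h : j = Fin.last m <;> simp [deg, h]
  · by_cases h : j = Fin.last m <;> simp [deg, h]

/-- The matrices that strictly lower the degree. -/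
def IsLower (M : Mat m) : Prop := ∀ a b, M a b ≠ 0 → deg a < deg b

/-- Degrees take only the values -1, 0, 1, so a strict drop is a drop by one or two. -/
lemma mem_nbar_iff (X : g m) : X ∈ nbar m ↔ IsLower (X : Mat m) := by
  constructor
  · intro hX a b hab
    obtain ⟨Y, hY, Z, hZ, rfl⟩ := Submodule.mem_sup.1 hX
    rw [mem_gr_iff] at hY hZ
    by_cases h : (Y : Mat m) a b = 0
    · have h2 : (Z : Mat m) a b ≠ 0 := by
        intro h2
        apply hab
        change (Y : Mat m) a b + (Z : Mat m) a b = 0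
        rw [h, h2, add_zero]
      have := hZ a b h2
      omega
    · have := hY a b h
      omega
  · intro hX
    have h : X = nbarPart X := by
      ext a b
      change (X : Mat m) a b = (if deg a - deg b = -1 then (X : Mat m) a b else 0)
        + (if deg a - deg b = -2 then (X : Mat m) a b else 0)
      by_cases hab : (X : Mat m) a b = 0
      · simp [hab]
      · have h1 := hX a b hab
        rcases deg_cases a with ha | ha | ha <;> rcases deg_cases b with hb | hb | hb <;>
          simp_all
    rw [h]
    exact (nbarPart X).2

/-- Three strict drops do not fit between the degrees 1 and -1. All later truncations of series rest
on this. -/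
lemma IsLower.mul_mul {A B C : Mat m} (hA : IsLower A) (hB : IsLower B) (hC : IsLower C) :
    A * B * C = 0 := by
  ext a d
  rw [Matrix.mul_apply]
  refine Finset.sum_eq_zero fun c _ => ?_
  rw [Matrix.mul_apply, Finset.sum_mul]
  refine Finset.sum_eq_zero fun b _ => ?_
  by_contra h
  have h1 := hA a b (fun h0 => h (by rw [h0, zero_mul, zero_mul]))
  have h2 := hB b c (fun h0 => h (by rw [h0, mul_zero, zero_mul]))
  have h3 := hC c d (fun h0 => h (by rw [h0, mul_zero]))
  rcases deg_cases a with ha | ha | ha <;> rcases deg_cases d with hd | hd | hd <;> omega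

lemma nbar_mul_mul {X Y Z : g m} (hX : X ∈ nbar m) (hY : Y ∈ nbar m) (hZ : Z ∈ nbar m) :
    (X : Mat m) * (Y : Mat m) * (Z : Mat m) = 0 :=
  ((mem_nbar_iff X).1 hX).mul_mul ((mem_nbar_iff Y).1 hY) ((mem_nbar_iff Z).1 hZ)

lemma exp_eq_of_cube_eq_zero {M : Mat m} (h : M * M * M = 0) :
    NormedSpace.exp M = 1 + M + (1 / 2 : ℂ) • (M * M) := by
  rw [NormedSpace.exp_eq_tsum ℂ]
  dsimp only
  rw [tsum_eq_sum (s := Finset.range 3)]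
  · simp [Finset.sum_range_succ, pow_two]
  · intro n hn
    obtain ⟨k, rfl⟩ : ∃ k, n = 3 + k := ⟨n - 3, by simp at hn; omega⟩
    rw [pow_add, pow_succ, pow_two, h, zero_mul, smul_zero]

lemma exp_coe {X : g m} (hX : X ∈ nbar m) :
    NormedSpace.exp (X : Mat m) = 1 + (X : Mat m) + (1 / 2 : ℂ) • ((X : Mat m) * (X : Mat m)) :=
  exp_eq_of_cube_eq_zero (nbar_mul_mul hX hX hX)

lemma lie_mem_nbar {X Y : g m} (hX : X ∈ nbar m) (hY : Y ∈ nbar m) : ⁅X, Y⁆ ∈ nbar m := by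
  rw [mem_nbar_iff] at *
  intro a b hab
  rw [coe_lie, Matrix.sub_apply, Matrix.mul_apply, Matrix.mul_apply] at hab
  by_contra hlt
  apply hab
  have aux : ∀ A B : Mat m, IsLower A → IsLower B → ∑ j, A a j * B j b = 0 := by
    intro A B hA hB
    refine Finset.sum_eq_zero fun j _ => ?_
    by_contra h
    have h1 := hA a j (fun h0 => h (by rw [h0, zero_mul]))
    have h2 := hB j b (fun h0 => h (by rw [h0, mul_zero]))
    omega
  rw [aux _ _ hX hY, aux _ _ hY hX, sub_zero]

lemma lie_lie_nbar {X Y Z : g m} (hX : X ∈ nbar m) (hY : Y ∈ nbar m) (hZ : Z ∈ nbar m) :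
    ⁅X, ⁅Y, Z⁆⁆ = 0 := by
  ext1
  rw [coe_lie, coe_lie, Matrix.mul_sub, Matrix.sub_mul, ← Matrix.mul_assoc, ← Matrix.mul_assoc,
    nbar_mul_mul hX hY hZ, nbar_mul_mul hX hZ hY, nbar_mul_mul hY hZ hX, nbar_mul_mul hZ hY hX]
  simp

/-! ### Left-invariant vector fields of a two-step nilpotent group in linear coordinates -/

section VectorFields

variable {V : Type*} [AddCommGroup V] [Module ℝ V] {d : ℕ} (e : V ≃ₗ[ℝ] (Fin d → ℝ))
  (L : V →ₗ[ℝ] V →ₗ[ℝ] V)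

/-- In coordinates `e`, the vector field `t ↦ Z + ½ L(t, Z)`. When `L` is the bracket of a two-step
nilpotent Lie algebra, this is the left-invariant vector field of `Z`. -/
def vecField (Z : V) (t : Fin d → ℝ) : Fin d → ℝ := e (Z + (1 / 2 : ℝ) • L (e.symm t) Z)

/-- The linear part of `vecField`. -/
def vecFieldLin (Z : V) : (Fin d → ℝ) →L[ℝ] (Fin d → ℝ) :=
  (e.toLinearMap ∘ₗ ((1 / 2 : ℝ) • L.flip Z) ∘ₗ e.symm.toLinearMap).toContinuousLinearMap

lemma vecFieldLin_apply (Z : V) (v : Fin d → ℝ) :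
    vecFieldLin e L Z v = e ((1 / 2 : ℝ) • L (e.symm v) Z) := rfl

lemma vecField_eq (Z : V) : vecField e L Z = fun t => e Z + vecFieldLin e L Z t := by
  funext t
  rw [vecField, vecFieldLin_apply, map_add]

lemma vecField_add (Z Z' : V) (t : Fin d → ℝ) :
    vecField e L (Z + Z') t = vecField e L Z t + vecField e L Z' t := by
  rw [vecField, vecField, vecField, ← map_add, map_add (L _)]
  congr 1
  module

lemma vecField_smul (r : ℝ) (Z : V) (t : Fin d → ℝ) :
    vecField e L (r • Z) t = r • vecField e L Z t := by
  rw [vecField, vecField, ← map_smul e, map_smul (L _)]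
  congr 1
  module

lemma contDiff_vecField (Z : V) : ContDiff ℝ ∞ (vecField e L Z) := by
  rw [vecField_eq]
  exact contDiff_const.add (ContinuousLinearMap.contDiff _)

lemma fderiv_vecField (Z : V) (t : Fin d → ℝ) :
    fderiv ℝ (vecField e L Z) t = vecFieldLin e L Z := by
  rw [vecField_eq, fderiv_const_add, ContinuousLinearMap.fderiv]

/-- The right side is the Baker-Campbell-Hausdorff product of t and rZ. Right translation by a
one-parameter group thus moves along a straight line in the coordinates. -/
lemma symm_add_smul_vecField (r : ℝ) (Z : V) (t : Fin d → ℝ) :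
    e.symm (t + r • vecField e L Z t)
      = e.symm t + r • Z + (1 / 2 : ℝ) • L (e.symm t) (r • Z) := by
  rw [map_add, map_smul, vecField, LinearEquiv.symm_apply_apply, map_smul (L _)]
  module

/-- Both fields are affine, and their linear parts contribute half of L(X, Z) each. The quadratic
corrections are double brackets, which `h0` kills. -/
lemma lieBracket_vecField (h0 : ∀ A B C, L A (L B C) = 0) (hs : ∀ A B, L A B = -L B A) (X Z : V)
    (t : Fin d → ℝ) :
    VectorField.lieBracket ℝ (vecField e L X) (vecField e L Z) t = vecField e L (L X Z) t := by
  rw [VectorField.lieBracket, fderiv_vecField, fderiv_vecField, vecFieldLin_apply,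
    vecFieldLin_apply, vecField, vecField, vecField, LinearEquiv.symm_apply_apply,
    LinearEquiv.symm_apply_apply, ← map_sub]
  congr 1
  generalize e.symm t = T
  have e1 : L (X + (1 / 2 : ℝ) • L T X) Z = L X Z := by
    rw [map_add, LinearMap.add_apply, map_smul, LinearMap.smul_apply, hs (L T X) Z, h0, neg_zero,
      smul_zero, add_zero]
  have e2 : L (Z + (1 / 2 : ℝ) • L T Z) X = -L X Z := by
    rw [map_add, LinearMap.add_apply, map_smul, LinearMap.smul_apply, hs (L T Z) X, h0, neg_zero,
      smul_zero, add_zero, hs Z X]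
  rw [e1, e2, h0, smul_zero, add_zero]
  module

end VectorFields

/-! ### The group law of N̄₀ and its global chart -/

variable (ρ : RealForm m)

lemma coe_real_smul (r : ℝ) (X : g m) : r • X = (r : ℂ) • X := (Complex.coe_smul r X).symm

/-- The bracket of `𝔫̄₀`. -/
def lie0 : nbar0 ρ →ₗ[ℝ] nbar0 ρ →ₗ[ℝ] nbar0 ρ :=
  LinearMap.mk₂ ℝ (fun X Y => ⟨⁅(X : g m), (Y : g m)⁆, lie_mem_nbar X.2.1 Y.2.1, by
      rw [ρ.conj_lie, X.2.2, Y.2.2]⟩)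
    (fun X X' Y => Subtype.ext (add_lie (X : g m) (X' : g m) (Y : g m)))
    (fun r X Y => Subtype.ext (by
      change ⁅r • (X : g m), (Y : g m)⁆ = r • ⁅(X : g m), (Y : g m)⁆
      rw [coe_real_smul, coe_real_smul, smul_lie]))
    (fun X Y Y' => Subtype.ext (lie_add (X : g m) (Y : g m) (Y' : g m)))
    (fun r X Y => Subtype.ext (by
      change ⁅(X : g m), r • (Y : g m)⁆ = r • ⁅(X : g m), (Y : g m)⁆
      rw [coe_real_smul, coe_real_smul, lie_smul]))

lemma coe_lie0 (X Y : nbar0 ρ) : (lie0 ρ X Y : g m) = ⁅(X : g m), (Y : g m)⁆ := rfl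

variable {ρ} in
lemma coe_expN (X : nbar0 ρ) : ((expN ρ X : (Mat m)ˣ) : Mat m)
    = 1 + ((X : g m) : Mat m) + (1 / 2 : ℂ) • (((X : g m) : Mat m) * ((X : g m) : Mat m)) :=
  exp_coe X.2.1

variable {ρ} in
lemma NBar_ext {u v : NBar ρ} (h : ((u : (Mat m)ˣ) : Mat m) = ((v : (Mat m)ˣ) : Mat m)) : u = v :=
  Subtype.ext (Units.ext h)

/-- After the mixed words of length three are dropped, both sides agree in degree two because the
half commutator in S corrects (A + B)²/2 to A²/2 + AB + B²/2. -/
lemma exp_mul_of_cube_eq_zero {A B S : Mat m} (h2 : A * A * B = 0) (h3 : A * B * A = 0) (h4 : A * B * B = 0) (h5 : B * A * A = 0) (h6 : B * A * B = 0)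
    (h7 : B * B * A = 0) (hS : S = A + B + (1 / 2 : ℂ) • (A * B - B * A)) :
    (1 + A + (1 / 2 : ℂ) • (A * A)) * (1 + B + (1 / 2 : ℂ) • (B * B))
      = 1 + S + (1 / 2 : ℂ) • (S * S) := by
  subst hS
  simp only [mul_add, add_mul, mul_sub, sub_mul, mul_one, one_mul, smul_mul_assoc, mul_smul_comm,
    ← mul_assoc, h2, h3, h4, h5, h6, h7, smul_zero, add_zero,
    sub_zero, smul_add, smul_sub]
  module

/-- The Baker-Campbell-Hausdorff formula in `𝔫̄₀`. -/
lemma expN_mul (X Y : nbar0 ρ) :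
    expN ρ X * expN ρ Y = expN ρ (X + Y + (1 / 2 : ℝ) • lie0 ρ X Y) := by
  apply NBar_ext
  change ((expN ρ X : (Mat m)ˣ) : Mat m) * ((expN ρ Y : (Mat m)ˣ) : Mat m) = _
  rw [coe_expN, coe_expN, coe_expN]
  have h3 : ∀ U V W : nbar0 ρ, ((U : g m) : Mat m) * ((V : g m) : Mat m) * ((W : g m) : Mat m) = 0 :=
    fun U V W => nbar_mul_mul U.2.1 V.2.1 W.2.1
  refine exp_mul_of_cube_eq_zero (h3 _ _ _) (h3 _ _ _) (h3 _ _ _) (h3 _ _ _) (h3 _ _ _) (h3 _ _ _) ?_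
  have h : ((X + Y + (1 / 2 : ℝ) • lie0 ρ X Y : nbar0 ρ) : g m)
      = (X : g m) + (Y : g m) + (1 / 2 : ℂ) • ⁅(X : g m), (Y : g m)⁆ := by
    rw [Submodule.coe_add, Submodule.coe_add, Submodule.coe_smul, coe_lie0, coe_real_smul]
    norm_num
  rw [h]
  rfl

lemma expN_zero : expN ρ 0 = 1 := by
  apply NBar_ext
  rw [coe_expN]
  simp

lemma expN_mul_neg (X : nbar0 ρ) : expN ρ X * expN ρ (-X) = 1 := by
  rw [expN_mul, map_neg]
  have : lie0 ρ X X = 0 := Subtype.ext (lie_self (X : g m))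
  rw [this, neg_zero, smul_zero, add_zero, add_neg_cancel, expN_zero]

lemma expN_neg (X : nbar0 ρ) : expN ρ (-X) = (expN ρ X)⁻¹ :=
  eq_inv_of_mul_eq_one_right (expN_mul_neg ρ X)

/-- The product formula shows that the exponentials are already closed under products and inverses,
so they exhaust the group that they generate. -/
lemma expN_surjective : Function.Surjective (expN ρ) := by
  rintro ⟨u, hu⟩
  induction hu using Subgroup.closure_induction with
  | mem u hu =>
    obtain ⟨X, hX, h⟩ := hu
    exact ⟨⟨X, hX⟩, NBar_ext h.symm⟩
  | one => exact ⟨0, expN_zero ρ⟩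
  | mul u v hu hv ihu ihv =>
    obtain ⟨X, hX⟩ := ihu
    obtain ⟨Y, hY⟩ := ihv
    exact ⟨_, (expN_mul ρ X Y).symm.trans (by rw [hX, hY]; rfl)⟩
  | inv u hu ihu =>
    obtain ⟨X, hX⟩ := ihu
    exact ⟨-X, (expN_neg ρ X).trans (by rw [hX]; rfl)⟩

instance : FiniteDimensional ℝ (g m) := FiniteDimensional.complexToReal (g m)

/-- The dimension of `𝔫̄₀`. -/
abbrev dimN : ℕ := Module.finrank ℝ (nbar0 ρ)

/-- A basis of `𝔫̄₀`. -/
def bas : Module.Basis (Fin (dimN ρ)) ℝ (nbar0 ρ) := Module.finBasis ℝ (nbar0 ρ)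

/-- The coordinates on `𝔫̄₀`. -/
abbrev Coord : Type := Fin (dimN ρ) → ℝ

/-- The chart of `N̄₀`. -/
def chart (t : Coord ρ) : NBar ρ := expN ρ ((bas ρ).equivFun.symm t)

lemma chart_surjective : Function.Surjective (chart ρ) :=
  (expN_surjective ρ).comp (bas ρ).equivFun.symm.surjective

/-- Any finite family of vectors of 𝔫̄₀ factors linearly through one basis, so a single chart tests
smoothness. -/
lemma isSmooth_iff (f : NBar ρ → ℂ) : IsSmooth ρ f ↔ ContDiff ℝ ∞ (fun t => f (chart ρ t)) := by
  constructor
  · intro h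
    have := h (dimN ρ) (bas ρ)
    simpa only [chart, Module.Basis.equivFun_symm_apply] using this
  · intro h d v
    set l : (Fin d → ℝ) →ₗ[ℝ] Coord ρ :=
      (bas ρ).equivFun.toLinearMap ∘ₗ (Fintype.linearCombination ℝ v) with hl
    have h2 : (fun t : Fin d → ℝ => f (expN ρ (∑ i, t i • v i)))
        = (fun t => f (chart ρ t)) ∘ l.toContinuousLinearMap := by
      funext t
      change _ = f (expN ρ ((bas ρ).equivFun.symm ((bas ρ).equivFun
        (Fintype.linearCombination ℝ v t))))
      rw [LinearEquiv.symm_apply_apply, Fintype.linearCombination_apply]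
    rw [h2]
    exact h.comp l.toContinuousLinearMap.contDiff

/-- The left-invariant vector field of `Z ∈ 𝔫̄₀` in the chart. -/
def field (Z : nbar0 ρ) : Coord ρ → Coord ρ := vecField (bas ρ).equivFun (lie0 ρ) Z

lemma chart_mul_expN (Z : nbar0 ρ) (t : Coord ρ) (r : ℝ) :
    chart ρ t * expN ρ (r • Z) = chart ρ (t + r • field ρ Z t) := by
  rw [chart, chart, expN_mul]
  exact congrArg _ (symm_add_smul_vecField (bas ρ).equivFun (lie0 ρ) r Z t).symm

/-- The path u exp(rZ) is a straight line in the chart by `chart_mul_expN`, so its derivative is a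
directional derivative. -/
lemma rightReal_chart {f : NBar ρ → ℂ} (hf : IsSmooth ρ f) (Z : nbar0 ρ) (t : Coord ρ) :
    rightReal ρ Z f (chart ρ t) = fderiv ℝ (fun t => f (chart ρ t)) t (field ρ Z t) := by
  rw [isSmooth_iff] at hf
  rw [← (hf.differentiable (by simp) t).lineDeriv_eq_fderiv, rightReal, lineDeriv]
  simp only [chart_mul_expN]

lemma IsSmooth.rightReal {f : NBar ρ → ℂ} (hf : IsSmooth ρ f) (Z : nbar0 ρ) :
    IsSmooth ρ (rightReal ρ Z f) := by
  rw [isSmooth_iff]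
  simp only [rightReal_chart ρ hf]
  rw [isSmooth_iff] at hf
  exact (hf.fderiv_right (by simp)).clm_apply (contDiff_vecField _ _ Z)

lemma rightReal_add {f : NBar ρ → ℂ} (hf : IsSmooth ρ f) (X Z : nbar0 ρ) (u : NBar ρ) :
    rightReal ρ (X + Z) f u = rightReal ρ X f u + rightReal ρ Z f u := by
  obtain ⟨t, rfl⟩ := chart_surjective ρ u
  rw [rightReal_chart ρ hf, rightReal_chart ρ hf, rightReal_chart ρ hf, field, vecField_add, map_add]
  rfl

lemma rightReal_smul {f : NBar ρ → ℂ} (hf : IsSmooth ρ f) (r : ℝ) (Z : nbar0 ρ) (u : NBar ρ) :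
    rightReal ρ (r • Z) f u = (r : ℂ) * rightReal ρ Z f u := by
  obtain ⟨t, rfl⟩ := chart_surjective ρ u
  rw [rightReal_chart ρ hf, rightReal_chart ρ hf, field, vecField_smul, map_smul, Complex.real_smul]
  rfl

/-- Symmetry of the second derivative of f leaves only the bracket of the two vector fields, which
is the field of the Lie bracket. -/
lemma rightReal_lie {f : NBar ρ → ℂ} (hf : IsSmooth ρ f) (X Z : nbar0 ρ) (u : NBar ρ) :
    rightReal ρ X (rightReal ρ Z f) u - rightReal ρ Z (rightReal ρ X f) u
      = rightReal ρ (lie0 ρ X Z) f u := by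
  obtain ⟨t, rfl⟩ := chart_surjective ρ u
  rw [rightReal_chart ρ (hf.rightReal ρ Z), rightReal_chart ρ (hf.rightReal ρ X),
    rightReal_chart ρ hf]
  simp only [rightReal_chart ρ hf]
  have hF := (isSmooth_iff ρ f).1 hf
  have hd : ∀ Z, DifferentiableAt ℝ (field ρ Z) t := fun Z =>
    (contDiff_vecField _ _ Z).differentiable (by simp) t
  rw [← VectorField.fderiv_apply_lieBracket (n := ∞) hF.contDiffAt (by
    rw [minSmoothness_of_isRCLikeNormedField]; exact WithTop.coe_le_coe.2 le_top) (hd Z) (hd X)]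
  refine congrArg _ (lieBracket_vecField (bas ρ).equivFun (lie0 ρ)
    (fun A B C => Subtype.ext (lie_lie_nbar A.2.1 B.2.1 C.2.1))
    (fun A B => Subtype.ext (lie_skew (A : g m) (B : g m)).symm) X Z t)

/-! ## Smooth functions and left-invariant derivations -/

lemma grProj_add_grProj {X : g m} (hX : X ∈ nbar m) : grProj m (-1) X + grProj m (-2) X = X := by
  rw [mem_nbar_iff] at hX
  ext a b
  change (if deg a - deg b = -1 then (X : Mat m) a b else 0)
    + (if deg a - deg b = -2 then (X : Mat m) a b else 0) = (X : Mat m) a b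
  by_cases hab : (X : Mat m) a b = 0
  · simp [hab]
  · have h1 := hX a b hab
    rcases deg_cases a with ha | ha | ha <;> rcases deg_cases b with hb | hb | hb <;>
      simp_all

lemma coe_nbarPart_of_mem {X : g m} (hX : X ∈ nbar m) : (nbarPart X : g m) = X :=
  grProj_add_grProj hX

lemma nbarPart_add (X Y : g m) : nbarPart (X + Y) = nbarPart X + nbarPart Y := by
  apply Subtype.ext
  change grProj m (-1) (X + Y) + grProj m (-2) (X + Y)
    = (grProj m (-1) X + grProj m (-2) X) + (grProj m (-1) Y + grProj m (-2) Y)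
  rw [map_add, map_add]
  abel

lemma nbarPart_smul (c : ℂ) (X : g m) : nbarPart (c • X) = c • nbarPart X := by
  apply Subtype.ext
  change grProj m (-1) (c • X) + grProj m (-2) (c • X) = c • (grProj m (-1) X + grProj m (-2) X)
  rw [map_smul, map_smul, smul_add]

/-! ### Real and imaginary parts in 𝔫̄ -/

variable (ρ : RealForm m)

variable {ρ} in
lemma coe_nbar0_add (X Y : nbar0 ρ) : ((X + Y : nbar0 ρ) : g m) = (X : g m) + (Y : g m) := rfl

variable {ρ} in
lemma coe_nbar0_smul (r : ℝ) (X : nbar0 ρ) : ((r • X : nbar0 ρ) : g m) = (r : ℂ) • (X : g m) :=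
  coe_real_smul r (X : g m)

/-- Conjugation fixes a and b and changes the sign of `Complex.I`, so it separates them. The rules
for sums, multiples and brackets then follow by exhibiting a decomposition. -/
lemma re_im_unique (Z : nbar m) (a b : nbar0 ρ) (h : (Z : g m) = (a : g m) + Complex.I • (b : g m)) :
    rePart ρ Z = a ∧ imPart ρ Z = b := by
  have hc : ρ.conj (Z : g m) = (a : g m) - Complex.I • (b : g m) := by
    rw [h, map_add, LinearMap.map_smulₛₗ, a.2.2, b.2.2, Complex.conj_I, neg_smul, sub_eq_add_neg]
  constructor
  · apply Subtype.ext
    change (1 / 2 : ℂ) • ((Z : g m) + ρ.conj Z) = a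
    rw [hc, h]
    module
  · apply Subtype.ext
    change (-Complex.I / 2 : ℂ) • ((Z : g m) - ρ.conj Z) = b
    have : (Z : g m) - ρ.conj Z = (2 * Complex.I) • (b : g m) := by
      rw [hc, h]
      module
    rw [this, smul_smul]
    have h2 : -Complex.I / 2 * (2 * Complex.I) = 1 := by
      linear_combination -Complex.I_mul_I
    rw [h2, one_smul]

lemma coe_eq_re_im (Z : nbar m) :
    (Z : g m) = (rePart ρ Z : g m) + Complex.I • (imPart ρ Z : g m) := (rePart_add_imPart ρ Z).symm

lemma re_im_add (Z Z' : nbar m) : rePart ρ (Z + Z') = rePart ρ Z + rePart ρ Z' ∧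
    imPart ρ (Z + Z') = imPart ρ Z + imPart ρ Z' := by
  apply re_im_unique
  change (Z : g m) + (Z' : g m) = ((rePart ρ Z : g m) + (rePart ρ Z' : g m))
    + Complex.I • ((imPart ρ Z : g m) + (imPart ρ Z' : g m))
  conv_lhs => rw [coe_eq_re_im ρ Z, coe_eq_re_im ρ Z']
  module

lemma smul_add_I_smul {M : Type*} [AddCommGroup M] [Module ℂ M] (c : ℂ) (a b : M) :
    c • (a + Complex.I • b) = ((c.re : ℂ) • a + ((-c.im : ℝ) : ℂ) • b)
      + Complex.I • ((c.im : ℂ) • a + (c.re : ℂ) • b) := by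
  have hc : c = c.re + c.im * Complex.I := (Complex.re_add_im c).symm
  have h2 : c * Complex.I = -c.im + Complex.I * c.re := by
    linear_combination Complex.I * hc + (c.im : ℂ) * Complex.I_mul_I
  rw [smul_add, smul_smul, h2]
  nth_rewrite 1 [hc]
  push_cast
  module

lemma add_add_I_smul_add {M : Type*} [AddCommGroup M] [Module ℂ M] (a b c d : M) :
    (a + b) + Complex.I • (c + d) = (a + Complex.I • c) + (b + Complex.I • d) := by
  module

lemma lie_add_I_smul_add_I_smul {L : Type*} [LieRing L] [LieAlgebra ℂ L] (a b c d : L) :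
    ⁅a + Complex.I • b, c + Complex.I • d⁆
      = (⁅a, c⁆ + ((-1 : ℝ) : ℂ) • ⁅b, d⁆) + Complex.I • (⁅a, d⁆ + ⁅b, c⁆) := by
  simp only [lie_add, add_lie, lie_smul, smul_lie, smul_smul, Complex.I_mul_I, smul_add]
  push_cast
  module

lemma re_im_smul (c : ℂ) (Z : nbar m) :
    rePart ρ (c • Z) = c.re • rePart ρ Z + (-c.im) • imPart ρ Z ∧
    imPart ρ (c • Z) = c.im • rePart ρ Z + c.re • imPart ρ Z := by
  apply re_im_unique
  rw [coe_nbar0_add, coe_nbar0_add, coe_nbar0_smul, coe_nbar0_smul, coe_nbar0_smul, coe_nbar0_smul]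
  exact (congrArg (fun W => c • W) (coe_eq_re_im ρ Z)).trans (smul_add_I_smul _ _ _)

lemma re_im_lie {X Y : g m} (hX : X ∈ nbar m) (hY : Y ∈ nbar m) :
    rePart ρ ⟨⁅X, Y⁆, lie_mem_nbar hX hY⟩
      = lie0 ρ (rePart ρ ⟨X, hX⟩) (rePart ρ ⟨Y, hY⟩)
        + (-1 : ℝ) • lie0 ρ (imPart ρ ⟨X, hX⟩) (imPart ρ ⟨Y, hY⟩) ∧
    imPart ρ ⟨⁅X, Y⁆, lie_mem_nbar hX hY⟩
      = lie0 ρ (rePart ρ ⟨X, hX⟩) (imPart ρ ⟨Y, hY⟩)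
        + lie0 ρ (imPart ρ ⟨X, hX⟩) (rePart ρ ⟨Y, hY⟩) := by
  apply re_im_unique
  have h : ∀ a b c d : nbar0 ρ, ⁅(a : g m) + Complex.I • (b : g m), (c : g m) + Complex.I • (d : g m)⁆
      = ((lie0 ρ a c + (-1 : ℝ) • lie0 ρ b d : nbar0 ρ) : g m)
        + Complex.I • ((lie0 ρ a d + lie0 ρ b c : nbar0 ρ) : g m) := fun a b c d =>
    (lie_add_I_smul_add_I_smul (a : g m) (b : g m) (c : g m) (d : g m)).trans
      (congrArg (fun W => ⁅(a : g m), (c : g m)⁆ + W + Complex.I • (⁅(a : g m), (d : g m)⁆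
        + ⁅(b : g m), (c : g m)⁆)) (coe_nbar0_smul (-1) (lie0 ρ b d)).symm)
  exact (congrArg₂ (fun A B : g m => ⁅A, B⁆) (coe_eq_re_im ρ ⟨X, hX⟩)
    (coe_eq_re_im ρ ⟨Y, hY⟩)).trans (h _ _ _ _)

/-! ### Smooth functions as an algebra with derivations -/

/-- The algebra of the smooth functions on `N̄₀`. -/
def smoothAlg : Subalgebra ℂ (NBar ρ → ℂ) where
  carrier := {f | IsSmooth ρ f}
  add_mem' := by
    intro f f' hf hf'
    rw [Set.mem_ofPred_eq, isSmooth_iff] at *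
    exact hf.add hf'
  mul_mem' := by
    intro f f' hf hf'
    rw [Set.mem_ofPred_eq, isSmooth_iff] at *
    exact hf.mul hf'
  algebraMap_mem' c := by
    rw [Set.mem_ofPred_eq, isSmooth_iff]
    exact contDiff_const

/-- The type of the smooth functions on `N̄₀`. -/
def Smooth : Type := smoothAlg ρ

instance : CommRing (Smooth ρ) := inferInstanceAs (CommRing (smoothAlg ρ))

instance : Algebra ℂ (Smooth ρ) := inferInstanceAs (Algebra ℂ (smoothAlg ρ))

variable {ρ}

/-- The function underlying an element of `Smooth`. -/
def Smooth.fn (f : Smooth ρ) : NBar ρ → ℂ := f.1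

instance : CoeFun (Smooth ρ) (fun _ => NBar ρ → ℂ) := ⟨Smooth.fn⟩

lemma Smooth.isSmooth (f : Smooth ρ) : IsSmooth ρ f := f.2

/-- A smooth function, as an element of `Smooth`. -/
def Smooth.mk (f : NBar ρ → ℂ) (hf : IsSmooth ρ f) : Smooth ρ := ⟨f, hf⟩

lemma Smooth.add_apply (f f' : Smooth ρ) (u : NBar ρ) : (f + f') u = f u + f' u := rfl

lemma Smooth.sub_apply (f f' : Smooth ρ) (u : NBar ρ) : (f - f') u = f u - f' u := rfl

lemma Smooth.neg_apply (f : Smooth ρ) (u : NBar ρ) : (-f) u = -f u := rfl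

lemma Smooth.mul_apply (f f' : Smooth ρ) (u : NBar ρ) : (f * f') u = f u * f' u := rfl

lemma Smooth.smul_apply (c : ℂ) (f : Smooth ρ) (u : NBar ρ) : (c • f) u = c * f u := rfl

/-- Evaluation at a point. -/
def Smooth.evalAt (u : NBar ρ) : Smooth ρ →ₗ[ℂ] ℂ where
  toFun f := f u
  map_add' _ _ := rfl
  map_smul' _ _ := rfl

lemma Smooth.sum_apply {ι : Type*} (s : Finset ι) (f : ι → Smooth ρ) (u : NBar ρ) :
    (∑ i ∈ s, f i) u = ∑ i ∈ s, f i u :=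
  map_sum (Smooth.evalAt u) f s

lemma Smooth.ext {f f' : Smooth ρ} (h : ∀ u, f u = f' u) : f = f' := Subtype.ext (funext h)

lemma Smooth.differentiableAt (f : Smooth ρ) (t : Coord ρ) :
    DifferentiableAt ℝ (fun t => f (chart ρ t)) t :=
  ((isSmooth_iff ρ _).1 f.isSmooth).differentiable (by simp) t

variable (ρ)

lemma rightReal_fun_add (X : nbar0 ρ) (f f' : Smooth ρ) (u : NBar ρ) :
    rightReal ρ X (f + f' : Smooth ρ).fn u = rightReal ρ X f u + rightReal ρ X f' u := by
  obtain ⟨t, rfl⟩ := chart_surjective ρ u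
  have h : (fun t => (f + f' : Smooth ρ).fn (chart ρ t))
      = fun t => f (chart ρ t) + f' (chart ρ t) := rfl
  rw [rightReal_chart ρ (f + f').isSmooth, rightReal_chart ρ f.isSmooth, rightReal_chart ρ f'.isSmooth, h,
    fderiv_fun_add (f.differentiableAt t) (f'.differentiableAt t)]
  rfl

lemma rightReal_fun_smul (X : nbar0 ρ) (c : ℂ) (f : Smooth ρ) (u : NBar ρ) :
    rightReal ρ X (c • f : Smooth ρ).fn u = c * rightReal ρ X f u := by
  obtain ⟨t, rfl⟩ := chart_surjective ρ u
  have h : (fun t => (c • f : Smooth ρ).fn (chart ρ t))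
      = fun t => c * f (chart ρ t) := rfl
  rw [rightReal_chart ρ (c • f).isSmooth, rightReal_chart ρ f.isSmooth, h,
    fderiv_const_mul (f.differentiableAt t), smul_apply, smul_eq_mul]

lemma rightReal_fun_mul (X : nbar0 ρ) (f f' : Smooth ρ) (u : NBar ρ) :
    rightReal ρ X (f * f' : Smooth ρ).fn u = f u * rightReal ρ X f' u
      + f' u * rightReal ρ X f u := by
  obtain ⟨t, rfl⟩ := chart_surjective ρ u
  have h : (fun t => (f * f' : Smooth ρ).fn (chart ρ t))
      = fun t => f (chart ρ t) * f' (chart ρ t) := rfl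
  rw [rightReal_chart ρ (f * f').isSmooth, rightReal_chart ρ f.isSmooth, rightReal_chart ρ f'.isSmooth, h,
    fderiv_fun_mul (f.differentiableAt t) (f'.differentiableAt t)]
  rfl

/-- The infinitesimal right translation by `X ∈ 𝔫̄₀`, as a linear map. -/
def rLin (X : nbar0 ρ) : Smooth ρ →ₗ[ℂ] Smooth ρ where
  toFun f := Smooth.mk (rightReal ρ X f) (IsSmooth.rightReal ρ f.isSmooth X)
  map_add' f f' := Smooth.ext (rightReal_fun_add ρ X f f')
  map_smul' c f := Smooth.ext (rightReal_fun_smul ρ X c f)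

/-- The infinitesimal right translation by `X ∈ 𝔫̄₀`, as a derivation. -/
def rDer (X : nbar0 ρ) : Derivation ℂ (Smooth ρ) (Smooth ρ) :=
  Derivation.mk' (rLin ρ X) fun f f' => Smooth.ext (rightReal_fun_mul ρ X f f')

lemma rDer_add (X Z : nbar0 ρ) : rDer ρ (X + Z) = rDer ρ X + rDer ρ Z := by
  ext1 f
  exact Smooth.ext fun u => rightReal_add ρ f.isSmooth X Z u

lemma rDer_smul (r : ℝ) (X : nbar0 ρ) : rDer ρ (r • X) = (r : ℂ) • rDer ρ X := by
  ext1 f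
  exact Smooth.ext fun u => rightReal_smul ρ f.isSmooth r X u

lemma rDer_smul_add_smul (r r' : ℝ) (X X' : nbar0 ρ) :
    rDer ρ (r • X + r' • X') = (r : ℂ) • rDer ρ X + (r' : ℂ) • rDer ρ X' :=
  (rDer_add ρ _ _).trans (congrArg₂ (fun a b => a + b) (rDer_smul ρ r X) (rDer_smul ρ r' X'))

lemma rDer_lie (X Z : nbar0 ρ) : rDer ρ (lie0 ρ X Z) = ⁅rDer ρ X, rDer ρ Z⁆ := by
  ext1 f
  rw [Derivation.commutator_apply]
  exact Smooth.ext fun u => (rightReal_lie ρ f.isSmooth X Z u).symm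

/-- The right translation `R` on smooth functions, as a derivation. It is extended to `𝔤` by means
of the projection onto `𝔫̄`. -/
def R : g m →ₗ[ℂ] Derivation ℂ (Smooth ρ) (Smooth ρ) where
  toFun Z := rDer ρ (rePart ρ (nbarPart Z)) + Complex.I • rDer ρ (imPart ρ (nbarPart Z))
  map_add' Z Z' := by
    have h1 : rDer ρ (rePart ρ (nbarPart (Z + Z')))
        = rDer ρ (rePart ρ (nbarPart Z)) + rDer ρ (rePart ρ (nbarPart Z')) := by
      rw [nbarPart_add, (re_im_add ρ _ _).1]
      exact rDer_add ρ _ _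
    have h2 : rDer ρ (imPart ρ (nbarPart (Z + Z')))
        = rDer ρ (imPart ρ (nbarPart Z)) + rDer ρ (imPart ρ (nbarPart Z')) := by
      rw [nbarPart_add, (re_im_add ρ _ _).2]
      exact rDer_add ρ _ _
    exact (congrArg₂ (fun D D' => D + Complex.I • D') h1 h2).trans (add_add_I_smul_add _ _ _ _)
  map_smul' c Z := by
    have h1 : rDer ρ (rePart ρ (nbarPart (c • Z))) = (c.re : ℂ) • rDer ρ (rePart ρ (nbarPart Z))
        + ((-c.im : ℝ) : ℂ) • rDer ρ (imPart ρ (nbarPart Z)) := by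
      rw [nbarPart_smul, (re_im_smul ρ _ _).1]
      exact rDer_smul_add_smul ρ _ _ _ _
    have h2 : rDer ρ (imPart ρ (nbarPart (c • Z))) = (c.im : ℂ) • rDer ρ (rePart ρ (nbarPart Z))
        + (c.re : ℂ) • rDer ρ (imPart ρ (nbarPart Z)) := by
      rw [nbarPart_smul, (re_im_smul ρ _ _).2]
      exact rDer_smul_add_smul ρ _ _ _ _
    exact (congrArg₂ (fun D D' => D + Complex.I • D') h1 h2).trans (smul_add_I_smul c _ _).symm

lemma R_eq (Z : g m) : R ρ Z
    = rDer ρ (rePart ρ (nbarPart Z)) + Complex.I • rDer ρ (imPart ρ (nbarPart Z)) := rfl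

lemma R_apply (Z : g m) (f : Smooth ρ) (u : NBar ρ) :
    R ρ Z f u = right ρ (nbarPart Z) f u := rfl

lemma nbarPart_of_mem {X : g m} (hX : X ∈ nbar m) : nbarPart X = ⟨X, hX⟩ :=
  Subtype.ext (coe_nbarPart_of_mem hX)

lemma R_lie_aux (a b c d : Derivation ℂ (Smooth ρ) (Smooth ρ)) :
    (⁅a, c⁆ + ((-1 : ℝ) : ℂ) • ⁅b, d⁆) + Complex.I • (⁅a, d⁆ + ⁅b, c⁆)
      = ⁅a + Complex.I • b, c + Complex.I • d⁆ :=
  (lie_add_I_smul_add_I_smul a b c d).symm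

/-- Bilinear expansion over 𝔫̄₀ ⊕ i𝔫̄₀ reduces this to real right translations. Membership in 𝔫̄
matters: elsewhere `R` sees only a projection, which does not respect brackets. -/
lemma R_lie {X Z : g m} (hX : X ∈ nbar m) (hZ : Z ∈ nbar m) : R ρ ⁅X, Z⁆ = ⁅R ρ X, R ρ Z⁆ := by
  have h1 : ∀ a b c d : nbar0 ρ, rDer ρ (lie0 ρ a c + (-1 : ℝ) • lie0 ρ b d)
      = ⁅rDer ρ a, rDer ρ c⁆ + ((-1 : ℝ) : ℂ) • ⁅rDer ρ b, rDer ρ d⁆ := fun a b c d =>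
    (rDer_add ρ _ _).trans (congrArg₂ (fun a b => a + b) (rDer_lie ρ a c)
      ((rDer_smul ρ (-1) _).trans (congrArg (fun D => ((-1 : ℝ) : ℂ) • D) (rDer_lie ρ b d))))
  have h2 : ∀ a b c d : nbar0 ρ, rDer ρ (lie0 ρ a d + lie0 ρ b c)
      = ⁅rDer ρ a, rDer ρ d⁆ + ⁅rDer ρ b, rDer ρ c⁆ := fun a b c d =>
    (rDer_add ρ _ _).trans (congrArg₂ (fun a b => a + b) (rDer_lie ρ a d) (rDer_lie ρ b c))
  rw [R_eq, R_eq, R_eq, nbarPart_of_mem hX, nbarPart_of_mem hZ,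
    nbarPart_of_mem (lie_mem_nbar hX hZ), (re_im_lie ρ hX hZ).1, (re_im_lie ρ hX hZ).2]
  exact (congrArg₂ (fun D D' => D + Complex.I • D') (h1 (rePart ρ ⟨X, hX⟩) (imPart ρ ⟨X, hX⟩)
    (rePart ρ ⟨Z, hZ⟩) (imPart ρ ⟨Z, hZ⟩)) (h2 (rePart ρ ⟨X, hX⟩) (imPart ρ ⟨X, hX⟩)
    (rePart ρ ⟨Z, hZ⟩) (imPart ρ ⟨Z, hZ⟩))).trans (R_lie_aux ρ _ _ _ _)

/-! ## Matrix coefficients -/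

lemma contDiff_chart_apply (a b : Idx m) :
    ContDiff ℝ ∞ (fun t => ((chart ρ t : (Mat m)ˣ) : Mat m) a b) := by
  have hlin : ∀ a b : Idx m, ContDiff ℝ ∞
      (fun t : Coord ρ => (((bas ρ).equivFun.symm t : g m) : Mat m) a b) := by
    intro a b
    let l : Coord ρ →ₗ[ℝ] ℂ :=
      { toFun := fun t => (((bas ρ).equivFun.symm t : g m) : Mat m) a b
        map_add' := fun t t' => by
          rw [map_add]
          rfl
        map_smul' := fun r t => by
          rw [map_smul]
          rfl }
    exact l.toContinuousLinearMap.contDiff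
  have h : (fun t => ((chart ρ t : (Mat m)ˣ) : Mat m) a b)
      = fun t => (1 : Mat m) a b + (((bas ρ).equivFun.symm t : g m) : Mat m) a b
        + (1 / 2 : ℂ) * ∑ c, (((bas ρ).equivFun.symm t : g m) : Mat m) a c
          * (((bas ρ).equivFun.symm t : g m) : Mat m) c b := by
    funext t
    rw [chart, coe_expN, Matrix.add_apply, Matrix.add_apply, Matrix.smul_apply, Matrix.mul_apply,
      smul_eq_mul]
  rw [h]
  exact (contDiff_const.add (hlin a b)).add
    (contDiff_const.mul (ContDiff.sum fun c _ => (hlin a c).mul (hlin c b)))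

lemma contDiff_chart_inv_apply (a b : Idx m) :
    ContDiff ℝ ∞ (fun t => (((chart ρ t : (Mat m)ˣ)⁻¹ : (Mat m)ˣ) : Mat m) a b) := by
  have h : (fun t => (((chart ρ t : (Mat m)ˣ)⁻¹ : (Mat m)ˣ) : Mat m) a b)
      = fun t => ((chart ρ (-t) : (Mat m)ˣ) : Mat m) a b := by
    funext t
    rw [chart, chart, map_neg, expN_neg]
    rfl
  rw [h]
  exact (contDiff_chart_apply ρ a b).comp contDiff_neg

lemma linearMap_mat_apply (l : Mat m →ₗ[ℂ] ℂ) (M : Mat m) :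
    l M = ∑ a, ∑ b, M a b * l (Matrix.single a b 1) := by
  conv_lhs => rw [Matrix.matrix_eq_sum_single M]
  simp only [map_sum]
  refine Finset.sum_congr rfl fun a _ => Finset.sum_congr rfl fun b _ => ?_
  rw [← smul_eq_mul, ← map_smul, Matrix.smul_single, smul_eq_mul, mul_one]

lemma contDiff_linearMap_mat {E : Type*} [NormedAddCommGroup E] [NormedSpace ℝ E] {M : E → Mat m}
    (h : ∀ a b, ContDiff ℝ ∞ (fun t => M t a b)) (l : Mat m →ₗ[ℂ] ℂ) :
    ContDiff ℝ ∞ (fun t => l (M t)) := by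
  have : (fun t => l (M t)) = fun t => ∑ a, ∑ b, M t a b * l (Matrix.single a b 1) :=
    funext fun t => linearMap_mat_apply l (M t)
  rw [this]
  exact ContDiff.sum fun a _ => ContDiff.sum fun b _ => (h a b).mul contDiff_const

lemma contDiff_mat_mul {E : Type*} [NormedAddCommGroup E] [NormedSpace ℝ E] {M N : E → Mat m}
    (hM : ∀ a b, ContDiff ℝ ∞ (fun t => M t a b)) (hN : ∀ a b, ContDiff ℝ ∞ (fun t => N t a b))
    (a b : Idx m) : ContDiff ℝ ∞ (fun t => (M t * N t : Mat m) a b) := by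
  simp only [Matrix.mul_apply]
  exact ContDiff.sum fun c _ => (hM a c).mul (hN c b)

/-- The function `u ↦ l(u)` for a linear form `l` on the matrices. -/
def matFun (l : Mat m →ₗ[ℂ] ℂ) : Smooth ρ :=
  Smooth.mk (fun u => l ((u : (Mat m)ˣ) : Mat m)) <| by
    rw [isSmooth_iff]
    exact contDiff_linearMap_mat (contDiff_chart_apply ρ) l

/-- The function `u ↦ L(Ad(u⁻¹)Y)` for a linear form `L` on `𝔤`. -/
def adFun (Y : g m) (L : g m →ₗ[ℂ] ℂ) : Smooth ρ :=
  Smooth.mk (fun u => L (adInv ρ u Y)) <| by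
    rw [isSmooth_iff]
    -- A linear form on 𝔤 is extended to all matrices through half of `skewPart`, so smoothness
    -- follows from that of the matrix entries.
    have h : ∀ t, L (adInv ρ (chart ρ t) Y) = ((1 / 2 : ℂ) • (L ∘ₗ skewPart m))
        ((((chart ρ t : (Mat m)ˣ)⁻¹ : (Mat m)ˣ) : Mat m) * (Y : Mat m)
          * ((chart ρ t : (Mat m)ˣ) : Mat m)) := by
      intro t
      change _ = (1 / 2 : ℂ) * L (skewPart m (adInv ρ (chart ρ t) Y))
      rw [skewPart_coe, map_smul, smul_eq_mul]
      ring
    rw [funext h]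
    exact contDiff_linearMap_mat (contDiff_mat_mul (contDiff_mat_mul (N := fun _ => (Y : Mat m))
      (contDiff_chart_inv_apply ρ) fun a b => contDiff_const) (contDiff_chart_apply ρ)) _

/-- The exponentials of 𝔫̄ are quadratic in the parameter, so conjugation by them is a polynomial of
degree at most four. -/
lemma deriv_quartic {F : ℝ → ℂ} (a0 a1 a2 a3 a4 : ℂ)
    (h : ∀ r : ℝ, F r = a0 + r * a1 + r ^ 2 * a2 + r ^ 3 * a3 + r ^ 4 * a4) : deriv F 0 = a1 := by
  have hF : F = fun r : ℝ =>
      (fun z : ℂ => a0 + z * a1 + z ^ 2 * a2 + z ^ 3 * a3 + z ^ 4 * a4) r := funext h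
  have hd : HasDerivAt (fun z : ℂ => a0 + z * a1 + z ^ 2 * a2 + z ^ 3 * a3 + z ^ 4 * a4) a1
      ((0 : ℝ) : ℂ) := by
    have h1 := ((((hasDerivAt_id ((0 : ℝ) : ℂ)).mul_const a1).const_add a0).add
      ((hasDerivAt_pow 2 ((0 : ℝ) : ℂ)).mul_const a2)).add
      ((hasDerivAt_pow 3 ((0 : ℝ) : ℂ)).mul_const a3) |>.add
      ((hasDerivAt_pow 4 ((0 : ℝ) : ℂ)).mul_const a4)
    exact h1.congr_deriv (by simp)
  rw [hF]
  exact hd.comp_ofReal.deriv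

lemma coe_expN_smul (X : nbar0 ρ) (r : ℝ) : ((expN ρ (r • X) : (Mat m)ˣ) : Mat m)
    = 1 + (r : ℂ) • ((X : g m) : Mat m)
      + ((r : ℂ) ^ 2 / 2) • (((X : g m) : Mat m) * ((X : g m) : Mat m)) := by
  have h : (((r • X : nbar0 ρ) : g m) : Mat m) = (r : ℂ) • ((X : g m) : Mat m) :=
    congrArg (fun Z : g m => (Z : Mat m)) (coe_real_smul r (X : g m))
  rw [coe_expN, h, smul_mul_smul_comm, smul_smul]
  congr 2
  ring

lemma rightReal_matFun (X : nbar0 ρ) (l : Mat m →ₗ[ℂ] ℂ) (u : NBar ρ) :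
    rightReal ρ X (matFun ρ l) u = l (((u : (Mat m)ˣ) : Mat m) * ((X : g m) : Mat m)) := by
  refine deriv_quartic (l ((u : (Mat m)ˣ) : Mat m)) _
    ((1 / 2 : ℂ) * l (((u : (Mat m)ˣ) : Mat m) * (((X : g m) : Mat m) * ((X : g m) : Mat m))))
    0 0 fun r => ?_
  change l (((u : (Mat m)ˣ) : Mat m) * ((expN ρ (r • X) : (Mat m)ˣ) : Mat m)) = _
  rw [coe_expN_smul, mul_add, mul_add, mul_one, mul_smul_comm, mul_smul_comm, map_add, map_add,
    map_smul, map_smul, smul_eq_mul, smul_eq_mul]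
  ring

lemma coe_adInv (u : NBar ρ) (Y : g m) : (adInv ρ u Y : Mat m)
    = (((u : (Mat m)ˣ)⁻¹ : (Mat m)ˣ) : Mat m) * (Y : Mat m) * ((u : (Mat m)ˣ) : Mat m) := rfl

lemma adInv_mul (u v : NBar ρ) (Y : g m) : adInv ρ (u * v) Y = adInv ρ v (adInv ρ u Y) := by
  ext1
  rw [coe_adInv, coe_adInv, coe_adInv]
  change (((u : (Mat m)ˣ) * (v : (Mat m)ˣ))⁻¹ : (Mat m)ˣ).val * (Y : Mat m)
    * (((u : (Mat m)ˣ) : Mat m) * ((v : (Mat m)ˣ) : Mat m)) = _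
  rw [mul_inv_rev, Units.val_mul]
  simp only [mul_assoc]

lemma adInv_one (Y : g m) : adInv ρ 1 Y = Y := by
  ext1
  rw [coe_adInv]
  change ((1 : (Mat m)ˣ)⁻¹ : (Mat m)ˣ).val * (Y : Mat m) * ((1 : (Mat m)ˣ) : Mat m) = _
  simp

/-- Only the linear term, the commutator of W with X, is used afterwards; the higher coefficients
merely have to be independent of r. -/
lemma coe_adInv_expN_smul (X : nbar0 ρ) (W : g m) (r : ℝ) :
    (adInv ρ (expN ρ (r • X)) W : Mat m)
      = (W : Mat m) + (r : ℂ) • ((W : Mat m) * ((X : g m) : Mat m) - ((X : g m) : Mat m) * (W : Mat m))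
        + ((r : ℂ) ^ 2) • ((1 / 2 : ℂ) • ((W : Mat m) * (((X : g m) : Mat m) * ((X : g m) : Mat m)))
          - ((X : g m) : Mat m) * (W : Mat m) * ((X : g m) : Mat m)
          + (1 / 2 : ℂ) • ((((X : g m) : Mat m) * ((X : g m) : Mat m)) * (W : Mat m)))
        + ((r : ℂ) ^ 3) • ((1 / 2 : ℂ) • ((((X : g m) : Mat m) * ((X : g m) : Mat m)) * (W : Mat m)
            * ((X : g m) : Mat m))
          - (1 / 2 : ℂ) • (((X : g m) : Mat m) * (W : Mat m)
            * (((X : g m) : Mat m) * ((X : g m) : Mat m))))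
        + ((r : ℂ) ^ 4) • ((1 / 4 : ℂ) • ((((X : g m) : Mat m) * ((X : g m) : Mat m)) * (W : Mat m)
            * (((X : g m) : Mat m) * ((X : g m) : Mat m)))) := by
  have hinv : (((expN ρ (r • X) : (Mat m)ˣ)⁻¹ : (Mat m)ˣ) : Mat m)
      = 1 + (-r : ℂ) • ((X : g m) : Mat m)
      + ((r : ℂ) ^ 2 / 2) • (((X : g m) : Mat m) * ((X : g m) : Mat m)) := by
    have h : (((expN ρ (r • X) : (Mat m)ˣ)⁻¹ : (Mat m)ˣ) : Mat m)
        = ((expN ρ ((-r) • X) : (Mat m)ˣ) : Mat m) := by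
      rw [neg_smul, expN_neg]
      rfl
    rw [h, coe_expN_smul]
    push_cast
    ring_nf
  rw [coe_adInv, hinv, coe_expN_smul]
  generalize ((X : g m) : Mat m) = A
  generalize (W : Mat m) = B
  simp only [mul_add, add_mul, mul_one, one_mul, smul_mul_assoc, mul_smul_comm, smul_add, smul_sub,
    smul_smul, mul_assoc]
  module

/-- The sign comes from Ad(exp(-rX)), whose derivative at r = 0 is -ad X. -/
lemma rightReal_adFun (X : nbar0 ρ) (Y : g m) (L : g m →ₗ[ℂ] ℂ) (u : NBar ρ) :
    rightReal ρ X (adFun ρ Y L) u = -L ⁅(X : g m), adInv ρ u Y⁆ := by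
  set W := adInv ρ u Y with hW
  set l : Mat m →ₗ[ℂ] ℂ := (1 / 2 : ℂ) • (L ∘ₗ skewPart m) with hl
  have hLl : ∀ Z : g m, L Z = l (Z : Mat m) := by
    intro Z
    change _ = (1 / 2 : ℂ) * L (skewPart m Z)
    rw [skewPart_coe, map_smul, smul_eq_mul]
    ring
  have h : -L ⁅(X : g m), W⁆
      = l ((W : Mat m) * ((X : g m) : Mat m) - ((X : g m) : Mat m) * (W : Mat m)) := by
    rw [hLl, coe_lie, ← map_neg, neg_sub]
  rw [h]
  have hr : ∀ r : ℝ, adFun ρ Y L (u * expN ρ (r • X))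
      = l (adInv ρ (expN ρ (r • X)) W : Mat m) := by
    intro r
    change L (adInv ρ (u * expN ρ (r • X)) Y) = _
    rw [adInv_mul, ← hW, hLl]
  obtain ⟨c2, c3, c4, hc⟩ : ∃ c2 c3 c4 : Mat m, ∀ r : ℝ, (adInv ρ (expN ρ (r • X)) W : Mat m)
      = (W : Mat m) + (r : ℂ) • ((W : Mat m) * ((X : g m) : Mat m) - ((X : g m) : Mat m) * (W : Mat m))
        + ((r : ℂ) ^ 2) • c2 + ((r : ℂ) ^ 3) • c3 + ((r : ℂ) ^ 4) • c4 :=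
    ⟨_, _, _, coe_adInv_expN_smul ρ X W⟩
  refine deriv_quartic (F := fun r : ℝ => adFun ρ Y L (u * expN ρ (r • X)))
    (l (W : Mat m)) _ (l c2) (l c3) (l c4) fun r => ?_
  rw [hr, hc, map_add, map_add, map_add, map_add, map_smul l (r : ℂ),
    map_smul l ((r : ℂ) ^ 2), map_smul l ((r : ℂ) ^ 3), map_smul l ((r : ℂ) ^ 4), smul_eq_mul,
    smul_eq_mul, smul_eq_mul, smul_eq_mul]

lemma R_matFun {Z : g m} (hZ : Z ∈ nbar m) (l : Mat m →ₗ[ℂ] ℂ) :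
    R ρ Z (matFun ρ l) = matFun ρ (l ∘ₗ LinearMap.mulRight ℂ (Z : Mat m)) := by
  refine Smooth.ext fun u => ?_
  rw [R_apply, right, rightReal_matFun, rightReal_matFun, nbarPart_of_mem hZ]
  change _ = l (((u : (Mat m)ˣ) : Mat m) * (Z : Mat m))
  have h : (Z : Mat m) = ((rePart ρ ⟨Z, hZ⟩ : g m) : Mat m)
      + Complex.I • ((imPart ρ ⟨Z, hZ⟩ : g m) : Mat m) :=
    congrArg (fun Z : g m => (Z : Mat m)) (coe_eq_re_im ρ ⟨Z, hZ⟩)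
  rw [h, mul_add, mul_smul_comm, map_add, map_smul, smul_eq_mul]

lemma R_adFun {Z : g m} (hZ : Z ∈ nbar m) (Y : g m) (L : g m →ₗ[ℂ] ℂ) :
    R ρ Z (adFun ρ Y L) = -adFun ρ Y (L ∘ₗ (LieAlgebra.ad ℂ (g m) Z)) := by
  refine Smooth.ext fun u => ?_
  rw [R_apply, right, rightReal_adFun, rightReal_adFun, nbarPart_of_mem hZ]
  change _ = -L ⁅Z, adInv ρ u Y⁆
  have h : Z = (rePart ρ ⟨Z, hZ⟩ : g m) + Complex.I • (imPart ρ ⟨Z, hZ⟩ : g m) :=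
    coe_eq_re_im ρ ⟨Z, hZ⟩
  conv_rhs => rw [h, add_lie, smul_lie, map_add, map_smul, smul_eq_mul]
  ring

/-! ## Operators of first order and their commutators with right translations -/

/-- The projection of `𝔤` onto `𝔫̄`. -/
def prN (m : ℕ) : g m →ₗ[ℂ] g m := grProj m (-1) + grProj m (-2)

lemma prN_mem (X : g m) : prN m X ∈ nbar m := (nbarPart X).2

lemma prN_of_mem {X : g m} (hX : X ∈ nbar m) : prN m X = X := coe_nbarPart_of_mem hX

variable (ρ : RealForm m)

lemma R_prN (X : g m) : R ρ (prN m X) = R ρ X := by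
  have h : nbarPart (prN m X) = nbarPart X := nbarPart_of_mem (nbarPart X).2
  rw [R_eq, R_eq, h]

lemma R_eq_zero {X : g m} (hX : prN m X = 0) : R ρ X = 0 := by
  rw [← R_prN, hX, map_zero]

/-- A basis of `𝔤`. -/
def basG (m : ℕ) : Module.Basis (Fin (Module.finrank ℂ (g m))) ℂ (g m) := Module.finBasis ℂ (g m)

/-- This rewrites an operator whose direction varies with u as a combination of fixed derivations
with function coefficients, to which the Leibniz rule applies. -/
lemma sum_coord_mul (T : g m →ₗ[ℂ] ℂ) (v : g m) :
    ∑ i, (basG m).coord i v * T (basG m i) = T v := by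
  conv_rhs => rw [← (basG m).sum_repr v, map_sum]
  refine Finset.sum_congr rfl fun i _ => ?_
  rw [map_smul, smul_eq_mul, Module.Basis.coord_apply]

/-- The linear form `v ↦ (R(v)f)(u)`. -/
def evalR (f : Smooth ρ) (u : NBar ρ) : g m →ₗ[ℂ] ℂ where
  toFun v := R ρ v f u
  map_add' v w := by
    rw [map_add, Derivation.add_apply, Smooth.add_apply]
  map_smul' c v := by
    rw [map_smul, Derivation.smul_apply, Smooth.smul_apply]
    rfl

/-- The linear form `v ↦ (R(Z)R(v)f)(u)`. -/
def evalRR (Z : g m) (f : Smooth ρ) (u : NBar ρ) : g m →ₗ[ℂ] ℂ where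
  toFun v := R ρ Z (R ρ v f) u
  map_add' v w := by
    rw [map_add, Derivation.add_apply, map_add, Smooth.add_apply]
  map_smul' c v := by
    rw [map_smul, Derivation.smul_apply, Derivation.map_smul, Smooth.smul_apply]
    rfl

lemma evalR_apply (f : Smooth ρ) (u : NBar ρ) (v : g m) : evalR ρ f u v = R ρ v f u := rfl

lemma adFun_apply (Y : g m) (l : g m →ₗ[ℂ] ℂ) (u : NBar ρ) : adFun ρ Y l u = l (adInv ρ u Y) := rfl

/-- The operator `f ↦ (u ↦ α(W)f(u) - (R(βW)f)(u))`, where `W = Ad(u⁻¹)Y`. -/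
def Op (Y : g m) (α : g m →ₗ[ℂ] ℂ) (β : g m →ₗ[ℂ] g m) (f : Smooth ρ) : Smooth ρ :=
  adFun ρ Y α * f - ∑ i, adFun ρ Y ((basG m).coord i ∘ₗ β) * R ρ (basG m i) f

lemma Op_apply (Y : g m) (α : g m →ₗ[ℂ] ℂ) (β : g m →ₗ[ℂ] g m) (f : Smooth ρ) (u : NBar ρ) :
    Op ρ Y α β f u = α (adInv ρ u Y) * f u - R ρ (β (adInv ρ u Y)) f u := by
  rw [Op, Smooth.sub_apply, Smooth.mul_apply, Smooth.sum_apply, ← evalR_apply ρ f u (β _),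
    ← sum_coord_mul (evalR ρ f u) (β _)]
  rfl

lemma R_lie_apply {X Z : g m} (hX : X ∈ nbar m) (hZ : Z ∈ nbar m) (f : Smooth ρ) (u : NBar ρ) :
    R ρ ⁅X, Z⁆ f u = R ρ X (R ρ Z f) u - R ρ Z (R ρ X f) u := by
  rw [R_lie ρ hX hZ, Derivation.commutator_apply, Smooth.sub_apply]

/-- The commutator of an operator of first order with a right translation. -/
lemma Op_R_sub_R_Op {Z : g m} (hZ : Z ∈ nbar m) (Y : g m) (α : g m →ₗ[ℂ] ℂ) (β : g m →ₗ[ℂ] g m)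
    (f : Smooth ρ) :
    Op ρ Y α β (R ρ Z f) - R ρ Z (Op ρ Y α β f)
      = Op ρ Y (α ∘ₗ LieAlgebra.ad ℂ (g m) Z)
          (β ∘ₗ LieAlgebra.ad ℂ (g m) Z - LieAlgebra.ad ℂ (g m) Z ∘ₗ prN m ∘ₗ β) f := by
  refine Smooth.ext fun u => ?_
  obtain ⟨W, hW⟩ : ∃ W, W = adInv ρ u Y := ⟨_, rfl⟩
  have h0 : Op ρ Y α β (R ρ Z f) u = α W * R ρ Z f u - R ρ (β W) (R ρ Z f) u := by
    rw [hW]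
    exact Op_apply ρ Y α β (R ρ Z f) u
  have h8 : Op ρ Y (α ∘ₗ LieAlgebra.ad ℂ (g m) Z)
      (β ∘ₗ LieAlgebra.ad ℂ (g m) Z - LieAlgebra.ad ℂ (g m) Z ∘ₗ prN m ∘ₗ β) f u
      = α ⁅Z, W⁆ * f u - R ρ ((β ∘ₗ LieAlgebra.ad ℂ (g m) Z
        - LieAlgebra.ad ℂ (g m) Z ∘ₗ prN m ∘ₗ β) W) f u := by
    rw [hW]
    exact Op_apply ρ Y _ _ f u
  have h1 : R ρ Z (Op ρ Y α β f) u = α W * R ρ Z f u - α ⁅Z, W⁆ * f u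
      - (R ρ Z (R ρ (β W) f) u - R ρ (β ⁅Z, W⁆) f u) := by
    -- By the Leibniz rule the derivative also falls on the coefficients, where `R_adFun` replaces a
    -- linear form l by -l ∘ ad Z.
    have h2 : R ρ Z (Op ρ Y α β f) = (adFun ρ Y α * R ρ Z f
        + f * -adFun ρ Y (α ∘ₗ LieAlgebra.ad ℂ (g m) Z))
        - ∑ i, (adFun ρ Y ((basG m).coord i ∘ₗ β) * R ρ Z (R ρ (basG m i) f)
          + R ρ (basG m i) f
            * -adFun ρ Y (((basG m).coord i ∘ₗ β) ∘ₗ LieAlgebra.ad ℂ (g m) Z)) := by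
      rw [Op, map_sub, map_sum, Derivation.leibniz, R_adFun ρ hZ]
      simp only [Derivation.leibniz, R_adFun ρ hZ, smul_eq_mul]
    have h3 : R ρ Z (R ρ (β W) f) u
        = ∑ i, (basG m).coord i (β W) * R ρ Z (R ρ (basG m i) f) u :=
      (sum_coord_mul (evalRR ρ Z f u) (β W)).symm
    have h4 : R ρ (β ⁅Z, W⁆) f u
        = ∑ i, (basG m).coord i (β ⁅Z, W⁆) * R ρ (basG m i) f u :=
      (sum_coord_mul (evalR ρ f u) (β ⁅Z, W⁆)).symm
    rw [h2, h3, h4, Smooth.sub_apply, Smooth.sum_apply, ← Finset.sum_sub_distrib]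
    congr 1
    · rw [Smooth.add_apply, Smooth.mul_apply, Smooth.mul_apply, Smooth.neg_apply, adFun_apply,
        adFun_apply, ← hW]
      change α W * R ρ Z f u + f u * -α ⁅Z, W⁆ = _
      ring
    · refine Finset.sum_congr rfl fun i _ => ?_
      rw [Smooth.add_apply, Smooth.mul_apply, Smooth.mul_apply, Smooth.neg_apply, adFun_apply,
        adFun_apply, ← hW]
      change (basG m).coord i (β W) * R ρ Z (R ρ (basG m i) f) u
        + R ρ (basG m i) f u * -((basG m).coord i (β ⁅Z, W⁆)) = _
      ring
  have h5 : R ρ ((β ∘ₗ LieAlgebra.ad ℂ (g m) Z - LieAlgebra.ad ℂ (g m) Z ∘ₗ prN m ∘ₗ β) W) f u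
      = R ρ (β ⁅Z, W⁆) f u - R ρ ⁅Z, prN m (β W)⁆ f u :=
    (evalR ρ f u).map_sub (β ⁅Z, W⁆) ⁅Z, prN m (β W)⁆
  have h6 : R ρ (β W) = R ρ (prN m (β W)) := (R_prN ρ _).symm
  -- Exchanging R(Z) with R(βW) costs the bracket of Z with the 𝔫̄-component of βW; the projection
  -- is inserted because `R` is multiplicative for brackets on 𝔫̄ only.
  have h7 := R_lie_apply ρ hZ (prN_mem (β W)) f u
  rw [← h6] at h7
  have aux : ∀ A B C D E P : ℂ, P = E - (D - B) → A - B - (A - C - (D - E)) = C - P := by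
    rintro A B C D E P rfl
    ring
  exact ((Smooth.sub_apply _ _ u).trans (congrArg₂ (· - ·) h0 h1)).trans
    ((aux _ _ _ _ _ _ (h5.trans (congrArg₂ (· - ·) rfl h7))).trans h8.symm)

/-! ### The action of 𝔤 and its commutators with R(Z₁)R(Z₂) -/

/-- The linear form `λ_𝔮` of `𝔮`, extended to `𝔤` by zero on `𝔫̄`. -/
def lam (m : ℕ) : g m →ₗ[ℂ] ℂ where
  toFun X := ∑ j : Fin m, (X : Mat m) (idxP j) (idxP j)
  map_add' X Y := by
    rw [← Finset.sum_add_distrib]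
    rfl
  map_smul' c X := by
    rw [RingHom.id_apply, smul_eq_mul, Finset.mul_sum]
    rfl

lemma lam_apply (X : g m) : lam m X = ∑ j : Fin m, (X : Mat m) (idxP j) (idxP j) := rfl

lemma lamQ_qPart (X : g m) : lamQ (qPart X) = lam m X := by
  refine Finset.sum_congr rfl fun j _ => ?_
  change (if deg (idxP j) - deg (idxP j) = 0 then (X : Mat m) (idxP j) (idxP j) else 0)
      + (if deg (idxP j) - deg (idxP j) = 1 then (X : Mat m) (idxP j) (idxP j) else 0)
      + (if deg (idxP j) - deg (idxP j) = 2 then (X : Mat m) (idxP j) (idxP j) else 0) = _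
  simp

/-- The action of `𝔤` on the smooth sections of `ℒ_s`. -/
def actS (s : ℂ) (Y : g m) (f : Smooth ρ) : Smooth ρ := Op ρ Y (s • lam m) LinearMap.id f

lemma actS_apply (s : ℂ) (Y : g m) (f : Smooth ρ) (u : NBar ρ) :
    actS ρ s Y f u = act ρ s Y f u := by
  rw [actS, Op_apply, act, lamQ_qPart, R_apply]
  rfl

/-- The part of `[Z, X]` that depends on the `𝔮`-component of `X` only. -/
abbrev lieQ (Z X : g m) : g m := ⁅Z, X⁆ - ⁅Z, prN m X⁆

/-- The value at `u` of the commutator of `W ∈ 𝔤` with `R(Z₁)R(Z₂)`, applied to `f`. -/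
def commRR (s : ℂ) (f : Smooth ρ) (u : NBar ρ) (Z₁ Z₂ W : g m) : ℂ :=
  s * lam m ⁅Z₁, W⁆ * R ρ Z₂ f u - R ρ (lieQ Z₁ W) (R ρ Z₂ f) u
    + s * lam m ⁅Z₂, W⁆ * R ρ Z₁ f u - R ρ (lieQ Z₂ W) (R ρ Z₁ f) u
    - s * lam m ⁅Z₂, ⁅Z₁, W⁆⁆ * f u
    + R ρ (lieQ Z₂ ⁅Z₁, W⁆ - ⁅Z₁, prN m (lieQ Z₂ W)⁆) f u

/-- With A the action of Y, [A, R₁R₂] = [A, R₁]R₂ + [A, R₂]R₁ - [[A, R₂], R₁], and each bracket on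
the right is an instance of `Op_R_sub_R_Op`. -/
lemma actS_RR_sub (s : ℂ) {Z₁ Z₂ : g m} (h₁ : Z₁ ∈ nbar m) (h₂ : Z₂ ∈ nbar m) (Y : g m)
    (f : Smooth ρ) (u : NBar ρ) :
    actS ρ s Y (R ρ Z₁ (R ρ Z₂ f)) u - R ρ Z₁ (R ρ Z₂ (actS ρ s Y f)) u
      = commRR ρ s f u Z₁ Z₂ (adInv ρ u Y) := by
  refine (Smooth.sub_apply _ _ u).symm.trans ?_
  have e1 := Op_R_sub_R_Op ρ h₁ Y (s • lam m) LinearMap.id (R ρ Z₂ f)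
  have e2 := Op_R_sub_R_Op ρ h₂ Y (s • lam m) LinearMap.id f
  have e3 := Op_R_sub_R_Op ρ h₁ Y ((s • lam m) ∘ₗ LieAlgebra.ad ℂ (g m) Z₂)
    (LinearMap.id ∘ₗ LieAlgebra.ad ℂ (g m) Z₂
      - LieAlgebra.ad ℂ (g m) Z₂ ∘ₗ prN m ∘ₗ LinearMap.id) f
  have key : actS ρ s Y (R ρ Z₁ (R ρ Z₂ f)) - R ρ Z₁ (R ρ Z₂ (actS ρ s Y f))
      = Op ρ Y ((s • lam m) ∘ₗ LieAlgebra.ad ℂ (g m) Z₁) (LinearMap.id ∘ₗ LieAlgebra.ad ℂ (g m) Z₁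
          - LieAlgebra.ad ℂ (g m) Z₁ ∘ₗ prN m ∘ₗ LinearMap.id) (R ρ Z₂ f)
        + Op ρ Y ((s • lam m) ∘ₗ LieAlgebra.ad ℂ (g m) Z₂) (LinearMap.id ∘ₗ LieAlgebra.ad ℂ (g m) Z₂
          - LieAlgebra.ad ℂ (g m) Z₂ ∘ₗ prN m ∘ₗ LinearMap.id) (R ρ Z₁ f)
        - Op ρ Y (((s • lam m) ∘ₗ LieAlgebra.ad ℂ (g m) Z₂) ∘ₗ LieAlgebra.ad ℂ (g m) Z₁)
          ((LinearMap.id ∘ₗ LieAlgebra.ad ℂ (g m) Z₂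
            - LieAlgebra.ad ℂ (g m) Z₂ ∘ₗ prN m ∘ₗ LinearMap.id) ∘ₗ LieAlgebra.ad ℂ (g m) Z₁
            - LieAlgebra.ad ℂ (g m) Z₁ ∘ₗ prN m ∘ₗ (LinearMap.id ∘ₗ LieAlgebra.ad ℂ (g m) Z₂
            - LieAlgebra.ad ℂ (g m) Z₂ ∘ₗ prN m ∘ₗ LinearMap.id)) f := by
    rw [← e1, ← e3, ← e2, actS, actS, map_sub]
    abel
  have k1 := Op_apply ρ Y ((s • lam m) ∘ₗ LieAlgebra.ad ℂ (g m) Z₁)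
    (LinearMap.id ∘ₗ LieAlgebra.ad ℂ (g m) Z₁
      - LieAlgebra.ad ℂ (g m) Z₁ ∘ₗ prN m ∘ₗ LinearMap.id) (R ρ Z₂ f) u
  have k2 := Op_apply ρ Y ((s • lam m) ∘ₗ LieAlgebra.ad ℂ (g m) Z₂)
    (LinearMap.id ∘ₗ LieAlgebra.ad ℂ (g m) Z₂
      - LieAlgebra.ad ℂ (g m) Z₂ ∘ₗ prN m ∘ₗ LinearMap.id) (R ρ Z₁ f) u
  have k3 := Op_apply ρ Y (((s • lam m) ∘ₗ LieAlgebra.ad ℂ (g m) Z₂) ∘ₗ LieAlgebra.ad ℂ (g m) Z₁)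
    ((LinearMap.id ∘ₗ LieAlgebra.ad ℂ (g m) Z₂
      - LieAlgebra.ad ℂ (g m) Z₂ ∘ₗ prN m ∘ₗ LinearMap.id) ∘ₗ LieAlgebra.ad ℂ (g m) Z₁
      - LieAlgebra.ad ℂ (g m) Z₁ ∘ₗ prN m ∘ₗ (LinearMap.id ∘ₗ LieAlgebra.ad ℂ (g m) Z₂
      - LieAlgebra.ad ℂ (g m) Z₂ ∘ₗ prN m ∘ₗ LinearMap.id)) f u
  refine (congrArg (fun F : Smooth ρ => F u) key).trans ?_
  refine (Smooth.sub_apply _ _ u).trans ?_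
  refine (congrArg₂ (· - ·) ((Smooth.add_apply _ _ u).trans (congrArg₂ (· + ·) k1 k2)) k3).trans ?_
  clear k1 k2 k3 key e1 e2 e3
  have gen : ∀ W : g m, (s * lam m ⁅Z₁, W⁆ * R ρ Z₂ f u - R ρ (lieQ Z₁ W) (R ρ Z₂ f) u)
    + (s * lam m ⁅Z₂, W⁆ * R ρ Z₁ f u - R ρ (lieQ Z₂ W) (R ρ Z₁ f) u)
    - (s * lam m ⁅Z₂, ⁅Z₁, W⁆⁆ * f u
    - R ρ (lieQ Z₂ ⁅Z₁, W⁆ - ⁅Z₁, prN m (lieQ Z₂ W)⁆) f u) = commRR ρ s f u Z₁ Z₂ W := by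
    intro W
    have aux : ∀ a b c d e k : ℂ, (a - b) + (c - d) - (e - k) = a - b + c - d - e + k := by
      intros
      ring
    exact aux _ _ _ _ _ _
  exact gen (adInv ρ u Y)

/-! ## Indices and graded pieces -/

lemma deg_idxP (l : Fin m) : deg (idxP l : Idx m) = 1 := by
  simp [idxP, deg, Fin.castSucc_ne_last]

lemma deg_idxM (l : Fin m) : deg (idxM l : Idx m) = -1 := by
  simp [idxM, deg, Fin.castSucc_ne_last]

lemma deg_midIdx (t : Fin 3) : deg (midIdx t : Idx m) = 0 := by
  fin_cases t <;> simp [midIdx, deg]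

lemma exists_idxP {a : Idx m} (h : deg a = 1) : ∃ l, a = idxP l := by
  rcases a with _ | j | j
  · simp [deg] at h
  · induction j using Fin.lastCases with
    | last => simp [deg] at h
    | cast l => exact ⟨l, rfl⟩
  · by_cases hj : j = Fin.last m <;> simp [deg, hj] at h

lemma exists_idxM {a : Idx m} (h : deg a = -1) : ∃ l, a = idxM l := by
  rcases a with _ | j | j
  · simp [deg] at h
  · by_cases hj : j = Fin.last m <;> simp [deg, hj] at h
  · induction j using Fin.lastCases with
    | last => simp [deg] at h
    | cast l => exact ⟨l, rfl⟩

lemma exists_midIdx {a : Idx m} (h : deg a = 0) : ∃ t, a = midIdx t := by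
  rcases a with _ | j | j
  · exact ⟨0, rfl⟩
  · by_cases hj : j = Fin.last m
    · exact ⟨1, by rw [hj]; rfl⟩
    · simp [deg, hj] at h
  · by_cases hj : j = Fin.last m
    · exact ⟨2, by rw [hj]; rfl⟩
    · simp [deg, hj] at h

/-- The involution of the three indices of degree `0`. -/
def midDual : Fin 3 → Fin 3 := ![0, 2, 1]

lemma midDual_midDual (t : Fin 3) : midDual (midDual t) = t := by
  fin_cases t <;> rfl

lemma dualIdx_midIdx (t : Fin 3) : dualIdx (midIdx t : Idx m) = midIdx (midDual t) := by
  fin_cases t <;> rfl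

lemma dualIdx_idxP (l : Fin m) : dualIdx (idxP l) = idxM l := rfl

lemma dualIdx_idxM (l : Fin m) : dualIdx (idxM l) = idxP l := rfl

lemma idxP_inj {k l : Fin m} : idxP k = idxP l ↔ k = l := by
  simp [idxP]

lemma idxM_inj {k l : Fin m} : idxM k = idxM l ↔ k = l := by
  simp [idxM]

lemma midIdx_inj {s t : Fin 3} : (midIdx s : Idx m) = midIdx t ↔ s = t := by
  fin_cases s <;> fin_cases t <;> simp [midIdx]

lemma ne_of_deg_ne {a b : Idx m} (h : deg a ≠ deg b) : a ≠ b := fun hab => h (by rw [hab])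

lemma idxP_ne_idxM (k l : Fin m) : idxP k ≠ idxM l := by simp [idxP, idxM]

lemma idxM_ne_idxP (k l : Fin m) : idxM k ≠ idxP l := (idxP_ne_idxM l k).symm

lemma idxP_ne_midIdx (k : Fin m) (t : Fin 3) : idxP k ≠ midIdx t :=
  ne_of_deg_ne (by rw [deg_idxP, deg_midIdx]; decide)

lemma midIdx_ne_idxP (k : Fin m) (t : Fin 3) : midIdx t ≠ idxP k := (idxP_ne_midIdx k t).symm

lemma idxM_ne_midIdx (k : Fin m) (t : Fin 3) : idxM k ≠ midIdx t :=
  ne_of_deg_ne (by rw [deg_idxM, deg_midIdx]; decide)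

lemma midIdx_ne_idxM (k : Fin m) (t : Fin 3) : midIdx t ≠ idxM k := (idxM_ne_midIdx k t).symm

lemma jCoeff_idxP (l : Fin m) : jCoeff (idxP l) = 1 := rfl

lemma jCoeff_idxM (l : Fin m) : jCoeff (idxM l) = 1 := rfl

lemma sum_idx {M : Type*} [AddCommMonoid M] (f : Idx m → M) :
    ∑ i, f i = ∑ l, f (idxP l) + ∑ l, f (idxM l) + ∑ t, f (midIdx t) := by
  rw [Fintype.sum_sum_type, Fintype.sum_sum_type, Fin.sum_univ_castSucc, Fin.sum_univ_castSucc,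
    Fin.sum_univ_three]
  simp only [Finset.univ_unique, Finset.sum_singleton]
  change f (midIdx 0) + (∑ l, f (idxP l) + f (midIdx 1) + (∑ l, f (idxM l) + f (midIdx 2))) = _
  abel

/-- Dual entries of an element of 𝔤 are non-zero multiples of each other, so one of each pair has to
be checked. -/
lemma eq_zero_of_entries {X : g m}
    (h : ∀ a b, (X : Mat m) a b = 0 ∨ (X : Mat m) (dualIdx b) (dualIdx a) = 0) : X = 0 := by
  ext a b
  change (X : Mat m) a b = 0
  rcases h a b with h | h
  · exact h
  · rw [coe_apply_dualIdx, neg_eq_zero, mul_eq_zero] at h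
    exact h.resolve_left (div_ne_zero (jCoeff_ne_zero a) (jCoeff_ne_zero b))

lemma gr_apply_eq_zero {k : ℤ} {X : g m} (hX : X ∈ gr m k) {a b : Idx m} (h : deg a - deg b ≠ k) :
    (X : Mat m) a b = 0 := by
  by_contra h0
  exact h ((mem_gr_iff k X).1 hX a b h0)

lemma lie_mem_gr {j k : ℤ} {X Y : g m} (hX : X ∈ gr m j) (hY : Y ∈ gr m k) :
    ⁅X, Y⁆ ∈ gr m (j + k) := by
  rw [mem_gr_iff] at *
  intro a b hab
  by_contra hne
  refine hab ?_
  rw [coe_lie, Matrix.sub_apply, Matrix.mul_apply, Matrix.mul_apply]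
  have h1 : ∀ c, (X : Mat m) a c * (Y : Mat m) c b = 0 := by
    intro c
    by_contra h0
    have h1 := hX a c (left_ne_zero_of_mul h0)
    have h2 := hY c b (right_ne_zero_of_mul h0)
    omega
  have h2 : ∀ c, (Y : Mat m) a c * (X : Mat m) c b = 0 := by
    intro c
    by_contra h0
    have h1 := hY a c (left_ne_zero_of_mul h0)
    have h2 := hX c b (right_ne_zero_of_mul h0)
    omega
  rw [Finset.sum_eq_zero fun c _ => h1 c, Finset.sum_eq_zero fun c _ => h2 c, sub_zero]

lemma gr_neg_one_le : gr m (-1) ≤ nbar m := le_sup_left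

lemma grProj_of_mem_ne {j k : ℤ} (hjk : j ≠ k) {X : g m} (hX : X ∈ gr m j) : grProj m k X = 0 := by
  ext a b
  change (if deg a - deg b = k then (X : Mat m) a b else 0) = 0
  split_ifs with h
  · exact gr_apply_eq_zero hX fun h' => hjk (h'.symm.trans h)
  · rfl

lemma prN_eq_zero {k : ℤ} (hk : 0 ≤ k) {X : g m} (hX : X ∈ gr m k) : prN m X = 0 := by
  rw [prN, LinearMap.add_apply, grProj_of_mem_ne (by omega) hX, grProj_of_mem_ne (by omega) hX,
    add_zero]

lemma lam_eq_zero {k : ℤ} (hk : k ≠ 0) {X : g m} (hX : X ∈ gr m k) : lam m X = 0 := by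
  rw [lam_apply]
  exact Finset.sum_eq_zero fun j _ => gr_apply_eq_zero hX (by omega)

lemma gr_apply_x {X : g m} : X = prN m X + (grProj m 0 X + grProj m 1 X + grProj m 2 X) :=
  (nbarPart_add_qPart X).symm

/-! ### Bases of 𝔤(1), 𝔤(-1) and 𝔤(-2) -/

/-- The root vectors of `𝔤(-1)`. -/
def yv (p : Fin m × Fin 3) : g m := rootVec (midIdx p.2) (idxP p.1)

lemma x1Dual_eq (p : Fin m × Fin 3) : x1Dual p = (kap m)⁻¹ • yv p :=
  rootVecDual_eq (midIdx_ne_idxM p.1 p.2)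

lemma yv_mem (p : Fin m × Fin 3) : yv p ∈ gr m (-1) := by
  have h := rootVec_mem_gr (midIdx p.2) (idxP p.1)
  rwa [deg_midIdx, deg_idxP] at h

lemma x1_mem (p : Fin m × Fin 3) : x1 p ∈ gr m 1 := by
  have h := rootVec_mem_gr (idxP p.1) (midIdx p.2)
  rwa [deg_midIdx, deg_idxP] at h

lemma x1Dual_mem_gr (p : Fin m × Fin 3) : x1Dual p ∈ gr m (-1) := by
  rw [x1Dual_eq]
  exact Submodule.smul_mem _ _ (yv_mem p)

lemma yv_apply (p : Fin m × Fin 3) (l : Fin m) (t : Fin 3) :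
    (yv p : Mat m) (midIdx t) (idxP l) = if p = (l, t) then 1 else 0 := by
  obtain ⟨k, s⟩ := p
  rw [yv, rootVec_apply]
  simp [dualIdx_idxP, idxM_ne_midIdx, midIdx_inj, idxP_inj, and_comm]

lemma x1_apply (p : Fin m × Fin 3) (l : Fin m) (t : Fin 3) :
    (x1 p : Mat m) (idxP l) (midIdx t) = if p = (l, t) then 1 else 0 := by
  obtain ⟨k, s⟩ := p
  rw [x1, rootVec_apply]
  simp [dualIdx_idxP, idxM_ne_midIdx, midIdx_inj, idxP_inj]

lemma eq_zero_of_gr_neg_one {X : g m} (hX : X ∈ gr m (-1))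
    (h : ∀ l t, (X : Mat m) (midIdx t) (idxP l) = 0) : X = 0 := by
  refine eq_zero_of_entries fun a b => ?_
  by_cases hab : deg a - deg b = -1
  · rcases deg_cases a with ha | ha | ha <;> rcases deg_cases b with hb | hb | hb <;>
      simp only [ha, hb] at hab <;> try omega
    · obtain ⟨l, hl⟩ := exists_idxP (a := dualIdx a) (by rw [deg_dualIdx, ha]; rfl)
      obtain ⟨t, ht⟩ := exists_midIdx (a := dualIdx b) (by rw [deg_dualIdx, hb]; rfl)
      right
      rw [hl, ht, h]
    · obtain ⟨l, rfl⟩ := exists_idxP hb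
      obtain ⟨t, rfl⟩ := exists_midIdx ha
      exact Or.inl (h l t)
  · exact Or.inl (gr_apply_eq_zero hX hab)

lemma eq_zero_of_gr_one {X : g m} (hX : X ∈ gr m 1)
    (h : ∀ l t, (X : Mat m) (idxP l) (midIdx t) = 0) : X = 0 := by
  refine eq_zero_of_entries fun a b => ?_
  by_cases hab : deg a - deg b = 1
  · rcases deg_cases a with ha | ha | ha <;> rcases deg_cases b with hb | hb | hb <;>
      simp only [ha, hb] at hab <;> try omega
    · obtain ⟨l, hl⟩ := exists_idxP (a := dualIdx b) (by rw [deg_dualIdx, hb]; rfl)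
      obtain ⟨t, ht⟩ := exists_midIdx (a := dualIdx a) (by rw [deg_dualIdx, ha]; rfl)
      right
      rw [hl, ht, h]
    · obtain ⟨l, rfl⟩ := exists_idxP ha
      obtain ⟨t, rfl⟩ := exists_midIdx hb
      exact Or.inl (h l t)
  · exact Or.inl (gr_apply_eq_zero hX hab)

lemma eq_zero_of_gr_neg_two {X : g m} (hX : X ∈ gr m (-2))
    (h : ∀ k l, (X : Mat m) (idxM k) (idxP l) = 0) : X = 0 := by
  refine eq_zero_of_entries fun a b => ?_
  by_cases hab : deg a - deg b = -2
  · rcases deg_cases a with ha | ha | ha <;> rcases deg_cases b with hb | hb | hb <;>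
      simp only [ha, hb] at hab <;> try omega
    obtain ⟨l, rfl⟩ := exists_idxP hb
    obtain ⟨t, rfl⟩ := exists_idxM ha
    exact Or.inl (h t l)
  · exact Or.inl (gr_apply_eq_zero hX hab)

/-- The entries of a linear combination. -/
lemma coe_sum_smul_apply {ι : Type*} (s : Finset ι) (c : ι → ℂ) (X : ι → g m) (a b : Idx m) :
    ((∑ i ∈ s, c i • X i : g m) : Mat m) a b = ∑ i ∈ s, c i * (X i : Mat m) a b :=
  map_sum ((Matrix.entryLinearMap ℂ ℂ a b) ∘ₗ coeMat m) (fun i => c i • X i) s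

lemma gr_neg_one_eq_sum {X : g m} (hX : X ∈ gr m (-1)) :
    X = ∑ p : Fin m × Fin 3, (X : Mat m) (midIdx p.2) (idxP p.1) • yv p := by
  rw [← sub_eq_zero]
  refine eq_zero_of_gr_neg_one (Submodule.sub_mem _ hX
    (Submodule.sum_mem _ fun p _ => Submodule.smul_mem _ _ (yv_mem p))) fun l t => ?_
  change (X : Mat m) _ _ - ((∑ p : Fin m × Fin 3, (X : Mat m) (midIdx p.2) (idxP p.1) • yv p : g m)
    : Mat m) _ _ = 0
  rw [coe_sum_smul_apply]
  simp [yv_apply]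

lemma gr_one_eq_sum {X : g m} (hX : X ∈ gr m 1) :
    X = ∑ p : Fin m × Fin 3, (X : Mat m) (idxP p.1) (midIdx p.2) • x1 p := by
  rw [← sub_eq_zero]
  refine eq_zero_of_gr_one (Submodule.sub_mem _ hX
    (Submodule.sum_mem _ fun p _ => Submodule.smul_mem _ _ (x1_mem p))) fun l t => ?_
  change (X : Mat m) _ _ - ((∑ p : Fin m × Fin 3, (X : Mat m) (idxP p.1) (midIdx p.2) • x1 p : g m)
    : Mat m) _ _ = 0
  rw [coe_sum_smul_apply]
  simp [x1_apply]

lemma apply_idxM_idxP_swap (X : g m) (k l : Fin m) :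
    (X : Mat m) (idxM l) (idxP k) = -(X : Mat m) (idxM k) (idxP l) := by
  have h := coe_apply_dualIdx X (idxM k) (idxP l)
  rwa [jCoeff_idxM, jCoeff_idxP, div_one, one_mul] at h

lemma gr_neg_two_eq_sum {X : g m} (hX : X ∈ gr m (-2)) :
    X = ∑ p : Fin m × Fin m with p.1 < p.2,
      (X : Mat m) (idxM p.2) (idxP p.1) • rootVec (idxM p.2) (idxP p.1) := by
  rw [← sub_eq_zero]
  refine eq_zero_of_gr_neg_two (Submodule.sub_mem _ hX
    (Submodule.sum_mem _ fun p _ => Submodule.smul_mem _ _ ?_)) fun k l => ?_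
  · have h := rootVec_mem_gr (idxM p.2) (idxP p.1)
    rwa [deg_idxM, deg_idxP] at h
  · change (X : Mat m) _ _ - ((∑ p : Fin m × Fin m with p.1 < p.2, (X : Mat m) (idxM p.2) (idxP p.1)
      • rootVec (idxM p.2) (idxP p.1) : g m) : Mat m) _ _ = 0
    rw [coe_sum_smul_apply, sub_eq_zero]
    -- A root vector of degree -2 meets the entry (k, l) through its pair or through the swapped
    -- pair. Skewness of X gives both the same coefficient, and off the diagonal exactly one of the
    -- two pairs is increasing.
    have h1 : ∀ p : Fin m × Fin m, (X : Mat m) (idxM p.2) (idxP p.1)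
        * (rootVec (idxM p.2) (idxP p.1) : Mat m) (idxM k) (idxP l)
        = (if p = (l, k) then (X : Mat m) (idxM k) (idxP l) else 0)
          + (if p = (k, l) then (X : Mat m) (idxM k) (idxP l) else 0) := by
      rintro ⟨i, j⟩
      rw [rootVec_apply]
      simp only [dualIdx_idxP, dualIdx_idxM, idxM_inj, idxP_inj, jCoeff_idxM, jCoeff_idxP, div_one,
        Prod.mk.injEq]
      by_cases h1 : j = k ∧ i = l
      · obtain ⟨rfl, rfl⟩ := h1
        by_cases h2 : i = j
        · subst h2
          have := apply_idxM_idxP_swap X i i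
          have h0 : (X : Mat m) (idxM i) (idxP i) = 0 := by linear_combination (1 / 2 : ℂ) * this
          simp [h0]
        · simp [h2]
      · by_cases h2 : i = k ∧ j = l
        · obtain ⟨rfl, rfl⟩ := h2
          have := apply_idxM_idxP_swap X i j
          have h3 : ¬ (i = j ∧ j = i) := fun h => h1 ⟨h.2, h.1⟩
          simp [h1, h3]
          linear_combination -this
        · have h3 : ¬ (i = l ∧ j = k) := fun h => h1 ⟨h.2, h.1⟩
          simp [h1, h2, h3]
    rw [Finset.sum_congr rfl fun p _ => h1 p, Finset.sum_add_distrib, Finset.sum_ite_eq',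
      Finset.sum_ite_eq']
    have h0 : k = l → (X : Mat m) (idxM k) (idxP l) = 0 := by
      rintro rfl
      have := apply_idxM_idxP_swap X k k
      linear_combination (1 / 2 : ℂ) * this
    rcases lt_trichotomy k l with h | h | h
    · simp [h, h.not_gt]
    · subst h
      simp [h0 rfl]
    · simp [h, h.not_gt]

lemma rootVec_dualIdx_right (a : Idx m) : rootVec a (dualIdx a) = 0 := by
  have h := rootVec_dualIdx a (dualIdx a)
  rw [dualIdx_dualIdx, jCoeff_dualIdx, div_self (jCoeff_ne_zero a), neg_one_smul,
    eq_neg_iff_add_eq_zero, ← two_smul ℂ] at h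
  exact (smul_eq_zero.1 h).resolve_left two_ne_zero

/-! ### The ideal 𝔩_{nγ} and the stability of W and W^* -/

lemma lie_rootVec_idxN_idx0 :
    ⁅rootVec (idxN m) (idx0 m), rootVec (idx0 m) (idxN m)⁆ = rootVec (idxN m) (idxN m) := by
  rw [lie_rootVec, Finset.sum_eq_single (idxN m), Finset.sum_eq_single (idx0 m)]
  · have h1 : rootVec (idx0 m) (idx0 m) = 0 := rootVec_dualIdx_right (idx0 m)
    rw [h1, smul_zero, sub_zero, rootVec_apply]
    simp [idx0, idxN, dualIdx]
  · intro b _ hb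
    rw [rootVec_apply]
    have hb' : idx0 m ≠ b := hb.symm
    simp [idxN, idx0, dualIdx]
    exact fun h => absurd h hb'
  · simp
  · intro b _ hb
    rw [rootVec_apply]
    have hb' : idxN m ≠ b := hb.symm
    simp [idxN, idx0, dualIdx]
    exact fun h => absurd h hb'
  · simp


/-- The ideal is the copy of 𝔰𝔬(3) on the three basis vectors of degree 0. Skewness leaves three
free entries in this block, and they are the coefficients of the three spanning vectors. -/
lemma mem_lng_iff (A : g m) :
    A ∈ lng m ↔ ∀ a b, (A : Mat m) a b ≠ 0 → deg a = 0 ∧ deg b = 0 := by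
  have hspan : ∀ a b : Idx m, deg a = 0 → deg b = 0 → ∀ c d, (rootVec a b : Mat m) c d ≠ 0 →
      deg c = 0 ∧ deg d = 0 := by
    intro a b ha hb c d hcd
    rw [rootVec_apply] at hcd
    by_cases h1 : a = c ∧ b = d
    · rw [← h1.1, ← h1.2]; exact ⟨ha, hb⟩
    · by_cases h2 : dualIdx b = c ∧ dualIdx a = d
      · rw [← h2.1, ← h2.2, deg_dualIdx, deg_dualIdx, ha, hb]; exact ⟨rfl, rfl⟩
      · simp [h1, h2] at hcd
  have h0 : deg (idx0 m) = 0 := rfl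
  have hN : deg (idxN m) = 0 := by simp [idxN, deg]
  have hH := lie_rootVec_idxN_idx0 (m := m)
  constructor
  · intro hA
    induction hA using Submodule.span_induction with
    | mem A hA =>
      rcases hA with rfl | rfl | rfl
      · exact hspan _ _ hN h0
      · rw [hH]; exact hspan _ _ hN hN
      · exact hspan _ _ h0 hN
    | zero => intro a b h; exact absurd rfl h
    | add A B _ _ hA hB =>
      intro a b h
      by_cases h1 : (A : Mat m) a b = 0
      · refine hB a b fun h2 => h ?_
        change (A : Mat m) a b + (B : Mat m) a b = 0
        rw [h1, h2, add_zero]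
      · exact hA a b h1
    | smul c A _ hA =>
      intro a b h
      refine hA a b fun h1 => h ?_
      change c * (A : Mat m) a b = 0
      rw [h1, mul_zero]
  · intro hA
    have key : A = (A : Mat m) (idxN m) (idx0 m) • rootVec (idxN m) (idx0 m)
        + (A : Mat m) (idxN m) (idxN m) • ⁅rootVec (idxN m) (idx0 m), rootVec (idx0 m) (idxN m)⁆
        + (A : Mat m) (idx0 m) (idxN m) • rootVec (idx0 m) (idxN m) := by
      rw [hH, ← sub_eq_zero]
      refine eq_zero_of_entries fun a b => ?_
      set B : g m := A - ((A : Mat m) (idxN m) (idx0 m) • rootVec (idxN m) (idx0 m)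
        + (A : Mat m) (idxN m) (idxN m) • rootVec (idxN m) (idxN m)
        + (A : Mat m) (idx0 m) (idxN m) • rootVec (idx0 m) (idxN m)) with hB
      have hBe : ∀ c d, (B : Mat m) c d = (A : Mat m) c d
          - ((A : Mat m) (idxN m) (idx0 m) * (rootVec (idxN m) (idx0 m) : Mat m) c d
          + (A : Mat m) (idxN m) (idxN m) * (rootVec (idxN m) (idxN m) : Mat m) c d
          + (A : Mat m) (idx0 m) (idxN m) * (rootVec (idx0 m) (idxN m) : Mat m) c d) :=
        fun c d => rfl
      have hself : ∀ c, (B : Mat m) c (dualIdx c) = 0 := by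
        intro c
        have h := coe_apply_dualIdx B c (dualIdx c)
        rw [dualIdx_dualIdx, jCoeff_dualIdx, div_self (jCoeff_ne_zero c)] at h
        linear_combination (1 / 2 : ℂ) * h
      by_cases hab : deg a = 0 ∧ deg b = 0
      · obtain ⟨s, rfl⟩ := exists_midIdx hab.1
        obtain ⟨t, rfl⟩ := exists_midIdx hab.2
        have e1 : (B : Mat m) (midIdx 1) (midIdx 0) = 0 := by
          rw [hBe]
          simp [rootVec_apply, idxN, idx0, midIdx, dualIdx]
        have e2 : (B : Mat m) (midIdx 1) (midIdx 1) = 0 := by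
          rw [hBe]
          simp [rootVec_apply, idxN, idx0, midIdx, dualIdx]
        have e3 : (B : Mat m) (midIdx 0) (midIdx 1) = 0 := by
          rw [hBe]
          simp [rootVec_apply, idxN, idx0, midIdx, dualIdx]
        fin_cases s <;> fin_cases t
        · exact Or.inl (hself (midIdx 0))
        · exact Or.inl e3
        · exact Or.inr e1
        · exact Or.inl e1
        · exact Or.inl e2
        · exact Or.inl (hself (midIdx 1))
        · exact Or.inr e3
        · exact Or.inl (hself (midIdx 2))
        · exact Or.inr e2
      · left
        have hz : ∀ M : g m, (∀ c d, (M : Mat m) c d ≠ 0 → deg c = 0 ∧ deg d = 0) →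
            (M : Mat m) a b = 0 := fun M hM => by
          by_contra h
          exact hab (hM a b h)
        rw [hBe, hz A hA, hz _ (hspan _ _ hN h0), hz _ (hspan _ _ hN hN), hz _ (hspan _ _ h0 hN)]
        simp
    rw [key]
    refine Submodule.add_mem _ (Submodule.add_mem _ ?_ ?_) ?_ <;>
      refine Submodule.smul_mem _ _ (Submodule.subset_span ?_) <;> simp

lemma lie_mem_lng {X A : g m} (hX : X ∈ gr m 0) (hA : A ∈ lng m) : ⁅X, A⁆ ∈ lng m := by
  rw [mem_lng_iff] at *
  rw [mem_gr_iff] at hX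
  intro a b hab
  rw [coe_lie, Matrix.sub_apply, Matrix.mul_apply, Matrix.mul_apply] at hab
  by_contra hne
  refine hab ?_
  have h1 : ∀ c, (X : Mat m) a c * (A : Mat m) c b = 0 := by
    intro c
    by_contra h0
    have h1 := hX a c (left_ne_zero_of_mul h0)
    have h2 := hA c b (right_ne_zero_of_mul h0)
    omega
  have h2 : ∀ c, (A : Mat m) a c * (X : Mat m) c b = 0 := by
    intro c
    by_contra h0
    have h1 := hA a c (left_ne_zero_of_mul h0)
    have h2 := hX c b (right_ne_zero_of_mul h0)
    omega
  rw [Finset.sum_eq_zero fun c _ => h1 c, Finset.sum_eq_zero fun c _ => h2 c, sub_zero]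

lemma lie_mem_tens {X : g m} {A B : Submodule ℂ (g m)} (hA : ∀ Y ∈ A, ⁅X, Y⁆ ∈ A)
    (hB : ∀ Y ∈ B, ⁅X, Y⁆ ∈ B) {w : g m ⊗[ℂ] g m} (hw : w ∈ tens A B) : ⁅X, w⁆ ∈ tens A B := by
  have h : tens A B ≤ (tens A B).comap (LieModule.toEnd ℂ (g m) (g m ⊗[ℂ] g m) X) := by
    refine Submodule.map₂_le.2 fun a ha b hb => ?_
    change ⁅X, a ⊗ₜ[ℂ] b⁆ ∈ tens A B
    rw [TensorProduct.LieModule.lie_tmul_right]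
    exact Submodule.add_mem _ (Submodule.apply_mem_map₂ _ (hA a ha) hb)
      (Submodule.apply_mem_map₂ _ ha (hB b hb))
  exact h hw

lemma lie_mem_WngDual {X : g m} (hX : X ∈ gr m 0) {w : g m ⊗[ℂ] g m} (hw : w ∈ WngDual m) :
    ⁅X, w⁆ ∈ WngDual m :=
  lie_mem_tens (fun _ h => lie_mem_lng hX h)
    (fun Y h => by simpa only [zero_add] using lie_mem_gr hX h) hw

lemma lie_mem_Wng {X : g m} (hX : X ∈ gr m 0) {w : g m ⊗[ℂ] g m} (hw : w ∈ Wng m) :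
    ⁅X, w⁆ ∈ Wng m :=
  lie_mem_tens (fun _ h => lie_mem_lng hX h)
    (fun Y h => by simpa only [zero_add] using lie_mem_gr hX h) hw

/-! ## The quadratic polynomials `τ̃₂(Y^*)` -/

lemma killingForm_lie_left (X A B : g m) :
    killingForm ℂ (g m) ⁅X, A⁆ B = -killingForm ℂ (g m) A ⁅X, B⁆ :=
  LieModule.traceForm_apply_lie_apply' ℂ (g m) (g m) X A B

lemma killingForm_comm (A B : g m) : killingForm ℂ (g m) A B = killingForm ℂ (g m) B A :=
  LieModule.traceForm_comm ℂ (g m) (g m) A B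

lemma killingForm_rootVec' (X : g m) (a b : Idx m) :
    killingForm ℂ (g m) X (rootVec a b) = kap m * (X : Mat m) b a := killingForm_rootVec X a b

lemma killingForm_x1 (X : g m) (p : Fin m × Fin 3) :
    killingForm ℂ (g m) X (x1 p) = kap m * (X : Mat m) (midIdx p.2) (idxP p.1) :=
  killingForm_rootVec X _ _

lemma killingForm_x1Dual (X : g m) (p : Fin m × Fin 3) :
    killingForm ℂ (g m) X (x1Dual p) = (X : Mat m) (idxP p.1) (midIdx p.2) := by
  rw [x1Dual_eq, map_smul, yv, killingForm_rootVec', smul_eq_mul,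
    inv_mul_cancel_left₀ kap_ne_zero]

lemma gr_neg_one_eq_sum_dual {X : g m} (hX : X ∈ gr m (-1)) :
    X = ∑ p, killingForm ℂ (g m) X (x1 p) • x1Dual p := by
  conv_lhs => rw [gr_neg_one_eq_sum hX]
  refine Finset.sum_congr rfl fun p _ => ?_
  rw [killingForm_x1, x1Dual_eq, smul_smul, mul_right_comm, mul_inv_cancel₀ kap_ne_zero, one_mul]

lemma gr_one_eq_sum_dual {X : g m} (hX : X ∈ gr m 1) :
    X = ∑ p, killingForm ℂ (g m) X (x1Dual p) • x1 p := by
  conv_lhs => rw [gr_one_eq_sum hX]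
  refine Finset.sum_congr rfl fun p _ => ?_
  rw [killingForm_x1Dual]

/-- Invariance of the element `∑ x_p ⊗ x_p^*` under `𝔤(0)`. -/
lemma sum_form_lie_dual {W : g m} (hW : W ∈ gr m 0) (θ : g m →ₗ[ℂ] g m →ₗ[ℂ] ℂ) :
    ∑ p, θ (x1 p) ⁅W, x1Dual p⁆ = -∑ p : Fin m × Fin 3, θ ⁅W, x1 p⁆ (x1Dual p) := by
  have h1 : ∀ p : Fin m × Fin 3, θ (x1 p) ⁅W, x1Dual p⁆
      = ∑ r, killingForm ℂ (g m) ⁅W, x1Dual p⁆ (x1 r) * θ (x1 p) (x1Dual r) := by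
    intro p
    have h : ⁅W, x1Dual p⁆ ∈ gr m (-1) := by
      simpa only [zero_add] using lie_mem_gr hW (x1Dual_mem_gr p)
    conv_lhs => rw [gr_neg_one_eq_sum_dual h, map_sum]
    exact Finset.sum_congr rfl fun r _ => map_smul _ _ _
  have h2 : ∀ p : Fin m × Fin 3, θ ⁅W, x1 p⁆ (x1Dual p)
      = ∑ r, killingForm ℂ (g m) ⁅W, x1 p⁆ (x1Dual r) * θ (x1 r) (x1Dual p) := by
    intro p
    have h : ⁅W, x1 p⁆ ∈ gr m 1 := by
      simpa only [zero_add] using lie_mem_gr hW (x1_mem p)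
    conv_lhs => rw [gr_one_eq_sum_dual h, map_sum, LinearMap.sum_apply]
    exact Finset.sum_congr rfl fun r _ => LinearMap.map_smul₂ _ _ _ _
  rw [Finset.sum_congr rfl fun p _ => h1 p, Finset.sum_congr rfl fun p _ => h2 p, Finset.sum_comm,
    ← Finset.sum_neg_distrib]
  refine Finset.sum_congr rfl fun p _ => ?_
  rw [← Finset.sum_neg_distrib]
  refine Finset.sum_congr rfl fun r _ => ?_
  rw [killingForm_lie_left, killingForm_comm (x1Dual r), neg_mul]

/-- `A ⊗ z ↦ (X ↦ κ(A, [X, [X, z]]))`, polarized. -/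
def polarForm (A z : g m) : g m →ₗ[ℂ] g m →ₗ[ℂ] ℂ :=
  LinearMap.mk₂ ℂ (fun X X' => (1 / 4 : ℂ) * (killingForm ℂ (g m) A ⁅X, ⁅X', z⁆⁆
    + killingForm ℂ (g m) A ⁅X', ⁅X, z⁆⁆))
    (fun X Y Z => by simp only [add_lie, lie_add, map_add]; ring)
    (fun c X Y => by simp only [smul_lie, lie_smul, map_smul, smul_eq_mul]; ring)
    (fun X Y Z => by simp only [add_lie, lie_add, map_add]; ring)
    (fun c X Y => by simp only [smul_lie, lie_smul, map_smul, smul_eq_mul]; ring)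

lemma polarForm_apply (A z X X' : g m) : polarForm A z X X'
    = (1 / 4 : ℂ) * (killingForm ℂ (g m) A ⁅X, ⁅X', z⁆⁆
      + killingForm ℂ (g m) A ⁅X', ⁅X, z⁆⁆) := rfl

/-- The Leibniz rule for ad W on the double bracket, combined with the invariance of the Killing
form. -/
lemma polarForm_lie (W A z X X' : g m) :
    polarForm ⁅W, A⁆ z X X' + polarForm A ⁅W, z⁆ X X'
      = -(polarForm A z ⁅W, X⁆ X' + polarForm A z X ⁅W, X'⁆) := by
  simp only [polarForm_apply, killingForm_lie_left]
  have h : ∀ U V : g m, ⁅W, ⁅U, ⁅V, z⁆⁆⁆ = ⁅⁅W, U⁆, ⁅V, z⁆⁆ + ⁅U, ⁅⁅W, V⁆, z⁆⁆ + ⁅U, ⁅V, ⁅W, z⁆⁆⁆ := by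
    intro U V
    rw [leibniz_lie W U, leibniz_lie W V, lie_add]
    abel
  rw [h X X', h X' X]
  simp only [map_add]
  ring

/-- `polarCoeff` as a linear form. -/
def polarLin (p q : Fin m × Fin 3) : g m ⊗[ℂ] g m →ₗ[ℂ] ℂ where
  toFun Y := polarCoeff Y p q
  map_add' Y Z := by
    simp only [polarCoeff, tau2Tilde, map_add, LinearMap.add_apply]
    ring
  map_smul' c Y := by
    simp only [polarCoeff, tau2Tilde, map_smul, LinearMap.smul_apply, smul_eq_mul, RingHom.id_apply]
    ring

lemma polarLin_apply (p q : Fin m × Fin 3) (Y : g m ⊗[ℂ] g m) :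
    polarLin p q Y = polarCoeff Y p q := rfl

lemma polarCoeff_comm (Y : g m ⊗[ℂ] g m) (p q : Fin m × Fin 3) :
    polarCoeff Y p q = polarCoeff Y q p := by
  rw [polarCoeff, polarCoeff, add_comm (x1 p)]
  ring

/-- The element ω is the canonical tensor of the pairing of 𝔤(-2) with 𝔤(2), so contracting its
second leg with z returns z in the first leg. -/
lemma tau2Tilde_tmul (A : g m) {z : g m} (hz : z ∈ gr m (-2)) (X : g m) :
    tau2Tilde (A ⊗ₜ[ℂ] z) X = (1 / 2 : ℂ) * killingForm ℂ (g m) A ⁅X, ⁅X, z⁆⁆ := by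
  have h : z = ∑ p : Fin m × Fin m with p.1 < p.2,
      killingForm ℂ (g m) z (rootVec (idxP p.1) (idxM p.2)) • rootVecDual (idxP p.1) (idxM p.2) := by
    conv_lhs => rw [gr_neg_two_eq_sum hz]
    refine Finset.sum_congr rfl fun p hp => ?_
    have hp' : idxM p.2 ≠ dualIdx (idxP p.1) := by
      rw [dualIdx_idxP, Ne, idxM_inj]
      exact (Finset.mem_filter.1 hp).2.ne'
    rw [killingForm_rootVec', rootVecDual_eq hp', smul_smul, mul_right_comm,
      mul_inv_cancel₀ kap_ne_zero, one_mul]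
  have h2 : ⁅X, ⁅X, z⁆⁆ = ∑ p : Fin m × Fin m with p.1 < p.2,
      killingForm ℂ (g m) z (rootVec (idxP p.1) (idxM p.2))
        • ⁅X, ⁅X, rootVecDual (idxP p.1) (idxM p.2)⁆⁆ := by
    conv_lhs => rw [h]
    simp only [lie_sum, lie_smul]
  rw [h2, tau2Tilde, tau2, omegaElt, map_smul, map_sum, map_sum, map_sum, smul_eq_mul]
  congr 1
  refine Finset.sum_congr rfl fun p _ => ?_
  rw [LinearMap.rTensor_tmul, LinearMap.BilinForm.tensorDistrib_tmul, map_smul, pow_two]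
  rfl

lemma polarCoeff_tmul (A : g m) {z : g m} (hz : z ∈ gr m (-2)) (p q : Fin m × Fin 3) :
    polarCoeff (A ⊗ₜ[ℂ] z) p q = polarForm A z (x1 p) (x1 q) := by
  rw [polarCoeff, tau2Tilde_tmul A hz, tau2Tilde_tmul A hz, tau2Tilde_tmul A hz, polarForm_apply]
  simp only [add_lie, lie_add, map_add]
  ring

/-- The value of a bilinear form on the symmetric tensor that corresponds to `τ̃₂(Y^*)`. -/
def quadL (β : g m →ₗ[ℂ] g m →ₗ[ℂ] ℂ) : g m ⊗[ℂ] g m →ₗ[ℂ] ℂ :=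
  ∑ p, ∑ q, β (x1Dual p) (x1Dual q) • polarLin p q

lemma quadL_apply (β : g m →ₗ[ℂ] g m →ₗ[ℂ] ℂ) (Y : g m ⊗[ℂ] g m) :
    quadL β Y = ∑ p, ∑ q, polarCoeff Y p q * β (x1Dual p) (x1Dual q) := by
  simp only [quadL, LinearMap.sum_apply, LinearMap.smul_apply, polarLin_apply, smul_eq_mul,
    mul_comm]

/-- The action of `W` on bilinear forms, up to sign. -/
def lieForm (W : g m) (β : g m →ₗ[ℂ] g m →ₗ[ℂ] ℂ) : g m →ₗ[ℂ] g m →ₗ[ℂ] ℂ :=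
  β ∘ₗ LieAlgebra.ad ℂ (g m) W + β.compl₂ (LieAlgebra.ad ℂ (g m) W)

lemma lieForm_apply (W : g m) (β : g m →ₗ[ℂ] g m →ₗ[ℂ] ℂ) (X X' : g m) :
    lieForm W β X X' = β ⁅W, X⁆ X' + β X ⁅W, X'⁆ := rfl

/-- The map `Y^* ↦ τ̃₂(Y^*)` is equivariant. -/
lemma quadL_lie {W : g m} (hW : W ∈ gr m 0) (β : g m →ₗ[ℂ] g m →ₗ[ℂ] ℂ) {Y : g m ⊗[ℂ] g m}
    (hY : Y ∈ WngDual m) : quadL β ⁅W, Y⁆ = quadL (lieForm W β) Y := by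
  have h : WngDual m ≤ LinearMap.ker
      (quadL β ∘ₗ LieModule.toEnd ℂ (g m) (g m ⊗[ℂ] g m) W - quadL (lieForm W β)) := by
    refine Submodule.map₂_le.2 fun A _ z hz => ?_
    rw [LinearMap.mem_ker, LinearMap.sub_apply, sub_eq_zero]
    change quadL β ⁅W, A ⊗ₜ[ℂ] z⁆ = quadL (lieForm W β) (A ⊗ₜ[ℂ] z)
    have hz' : ⁅W, z⁆ ∈ gr m (-2) := by simpa only [zero_add] using lie_mem_gr hW hz
    rw [TensorProduct.LieModule.lie_tmul_right, map_add, quadL_apply, quadL_apply, quadL_apply]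
    simp only [polarCoeff_tmul _ hz, polarCoeff_tmul _ hz']
    rw [← Finset.sum_add_distrib]
    simp only [← Finset.sum_add_distrib, ← add_mul, polarForm_lie, lieForm_apply, mul_add, neg_mul]
    simp only [Finset.sum_add_distrib, Finset.sum_neg_distrib, neg_add, add_mul]
    -- One variable at a time, W is moved from the coefficient form onto β by the invariance of the
    -- tensor of dual bases.
    congr 1
    · rw [Finset.sum_comm, Finset.sum_comm (f := fun p q : Fin m × Fin 3 =>
        polarForm A z (x1 p) (x1 q) * β ⁅W, x1Dual p⁆ (x1Dual q)), ← Finset.sum_neg_distrib]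
      refine Finset.sum_congr rfl fun q _ => ?_
      have := sum_form_lie_dual hW (LinearMap.mk₂ ℂ
        (fun X X' => polarForm A z X (x1 q) * β X' (x1Dual q))
        (fun X Y Z => by simp only [map_add, LinearMap.add_apply]; ring)
        (fun c X Y => by simp only [map_smul, LinearMap.smul_apply, smul_eq_mul]; ring)
        (fun X Y Z => by simp only [map_add, LinearMap.add_apply]; ring)
        (fun c X Y => by simp only [map_smul, LinearMap.smul_apply, smul_eq_mul]; ring))
      simp only [LinearMap.mk₂_apply] at this
      exact this.symm
    · rw [← Finset.sum_neg_distrib]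
      refine Finset.sum_congr rfl fun p _ => ?_
      have := sum_form_lie_dual hW (LinearMap.mk₂ ℂ
        (fun X X' => polarForm A z (x1 p) X * β (x1Dual p) X')
        (fun X Y Z => by simp only [map_add]; ring)
        (fun c X Y => by simp only [map_smul, smul_eq_mul]; ring)
        (fun X Y Z => by simp only [map_add]; ring)
        (fun c X Y => by simp only [map_smul, smul_eq_mul]; ring))
      simp only [LinearMap.mk₂_apply] at this
      exact this.symm
  exact sub_eq_zero.1 (h hY)

/-! ## The coefficients for `Y^* ∈ W^*` -/

/-- Invariance rewrites the left side as κ(z, [[A, x_p], x_q]). Here A changes only the middle index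
of x_p, and two vectors of 𝔤(1) have a non-zero bracket only if their middle indices are dual. -/
lemma killingForm_lng_lie_lie {A z : g m} (hA : A ∈ lng m) (p q : Fin m × Fin 3) :
    killingForm ℂ (g m) A ⁅x1 p, ⁅x1 q, z⁆⁆ = kap m / jCoeff (midIdx p.2 : Idx m)
      * (A : Mat m) (midIdx q.2) (midIdx (midDual p.2)) * (z : Mat m) (idxM p.1) (idxP q.1) := by
  obtain ⟨l, a⟩ := p
  obtain ⟨k, b⟩ := q
  rw [mem_lng_iff] at hA
  have hA0 : ∀ i j, ¬ (deg i = 0 ∧ deg j = 0) → (A : Mat m) i j = 0 := fun i j h => by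
    by_contra h0
    exact h (hA i j h0)
  have h1 : ⁅A, x1 (l, a)⁆ = -∑ t, (A : Mat m) (midIdx a) (midIdx t) • x1 (l, t) := by
    rw [x1, lie_rootVec, sum_idx (fun i => (A : Mat m) (midIdx a) i • _),
      Finset.sum_eq_zero, Finset.sum_eq_zero, Finset.sum_eq_zero, zero_sub, zero_add, zero_add]
    · rfl
    · intro j _
      rw [hA0 _ _ (by rw [deg_idxM]; omega), zero_smul]
    · intro j _
      rw [hA0 _ _ (by rw [deg_idxP]; omega), zero_smul]
    · intro j _
      rw [hA0 _ _ (by rw [deg_idxP]; omega), zero_smul]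
  have h2 : ∀ t, ⁅x1 (l, t), x1 (k, b)⁆
      = if t = midDual b then (jCoeff (midIdx b : Idx m))⁻¹ • rootVec (idxP k) (idxM l) else 0 := by
    intro t
    rw [x1, x1, lie_rootVec, Finset.sum_eq_zero, zero_sub, Finset.sum_eq_single (idxM l)]
    · rw [rootVec_apply]
      simp only [dualIdx_midIdx, dualIdx_idxP, idxP_ne_midIdx, midIdx_inj, jCoeff_idxP]
      by_cases h : t = midDual b
      · subst h
        rw [midDual_midDual, ← dualIdx_midIdx, jCoeff_dualIdx]
        simp
      · have h' : midDual t ≠ b := fun h' => h (by rw [← h', midDual_midDual])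
        simp [h, h']
    · intro i _ hi
      rw [rootVec_apply]
      simp [dualIdx_idxP, idxP_ne_midIdx, hi.symm]
    · simp
    · intro i _
      rw [rootVec_apply]
      simp [dualIdx_idxP, midIdx_ne_idxP, idxM_ne_idxP]
  have h3 : killingForm ℂ (g m) A ⁅x1 (l, a), ⁅x1 (k, b), z⁆⁆
      = killingForm ℂ (g m) z ⁅⁅A, x1 (l, a)⁆, x1 (k, b)⁆ := by
    have e1 := killingForm_lie_left (x1 (l, a)) A ⁅x1 (k, b), z⁆
    have e2 := killingForm_lie_left (x1 (k, b)) ⁅x1 (l, a), A⁆ z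
    rw [killingForm_comm z, ← lie_skew A, ← lie_skew (-⁅x1 (l, a), A⁆), lie_neg, neg_neg, e2, e1,
      neg_neg]
  have h4 : ⁅⁅A, x1 (l, a)⁆, x1 (k, b)⁆ = -((A : Mat m) (midIdx a) (midIdx (midDual b))
      • (jCoeff (midIdx b : Idx m))⁻¹ • rootVec (idxP k) (idxM l)) := by
    rw [h1, neg_lie, sum_lie]
    simp only [smul_lie, h2]
    rw [Finset.sum_eq_single (midDual b)]
    · rw [if_pos rfl]
    · intro t _ ht
      rw [if_neg ht, smul_zero]
    · simp
  have h5 : (A : Mat m) (midIdx a) (midIdx (midDual b)) = -(jCoeff (midIdx b : Idx m)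
      / jCoeff (midIdx a : Idx m) * (A : Mat m) (midIdx b) (midIdx (midDual a))) := by
    have h := coe_apply_dualIdx A (midIdx b) (midIdx (midDual a))
    rwa [dualIdx_midIdx, dualIdx_midIdx, midDual_midDual, ← dualIdx_midIdx a, jCoeff_dualIdx,
      dualIdx_midIdx] at h
  have ha := jCoeff_ne_zero (midIdx a : Idx m)
  have hb := jCoeff_ne_zero (midIdx b : Idx m)
  rw [h3, h4, map_neg, map_smul, map_smul, killingForm_rootVec', h5, smul_eq_mul, smul_eq_mul]
  field_simp

/-- Interchanging p and q changes the sign of both the entry of z and the middle factor, so the two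
orders in `polarForm` agree and a quarter becomes a half. The coefficient is a product of a middle
part and an outer part. -/
lemma polarCoeff_tmul_eq {A z : g m} (hA : A ∈ lng m) (hz : z ∈ gr m (-2)) (p q : Fin m × Fin 3) :
    polarCoeff (A ⊗ₜ[ℂ] z) p q = kap m / 2 / jCoeff (midIdx p.2 : Idx m)
      * (A : Mat m) (midIdx q.2) (midIdx (midDual p.2)) * (z : Mat m) (idxM p.1) (idxP q.1) := by
  have h := coe_apply_dualIdx A (midIdx q.2) (midIdx (midDual p.2))
  rw [dualIdx_midIdx, dualIdx_midIdx, midDual_midDual, ← dualIdx_midIdx p.2, jCoeff_dualIdx,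
    dualIdx_midIdx] at h
  have ha := jCoeff_ne_zero (midIdx p.2 : Idx m)
  have hb := jCoeff_ne_zero (midIdx q.2 : Idx m)
  rw [polarCoeff_tmul A hz, polarForm_apply, killingForm_lng_lie_lie hA, killingForm_lng_lie_lie hA,
    h, apply_idxM_idxP_swap z p.1 q.1]
  field_simp
  ring

lemma polarCoeff_antisymm {Y : g m ⊗[ℂ] g m} (hY : Y ∈ WngDual m) (k l : Fin m) (a b : Fin 3) :
    polarCoeff Y (k, a) (l, b) = -polarCoeff Y (l, a) (k, b) := by
  have h : WngDual m ≤ LinearMap.ker (polarLin (k, a) (l, b) + polarLin (l, a) (k, b)) := by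
    refine Submodule.map₂_le.2 fun A hA z hz => ?_
    rw [LinearMap.mem_ker, LinearMap.add_apply]
    change polarCoeff (A ⊗ₜ[ℂ] z) _ _ + polarCoeff (A ⊗ₜ[ℂ] z) _ _ = 0
    rw [polarCoeff_tmul_eq hA hz, polarCoeff_tmul_eq hA hz, apply_idxM_idxP_swap z k l]
    ring
  exact eq_neg_of_add_eq_zero_left (h hY)

/-- Symmetry under exchange of the pairs together with skewness in the outer index forces skewness
in the middle index. -/
lemma polarCoeff_antisymm' {Y : g m ⊗[ℂ] g m} (hY : Y ∈ WngDual m) (k l : Fin m) (a b : Fin 3) :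
    polarCoeff Y (k, a) (l, b) = -polarCoeff Y (k, b) (l, a) := by
  rw [polarCoeff_comm, polarCoeff_antisymm hY]

/-- Products of entries, as linear forms on `𝔤 ⊗ 𝔤`. -/
def ent (a b c d : Idx m) : g m ⊗[ℂ] g m →ₗ[ℂ] ℂ :=
  LinearMap.mul' ℂ ℂ ∘ₗ TensorProduct.map (Matrix.entryLinearMap ℂ ℂ a b ∘ₗ coeMat m)
    (Matrix.entryLinearMap ℂ ℂ c d ∘ₗ coeMat m)

lemma ent_tmul (a b c d : Idx m) (A B : g m) :
    ent a b c d (A ⊗ₜ[ℂ] B) = (A : Mat m) a b * (B : Mat m) c d := rfl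

lemma two_smul_eq_sum (X : g m) : (2 : ℂ) • X = ∑ p : Idx m × Idx m, (X : Mat m) p.1 p.2 • rootVec p.1 p.2 := by
  rw [← skewPart_coe, Fintype.sum_prod_type]
  conv_lhs => rw [Matrix.matrix_eq_sum_single (X : Mat m)]
  rw [map_sum]
  refine Finset.sum_congr rfl fun a _ => ?_
  rw [map_sum]
  refine Finset.sum_congr rfl fun b _ => ?_
  rw [rootVec_eq_skewPart, ← map_smul, Matrix.smul_single, smul_eq_mul, mul_one]

lemma four_smul_eq_sum (T : g m ⊗[ℂ] g m) : (4 : ℂ) • T = ∑ p : Idx m × Idx m, ∑ q : Idx m × Idx m,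
    ent p.1 p.2 q.1 q.2 T • rootVec p.1 p.2 ⊗ₜ[ℂ] rootVec q.1 q.2 := by
  induction T using TensorProduct.induction_on with
  | zero => simp
  | tmul A B =>
    have h : (4 : ℂ) • A ⊗ₜ[ℂ] B = ((2 : ℂ) • A) ⊗ₜ[ℂ] ((2 : ℂ) • B) := by
      rw [TensorProduct.smul_tmul_smul]
      norm_num
    rw [h, two_smul_eq_sum, two_smul_eq_sum, TensorProduct.sum_tmul]
    refine Finset.sum_congr rfl fun p _ => ?_
    rw [TensorProduct.tmul_sum]
    refine Finset.sum_congr rfl fun q _ => ?_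
    rw [TensorProduct.smul_tmul_smul, ent_tmul]
  | add S T hS hT =>
    rw [smul_add, hS, hT]
    simp only [map_add, add_smul, Finset.sum_add_distrib]

lemma eq_zero_of_ent {T : g m ⊗[ℂ] g m} (h : ∀ a b c d, ent a b c d T = 0) : T = 0 := by
  have h4 := four_smul_eq_sum T
  simp only [h, zero_smul, Finset.sum_const_zero] at h4
  exact (smul_eq_zero.1 h4).resolve_left (by norm_num)

/-- Up to a non-zero factor the coefficients are the entries of Y in the block 𝔩_{nγ} ⊗ 𝔤(-2); the
other entries vanish by degree. Hence Y^* ↦ τ̃₂(Y^*) is injective on W^*. -/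
lemma eq_zero_of_polarCoeff {Y : g m ⊗[ℂ] g m} (hY : Y ∈ WngDual m)
    (h : ∀ p q, polarCoeff Y p q = 0) : Y = 0 := by
  refine eq_zero_of_ent fun a b c d => ?_
  by_cases habcd : (deg a = 0 ∧ deg b = 0) ∧ deg c - deg d = -2
  · obtain ⟨s, rfl⟩ := exists_midIdx habcd.1.1
    obtain ⟨t, rfl⟩ := exists_midIdx habcd.1.2
    have hc : deg c = -1 ∧ deg d = 1 := by
      rcases deg_cases c with h1 | h1 | h1 <;> rcases deg_cases d with h2 | h2 | h2 <;> omega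
    obtain ⟨k, rfl⟩ := exists_idxM hc.1
    obtain ⟨l, rfl⟩ := exists_idxP hc.2
    have hle : WngDual m ≤ LinearMap.ker (polarLin (k, midDual t) (l, s)
        - (kap m / 2 / jCoeff (midIdx (midDual t) : Idx m)) •
          ent (midIdx s) (midIdx t) (idxM k) (idxP l)) := by
      refine Submodule.map₂_le.2 fun A hA z hz => ?_
      rw [LinearMap.mem_ker, LinearMap.sub_apply, LinearMap.smul_apply]
      change polarCoeff (A ⊗ₜ[ℂ] z) _ _ - _ • ((A : Mat m) _ _ * (z : Mat m) _ _) = 0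
      rw [polarCoeff_tmul_eq hA hz, midDual_midDual, smul_eq_mul]
      ring
    have h1 := sub_eq_zero.1 (hle hY)
    rw [polarLin_apply, h, LinearMap.smul_apply] at h1
    refine (smul_eq_zero.1 h1.symm).resolve_left ?_
    exact div_ne_zero (div_ne_zero kap_ne_zero two_ne_zero) (jCoeff_ne_zero _)
  · have hle : WngDual m ≤ LinearMap.ker (ent a b c d) := by
      refine Submodule.map₂_le.2 fun A hA z hz => ?_
      change (A : Mat m) a b * (z : Mat m) c d = 0
      by_contra h0
      exact habcd ⟨(mem_lng_iff A).1 hA a b (left_ne_zero_of_mul h0),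
        (mem_gr_iff _ z).1 hz c d (right_ne_zero_of_mul h0)⟩
    exact hle hY

/-! ## The commutators with `τ̃₂(Y^*)`: algebra -/

lemma coe_mul_rootVec_apply (X : g m) (a b c d : Idx m) : ((X : Mat m) * (rootVec a b : Mat m)) c d
    = (if b = d then (X : Mat m) c a else 0)
      - (if dualIdx a = d then jCoeff a / jCoeff b * (X : Mat m) c (dualIdx b) else 0) := by
  rw [Matrix.mul_apply]
  simp only [rootVec_apply, mul_sub, Finset.sum_sub_distrib]
  congr 1
  · rw [Finset.sum_eq_single a]
    · simp
    · intro i _ hi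
      simp [hi.symm]
    · simp
  · rw [Finset.sum_eq_single (dualIdx b)]
    · simp [mul_comm]
    · intro i _ hi
      simp [hi.symm]
    · simp

lemma rootVec_mul_coe_apply (X : g m) (a b c d : Idx m) : ((rootVec a b : Mat m) * (X : Mat m)) c d
    = (if a = c then (X : Mat m) b d else 0)
      - (if dualIdx b = c then jCoeff a / jCoeff b * (X : Mat m) (dualIdx a) d else 0) := by
  rw [Matrix.mul_apply]
  simp only [rootVec_apply, sub_mul, Finset.sum_sub_distrib]
  congr 1
  · rw [Finset.sum_eq_single b]
    · simp
    · intro i _ hi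
      simp [hi.symm]
    · simp
  · rw [Finset.sum_eq_single (dualIdx a)]
    · simp
    · intro i _ hi
      simp [hi.symm]
    · simp

lemma lie_rootVec_apply (X : g m) (a b c d : Idx m) : ((⁅X, rootVec a b⁆ : g m) : Mat m) c d
    = (if b = d then (X : Mat m) c a else 0)
      - (if dualIdx a = d then jCoeff a / jCoeff b * (X : Mat m) c (dualIdx b) else 0)
      - ((if a = c then (X : Mat m) b d else 0)
      - (if dualIdx b = c then jCoeff a / jCoeff b * (X : Mat m) (dualIdx a) d else 0)) := by
  rw [coe_lie, Matrix.sub_apply, coe_mul_rootVec_apply, rootVec_mul_coe_apply]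

lemma lam_lie_yv (X : g m) (p : Fin m × Fin 3) :
    lam m ⁅X, yv p⁆ = (X : Mat m) (idxP p.1) (midIdx p.2) := by
  obtain ⟨j, b⟩ := p
  rw [lam_apply]
  simp [yv, lie_rootVec_apply, dualIdx_midIdx, dualIdx_idxP, midIdx_ne_idxP, idxM_ne_idxP, idxP_inj]

lemma lie_mem_gr_of_eq {j k l : ℤ} (h : j + k = l) {X Z : g m} (hX : X ∈ gr m j)
    (hZ : Z ∈ gr m k) : ⁅X, Z⁆ ∈ gr m l := h ▸ lie_mem_gr hX hZ

lemma midDual_eq_iff {a b : Fin 3} : midDual a = b ↔ a = midDual b :=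
  ⟨fun h => by rw [← h, midDual_midDual], fun h => by rw [h, midDual_midDual]⟩

lemma lie_yv_apply_midIdx (W : g m) (k : Fin m) (a b t : Fin 3) :
    ((⁅W, yv (k, a)⁆ : g m) : Mat m) (midIdx t) (midIdx b)
      = -((if a = midDual b then jCoeff (midIdx a : Idx m) else 0) * (W : Mat m) (midIdx t) (idxM k))
        - (if a = t then (W : Mat m) (idxP k) (midIdx b) else 0) := by
  rw [yv, lie_rootVec_apply]
  simp [dualIdx_midIdx, dualIdx_idxP, idxP_ne_midIdx, idxM_ne_midIdx, midIdx_inj, jCoeff_idxP,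
    midDual_eq_iff]

lemma lie_yv_apply_idxP (W : g m) (k j l : Fin m) (a : Fin 3) :
    ((⁅W, yv (k, a)⁆ : g m) : Mat m) (idxP j) (idxP l)
      = if k = l then (W : Mat m) (idxP j) (midIdx a) else 0 := by
  rw [yv, lie_rootVec_apply]
  simp [dualIdx_midIdx, dualIdx_idxP, midIdx_ne_idxP, idxM_ne_idxP, idxP_inj]

lemma lie_yv_of_mem {V : g m} (hV : V ∈ gr m 0) (j : Fin m) (b : Fin 3) :
    ⁅V, yv (j, b)⁆ = ∑ t, (V : Mat m) (midIdx t) (midIdx b) • yv (j, t)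
      - ∑ l, (V : Mat m) (idxP j) (idxP l) • yv (l, b) := by
  refine (lie_rootVec V (midIdx b) (idxP j)).trans ?_
  rw [sum_idx, sum_idx]
  have z1 : ∀ l, (V : Mat m) (idxP l) (midIdx b) = 0 := fun l =>
    gr_apply_eq_zero hV (by rw [deg_idxP, deg_midIdx]; decide)
  have z2 : ∀ l, (V : Mat m) (idxM l) (midIdx b) = 0 := fun l =>
    gr_apply_eq_zero hV (by rw [deg_idxM, deg_midIdx]; decide)
  have z3 : ∀ l, (V : Mat m) (idxP j) (idxM l) = 0 := fun l =>
    gr_apply_eq_zero hV (by rw [deg_idxM, deg_idxP]; decide)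
  have z4 : ∀ t, (V : Mat m) (idxP j) (midIdx t) = 0 := fun t =>
    gr_apply_eq_zero hV (by rw [deg_midIdx, deg_idxP]; decide)
  simp only [z1, z2, z3, z4, zero_smul, Finset.sum_const_zero, zero_add, add_zero]
  rfl

/-- The bracket [W, y] lies in 𝔤(0), whose middle block acts on the middle index and whose 𝔤𝔩-block
acts on the outer index. This gives one contraction of middle indices and two terms in which the
indices of the two vectors are recombined. -/
lemma lie_lie_yv {W : g m} (hW : W ∈ gr m 1) (k j : Fin m) (a b : Fin 3) :
    ⁅yv (j, b), ⁅yv (k, a), W⁆⁆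
      = (if a = midDual b then jCoeff (midIdx a : Idx m) else 0)
          • (-∑ t, (W : Mat m) (midIdx t) (idxM k) • yv (j, t))
        - (W : Mat m) (idxP k) (midIdx b) • yv (j, a)
        - (W : Mat m) (idxP j) (midIdx a) • yv (k, b) := by
  have hV : ⁅W, yv (k, a)⁆ ∈ gr m 0 := lie_mem_gr_of_eq (by decide) hW (yv_mem _)
  have h1 : ⁅yv (j, b), ⁅yv (k, a), W⁆⁆ = ⁅⁅W, yv (k, a)⁆, yv (j, b)⁆ := by
    rw [← lie_skew, ← lie_skew W, neg_lie]
  rw [h1, lie_yv_of_mem hV]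
  simp only [lie_yv_apply_midIdx, lie_yv_apply_idxP, sub_smul, Finset.sum_sub_distrib, ite_smul,
    zero_smul, Finset.sum_ite_eq, Finset.mem_univ, if_true, neg_smul, mul_smul, smul_neg,
    Finset.smul_sum, Finset.sum_neg_distrib]

lemma lam_lie_lie_yv {W : g m} (k j : Fin m) (a b : Fin 3) :
    lam m ⁅yv (j, b), ⁅yv (k, a), W⁆⁆
      = (if a = midDual b then jCoeff (midIdx a : Idx m) else 0)
          * -(W : Mat m) (idxP j) (idxM k) := by
  have h1 : ⁅yv (j, b), ⁅yv (k, a), W⁆⁆ = ⁅⁅W, yv (k, a)⁆, yv (j, b)⁆ := by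
    rw [← lie_skew, ← lie_skew W, neg_lie]
  rw [h1, lam_lie_yv, yv, lie_rootVec_apply]
  simp [dualIdx_midIdx, dualIdx_idxP, midIdx_ne_idxP, idxP_ne_midIdx, idxM_ne_idxP, midIdx_inj,
    jCoeff_idxP, midDual_eq_iff]

/-! ### Sums against coefficients skew in each index -/

section Antisymmetric

variable {K : Fin m × Fin 3 → Fin m × Fin 3 → ℂ}

/-- The inner factor is the symmetric form on ℂ³, and skew coefficients contract to zero with it. -/
lemma sum_antisymm_mid (hK : ∀ k l a b, K (k, a) (l, b) = -K (k, b) (l, a))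
    (G : Fin m → Fin m → ℂ) : ∑ p, ∑ q, K p q
      * ((if p.2 = midDual q.2 then jCoeff (midIdx p.2 : Idx m) else 0) * G p.1 q.1) = 0 := by
  simp only [Fintype.sum_prod_type]
  refine Finset.sum_eq_zero fun k _ => ?_
  rw [Finset.sum_comm]
  refine Finset.sum_eq_zero fun l _ => ?_
  have h0 : K (k, 0) (l, 0) = 0 := by linear_combination (1 / 2 : ℂ) * hK k l 0 0
  have h1 := hK k l 1 2
  simp [Fin.sum_univ_three, midDual, midIdx, jCoeff, h0, h1]

/-- Relabelling the two middle summation indices costs a sign; the next lemma does this for the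
outer indices. -/
lemma sum_antisymm_swap_mid (hK : ∀ k l a b, K (k, a) (l, b) = -K (k, b) (l, a))
    (G : Fin m → Fin 3 → Fin m → Fin 3 → ℂ) :
    ∑ p, ∑ q, K p q * G p.1 q.2 q.1 p.2 = -∑ p, ∑ q, K p q * G p.1 p.2 q.1 q.2 := by
  simp only [Fintype.sum_prod_type]
  rw [← Finset.sum_neg_distrib]
  refine Finset.sum_congr rfl fun k _ => ?_
  rw [Finset.sum_comm, Finset.sum_comm (f := fun a l => ∑ b, K (k, a) (l, b) * G k a l b),
    ← Finset.sum_neg_distrib]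
  refine Finset.sum_congr rfl fun l _ => ?_
  rw [Finset.sum_comm, ← Finset.sum_neg_distrib]
  refine Finset.sum_congr rfl fun a _ => ?_
  rw [← Finset.sum_neg_distrib]
  refine Finset.sum_congr rfl fun b _ => ?_
  rw [hK, neg_mul]

lemma sum_antisymm_swap (hK : ∀ k l a b, K (k, a) (l, b) = -K (l, a) (k, b))
    (G : Fin m → Fin 3 → Fin m → Fin 3 → ℂ) :
    ∑ p, ∑ q, K p q * G q.1 p.2 p.1 q.2 = -∑ p, ∑ q, K p q * G p.1 p.2 q.1 q.2 := by
  simp only [Fintype.sum_prod_type]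
  have hl : ∀ H : Fin m → Fin 3 → Fin m → Fin 3 → ℂ, ∑ k, ∑ a, ∑ l, ∑ b, H k a l b
      = ∑ a, ∑ b, ∑ k, ∑ l, H k a l b := fun H => by
    rw [Finset.sum_comm]
    refine Finset.sum_congr rfl fun a _ => ?_
    rw [Finset.sum_comm' (t' := Finset.univ) (s' := fun _ => Finset.univ) (by simp)]
    rw [Finset.sum_congr rfl fun k _ => Finset.sum_comm, Finset.sum_comm]
    refine Finset.sum_congr rfl fun b _ => Finset.sum_comm
  rw [hl, hl fun k a l b => K (k, a) (l, b) * G k a l b, ← Finset.sum_neg_distrib]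
  refine Finset.sum_congr rfl fun a _ => ?_
  rw [← Finset.sum_neg_distrib]
  refine Finset.sum_congr rfl fun b _ => ?_
  rw [Finset.sum_comm, ← Finset.sum_neg_distrib]
  refine Finset.sum_congr rfl fun k _ => ?_
  rw [← Finset.sum_neg_distrib]
  refine Finset.sum_congr rfl fun l _ => ?_
  rw [hK, neg_mul]

end Antisymmetric

/-! ### The commutator, one graded component of W at a time -/

section Comm

variable (s c : ℂ) (e : g m →ₗ[ℂ] ℂ) (b : g m →ₗ[ℂ] g m →ₗ[ℂ] ℂ)

/-- The commutator of the action of `W ∈ 𝔤` with `R(Z₁)R(Z₂)`, in terms of the value `c`, the first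
derivatives `e` and the second derivatives `b` of a section. -/
def commForm (Z₁ Z₂ W : g m) : ℂ :=
  s * lam m ⁅Z₁, W⁆ * e Z₂ - b (lieQ Z₁ W) Z₂
    + s * lam m ⁅Z₂, W⁆ * e Z₁ - b (lieQ Z₂ W) Z₁
    - s * lam m ⁅Z₂, ⁅Z₁, W⁆⁆ * c
    + e (lieQ Z₂ ⁅Z₁, W⁆ - ⁅Z₁, prN m (lieQ Z₂ W)⁆)

lemma commForm_add (Z₁ Z₂ W W' : g m) : commForm s c e b Z₁ Z₂ (W + W')
    = commForm s c e b Z₁ Z₂ W + commForm s c e b Z₁ Z₂ W' := by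
  simp only [commForm, lieQ, lie_add, map_add, map_sub, LinearMap.add_apply, LinearMap.sub_apply,
    lie_sub]
  ring

variable {e b}

/-- Left and right translations commute. Here `lieQ` depends on the 𝔮-component only, and λ_𝔮
vanishes on 𝔫̄. -/
lemma commForm_nbar {Z₁ Z₂ W : g m} (h₁ : Z₁ ∈ gr m (-1)) (h₂ : Z₂ ∈ gr m (-1))
    (hW : W ∈ nbar m) : commForm s c e b Z₁ Z₂ W = 0 := by
  have hl : ∀ {X : g m}, X ∈ nbar m → lam m X = 0 := fun {X} hX => by
    obtain ⟨A, hA, B, hB, rfl⟩ := Submodule.mem_sup.1 hX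
    rw [map_add, lam_eq_zero (by decide) hA, lam_eq_zero (by decide) hB, add_zero]
  have k₁ := gr_neg_one_le h₁
  have k₂ := gr_neg_one_le h₂
  have q : ∀ {Z X : g m}, X ∈ nbar m → lieQ Z X = 0 := fun {Z X} hX => by
    rw [lieQ, prN_of_mem hX, sub_self]
  have a1 := lie_mem_nbar k₁ hW
  have a2 := lie_mem_nbar k₂ hW
  rw [commForm, hl a1, hl a2, hl (lie_mem_nbar k₂ a1), q hW, q hW, q a1, map_zero, map_zero,
    lie_zero, sub_zero, map_zero]
  simp

/-- The first order term -e([Z₁, [Z₂, W]]) serves, through `hb`, to reorder b([Z₂, W], Z₁) into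
b(Z₁, [Z₂, W]), leaving the derivation action of W on b. -/
lemma commForm_zero (hb : ∀ X ∈ nbar m, ∀ Z ∈ nbar m, e ⁅X, Z⁆ = b X Z - b Z X) {Z₁ Z₂ W : g m}
    (h₁ : Z₁ ∈ gr m (-1)) (h₂ : Z₂ ∈ gr m (-1)) (hW : W ∈ gr m 0) :
    commForm s c e b Z₁ Z₂ W = lieForm W b Z₁ Z₂ := by
  have a1 : ⁅Z₁, W⁆ ∈ gr m (-1) := lie_mem_gr_of_eq (by decide) h₁ hW
  have a2 : ⁅Z₂, W⁆ ∈ gr m (-1) := lie_mem_gr_of_eq (by decide) h₂ hW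
  have a3 : ⁅Z₂, ⁅Z₁, W⁆⁆ ∈ gr m (-2) := lie_mem_gr_of_eq (by decide) h₂ a1
  rw [commForm, lieQ, lieQ, lieQ, prN_eq_zero le_rfl hW, prN_of_mem (gr_neg_one_le a1),
    lie_zero, sub_zero, lie_zero, sub_zero, sub_self, prN_of_mem (gr_neg_one_le a2), zero_sub,
    map_neg, hb _ (gr_neg_one_le h₁) _ (gr_neg_one_le a2), lam_eq_zero (by decide) a1,
    lam_eq_zero (by decide) a2, lam_eq_zero (by decide) a3, lieForm_apply, ← lie_skew W Z₁,
    ← lie_skew W Z₂, map_neg, map_neg, LinearMap.neg_apply]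
  ring

/-- Single brackets with W fall into 𝔤(0), which right translation ignores, so no second order part
survives. -/
lemma commForm_one (he : ∀ X ∈ gr m 0, b X = 0) {Z₁ Z₂ W : g m}
    (h₁ : Z₁ ∈ gr m (-1)) (h₂ : Z₂ ∈ gr m (-1)) (hW : W ∈ gr m 1) :
    commForm s c e b Z₁ Z₂ W = s * lam m ⁅Z₁, W⁆ * e Z₂ + s * lam m ⁅Z₂, W⁆ * e Z₁
      + e ⁅Z₂, ⁅Z₁, W⁆⁆ := by
  have a1 : ⁅Z₁, W⁆ ∈ gr m 0 := lie_mem_gr_of_eq (by decide) h₁ hW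
  have a2 : ⁅Z₂, W⁆ ∈ gr m 0 := lie_mem_gr_of_eq (by decide) h₂ hW
  have a3 : ⁅Z₂, ⁅Z₁, W⁆⁆ ∈ gr m (-1) := lie_mem_gr_of_eq (by decide) h₂ a1
  rw [commForm, lieQ, lieQ, lieQ, prN_eq_zero (by decide) hW, prN_eq_zero le_rfl a1]
  simp only [lie_zero, sub_zero]
  rw [prN_eq_zero le_rfl a2, lie_zero, sub_zero,
    he _ a1, he _ a2, lam_eq_zero (by decide) a3]
  simp

/-- Single brackets land in 𝔤(1) and double ones in 𝔤(0); both are invisible to right translation,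
and only the character sees the latter. -/
lemma commForm_two (he : ∀ X ∈ gr m 0, e X = 0) (hb : ∀ X ∈ gr m 1, b X = 0) {Z₁ Z₂ W : g m}
    (h₁ : Z₁ ∈ gr m (-1)) (h₂ : Z₂ ∈ gr m (-1)) (hW : W ∈ gr m 2) :
    commForm s c e b Z₁ Z₂ W = -s * c * lam m ⁅Z₂, ⁅Z₁, W⁆⁆ := by
  have a1 : ⁅Z₁, W⁆ ∈ gr m 1 := lie_mem_gr_of_eq (by decide) h₁ hW
  have a2 : ⁅Z₂, W⁆ ∈ gr m 1 := lie_mem_gr_of_eq (by decide) h₂ hW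
  have a3 : ⁅Z₂, ⁅Z₁, W⁆⁆ ∈ gr m 0 := lie_mem_gr_of_eq (by decide) h₂ a1
  rw [commForm, lieQ, lieQ, lieQ, prN_eq_zero (by decide) hW, prN_eq_zero (by decide) a1]
  simp only [lie_zero, sub_zero]
  rw [prN_eq_zero (by decide) a2, lie_zero, sub_zero,
    hb _ a1, hb _ a2, he _ a3, lam_eq_zero (by decide) a1, lam_eq_zero (by decide) a2]
  simp
  ring

/-- This is where s = 1 appears. The two character terms give -s each, the contraction `s1`
vanishes, and the exchanges `s2` and `s3` turn the remaining parts of the double bracket into +1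
each. -/
lemma sum_commForm_one {Y : g m ⊗[ℂ] g m} (hY : Y ∈ WngDual m)
    (he : ∀ X ∈ gr m 0, b X = 0) {W : g m} (hW : W ∈ gr m 1) :
    ∑ p, ∑ q, polarCoeff Y p q * commForm s c e b (x1Dual p) (x1Dual q) W
      = 2 * (1 - s) * (kap m)⁻¹ ^ 2 * ∑ p, ∑ q, polarCoeff Y p q
          * ((W : Mat m) (idxP p.1) (midIdx p.2) * e (yv q)) := by
  have h1 : ∀ p q : Fin m × Fin 3, polarCoeff Y p q * commForm s c e b (x1Dual p) (x1Dual q) W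
      = -(s * (kap m)⁻¹ ^ 2 * (polarCoeff Y p q * ((W : Mat m) (idxP p.1) (midIdx p.2) * e (yv q))))
        - s * (kap m)⁻¹ ^ 2 * (polarCoeff Y q p * ((W : Mat m) (idxP q.1) (midIdx q.2) * e (yv p)))
        + (kap m)⁻¹ ^ 2 * (polarCoeff Y p q
          * ((if p.2 = midDual q.2 then jCoeff (midIdx p.2 : Idx m) else 0)
          * e (-∑ t, (W : Mat m) (midIdx t) (idxM p.1) • yv (q.1, t))))
        - (kap m)⁻¹ ^ 2 * (polarCoeff Y p q
          * ((W : Mat m) (idxP p.1) (midIdx q.2) * e (yv (q.1, p.2))))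
        - (kap m)⁻¹ ^ 2 * (polarCoeff Y p q
          * ((W : Mat m) (idxP q.1) (midIdx p.2) * e (yv (p.1, q.2)))) := by
    intro p q
    rw [commForm_one s c he (x1Dual_mem_gr p) (x1Dual_mem_gr q) hW, polarCoeff_comm Y q p,
      x1Dual_eq, x1Dual_eq, smul_lie, smul_lie, smul_lie, lie_smul, lie_lie_yv hW, ← lie_skew,
      ← lie_skew (yv q)]
    simp only [map_sub, map_smul, map_neg, smul_eq_mul, lam_lie_yv]
    ring
  have s1 := sum_antisymm_mid (K := polarCoeff Y) (polarCoeff_antisymm' hY) fun k j =>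
    e (-∑ t, (W : Mat m) (midIdx t) (idxM k) • yv (j, t))
  have s2 := sum_antisymm_swap_mid (K := polarCoeff Y) (polarCoeff_antisymm' hY) fun k a j b =>
    (W : Mat m) (idxP k) (midIdx a) * e (yv (j, b))
  have s3 := sum_antisymm_swap (K := polarCoeff Y) (polarCoeff_antisymm hY) fun k a j b =>
    (W : Mat m) (idxP k) (midIdx a) * e (yv (j, b))
  have s4 : ∑ p, ∑ q, polarCoeff Y q p * ((W : Mat m) (idxP q.1) (midIdx q.2) * e (yv p))
      = ∑ p, ∑ q, polarCoeff Y p q * ((W : Mat m) (idxP p.1) (midIdx p.2) * e (yv q)) :=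
    Finset.sum_comm
  simp only [h1, Finset.sum_add_distrib, Finset.sum_sub_distrib, Finset.sum_neg_distrib,
    ← Finset.mul_sum]
  rw [s1, s2, s3, s4]
  ring

/-- The character of the double bracket is a contraction of the middle indices, hence orthogonal to
skew coefficients. -/
lemma sum_commForm_two {Y : g m ⊗[ℂ] g m} (hY : Y ∈ WngDual m)
    (he : ∀ X ∈ gr m 0, e X = 0) (hb : ∀ X ∈ gr m 1, b X = 0) {W : g m}
    (hW : W ∈ gr m 2) :
    ∑ p, ∑ q, polarCoeff Y p q * commForm s c e b (x1Dual p) (x1Dual q) W = 0 := by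
  have h1 : ∀ p q : Fin m × Fin 3, polarCoeff Y p q * commForm s c e b (x1Dual p) (x1Dual q) W
      = -s * c * (kap m)⁻¹ ^ 2 * (polarCoeff Y p q
        * ((if p.2 = midDual q.2 then jCoeff (midIdx p.2 : Idx m) else 0)
          * -(W : Mat m) (idxP q.1) (idxM p.1))) := by
    intro p q
    rw [commForm_two s c he hb (x1Dual_mem_gr p) (x1Dual_mem_gr q) hW, x1Dual_eq, x1Dual_eq,
      smul_lie, smul_lie, lie_smul, map_smul, map_smul, lam_lie_lie_yv, smul_eq_mul, smul_eq_mul]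
    ring
  have s1 := sum_antisymm_mid (K := polarCoeff Y) (polarCoeff_antisymm' hY) fun k j =>
    -(W : Mat m) (idxP j) (idxM k)
  simp only [h1, ← Finset.mul_sum]
  rw [s1, mul_zero]

/-- The commutator of the action of `W` with the second order operator given by `Y^*`. -/
theorem sum_commForm {Y : g m ⊗[ℂ] g m} (hY : Y ∈ WngDual m)
    (hb : ∀ X ∈ nbar m, ∀ Z ∈ nbar m, e ⁅X, Z⁆ = b X Z - b Z X)
    (he : ∀ X, prN m X = 0 → e X = 0) (hb' : ∀ X, prN m X = 0 → b X = 0) (W : g m) :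
    ∑ p, ∑ q, polarCoeff Y p q * commForm s c e b (x1Dual p) (x1Dual q) W
      = quadL b ⁅grProj m 0 W, Y⁆ + 2 * (1 - s) * (kap m)⁻¹ ^ 2 * ∑ p, ∑ q, polarCoeff Y p q
          * ((W : Mat m) (idxP p.1) (midIdx p.2) * e (yv q)) := by
  have h1 : ∀ p q : Fin m × Fin 3, polarCoeff Y p q * commForm s c e b (x1Dual p) (x1Dual q) W
      = polarCoeff Y p q * lieForm (grProj m 0 W) b (x1Dual p) (x1Dual q)
        + polarCoeff Y p q * commForm s c e b (x1Dual p) (x1Dual q) (grProj m 1 W)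
        + polarCoeff Y p q * commForm s c e b (x1Dual p) (x1Dual q) (grProj m 2 W) := by
    intro p q
    conv_lhs => rw [gr_apply_x (X := W)]
    rw [commForm_add, commForm_add, commForm_add,
      commForm_nbar s c (x1Dual_mem_gr p) (x1Dual_mem_gr q) (prN_mem W),
      commForm_zero s c hb (x1Dual_mem_gr p) (x1Dual_mem_gr q) (grProj_mem 0 W)]
    ring
  simp only [h1, Finset.sum_add_distrib]
  rw [sum_commForm_one s c hY (fun X hX => hb' X (prN_eq_zero le_rfl hX)) (grProj_mem 1 W),
    sum_commForm_two s c hY (fun X hX => he X (prN_eq_zero le_rfl hX))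
      (fun X hX => hb' X (prN_eq_zero (by decide) hX)) (grProj_mem 2 W),
    quadL_lie (grProj_mem 0 W) b hY, quadL_apply, add_zero]
  congr 2
  refine Finset.sum_congr rfl fun p _ => Finset.sum_congr rfl fun q _ => ?_
  have h2 : (grProj m 1 W : Mat m) (idxP p.1) (midIdx p.2) = (W : Mat m) (idxP p.1) (midIdx p.2) :=
    if_pos (by rw [deg_idxP, deg_midIdx]; rfl)
  rw [h2]

end Comm

/-! ## The operators `Ω₂(Y^*)` -/

section Omega

variable (ρ : RealForm m)

/-- The bilinear form `(Z, Z') ↦ (R(Z)R(Z')f)(u)`. -/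
def evalB (f : Smooth ρ) (u : NBar ρ) : g m →ₗ[ℂ] g m →ₗ[ℂ] ℂ where
  toFun Z := evalRR ρ Z f u
  map_add' Z Z' := LinearMap.ext fun v => (evalR ρ (R ρ v f) u).map_add Z Z'
  map_smul' c Z := LinearMap.ext fun v => (evalR ρ (R ρ v f) u).map_smul c Z

lemma evalB_apply (f : Smooth ρ) (u : NBar ρ) (Z Z' : g m) :
    evalB ρ f u Z Z' = R ρ Z (R ρ Z' f) u := rfl

/-- The operator `Ω₂(Y^*)` on the algebra of smooth functions. -/
def omegaS (Y : g m ⊗[ℂ] g m) (f : Smooth ρ) : Smooth ρ :=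
  ∑ p, ∑ q, polarCoeff Y p q • R ρ (x1Dual p) (R ρ (x1Dual q) f)

lemma omegaS_apply (Y : g m ⊗[ℂ] g m) (f : Smooth ρ) (u : NBar ρ) :
    omegaS ρ Y f u = ∑ p, ∑ q, polarCoeff Y p q * evalB ρ f u (x1Dual p) (x1Dual q) := by
  rw [omegaS, Smooth.sum_apply]
  refine Finset.sum_congr rfl fun p _ => ?_
  rw [Smooth.sum_apply]
  exact Finset.sum_congr rfl fun q _ => Smooth.smul_apply _ _ _

lemma right_right_eq (f : Smooth ρ) (u : NBar ρ) (p q : Fin m × Fin 3) :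
    right ρ ⟨x1Dual p, x1Dual_mem p⟩ (right ρ ⟨x1Dual q, x1Dual_mem q⟩ f) u
      = evalB ρ f u (x1Dual p) (x1Dual q) := by
  rw [← nbarPart_of_mem (x1Dual_mem p), ← nbarPart_of_mem (x1Dual_mem q)]
  rfl

/-- The coefficients are symmetric in p and q, so the symmetrization changes nothing in the sum. -/
lemma Omega2_eq (Y : g m ⊗[ℂ] g m) (f : Smooth ρ) (u : NBar ρ) :
    Omega2 ρ Y f u = omegaS ρ Y f u := by
  rw [omegaS_apply]
  have h1 : ∀ p q : Fin m × Fin 3, polarCoeff Y p q * ((1 / 2 : ℂ) *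
      (right ρ ⟨x1Dual p, x1Dual_mem p⟩ (right ρ ⟨x1Dual q, x1Dual_mem q⟩ f) u
        + right ρ ⟨x1Dual q, x1Dual_mem q⟩ (right ρ ⟨x1Dual p, x1Dual_mem p⟩ f) u))
      = (1 / 2 : ℂ) * (polarCoeff Y p q * evalB ρ f u (x1Dual p) (x1Dual q))
        + (1 / 2 : ℂ) * (polarCoeff Y q p * evalB ρ f u (x1Dual q) (x1Dual p)) := by
    intro p q
    rw [right_right_eq, right_right_eq, polarCoeff_comm Y q p]
    ring
  have h2 : ∑ p, ∑ q, polarCoeff Y q p * evalB ρ f u (x1Dual q) (x1Dual p)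
      = ∑ p, ∑ q, polarCoeff Y p q * evalB ρ f u (x1Dual p) (x1Dual q) := Finset.sum_comm
  simp only [Omega2, h1, Finset.sum_add_distrib, ← Finset.mul_sum]
  rw [h2]
  ring

lemma Omega2_eq_quadL (Y : g m ⊗[ℂ] g m) (f : Smooth ρ) (u : NBar ρ) :
    Omega2 ρ Y f u = quadL (evalB ρ f u) Y := by
  rw [Omega2_eq, omegaS_apply, quadL_apply]

lemma actS_sum_smul (s : ℂ) (X : g m) {ι : Type*} (t : Finset ι) (c : ι → ℂ) (F : ι → Smooth ρ)
    (u : NBar ρ) : actS ρ s X (∑ i ∈ t, c i • F i) u = ∑ i ∈ t, c i * actS ρ s X (F i) u := by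
  obtain ⟨W, hW⟩ : ∃ W, W = adInv ρ u X := ⟨_, rfl⟩
  have h : ∀ G : Smooth ρ, actS ρ s X G u = (s * lam m W) * G u - R ρ W G u := by
    intro G
    rw [hW]
    exact Op_apply ρ X (s • lam m) LinearMap.id G u
  have h2 : R ρ W (∑ i ∈ t, c i • F i) u = ∑ i ∈ t, c i * R ρ W (F i) u := by
    have h3 : R ρ W (∑ i ∈ t, c i • F i) = ∑ i ∈ t, c i • R ρ W (F i) := by
      rw [map_sum]
      exact Finset.sum_congr rfl fun i _ => Derivation.map_smul _ _ _
    rw [h3, Smooth.sum_apply]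
    rfl
  rw [h, h2, Smooth.sum_apply, Finset.mul_sum, ← Finset.sum_sub_distrib]
  refine Finset.sum_congr rfl fun i _ => ?_
  rw [h, Smooth.smul_apply]
  ring

lemma actS_omegaS (s : ℂ) (X : g m) (Y : g m ⊗[ℂ] g m) (f : Smooth ρ) (u : NBar ρ) :
    actS ρ s X (omegaS ρ Y f) u - omegaS ρ Y (actS ρ s X f) u
      = ∑ p, ∑ q, polarCoeff Y p q
        * commForm s (f u) (evalR ρ f u) (evalB ρ f u) (x1Dual p) (x1Dual q) (adInv ρ u X) := by
  have h1 : omegaS ρ Y f = ∑ p : (Fin m × Fin 3) × (Fin m × Fin 3),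
      polarCoeff Y p.1 p.2 • R ρ (x1Dual p.1) (R ρ (x1Dual p.2) f) := by
    rw [omegaS]
    exact (Fintype.sum_prod_type' fun p q =>
      polarCoeff Y p q • R ρ (x1Dual p) (R ρ (x1Dual q) f)).symm
  rw [h1, actS_sum_smul, omegaS_apply, ← Fintype.sum_prod_type', ← Fintype.sum_prod_type',
    ← Finset.sum_sub_distrib]
  refine Finset.sum_congr rfl fun p _ => ?_
  rw [← mul_sub]
  exact congrArg (polarCoeff Y p.1 p.2 * ·)
    (actS_RR_sub ρ s (x1Dual_mem p.1) (x1Dual_mem p.2) X f u)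

/-- The commutator of the action of `X ∈ 𝔤` with `Ω₂(Y^*)`. -/
theorem act_Omega2_sub (s : ℂ) (X : g m) {Y : g m ⊗[ℂ] g m} (hY : Y ∈ WngDual m) (f : Smooth ρ)
    (u : NBar ρ) : act ρ s X (Omega2 ρ Y f) u - Omega2 ρ Y (act ρ s X f) u
      = quadL (evalB ρ f u) ⁅grProj m 0 (adInv ρ u X), Y⁆
        + 2 * (1 - s) * (kap m)⁻¹ ^ 2 * ∑ p, ∑ q, polarCoeff Y p q
          * ((adInv ρ u X : Mat m) (idxP p.1) (midIdx p.2) * evalR ρ f u (yv q)) := by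
  have h1 : Omega2 ρ Y f = omegaS ρ Y f := funext fun v => Omega2_eq ρ Y f v
  have h2 : act ρ s X f = actS ρ s X f := funext fun v => (actS_apply ρ s X f v).symm
  rw [h1, h2, ← actS_apply, Omega2_eq, actS_omegaS]
  refine sum_commForm s (f u) hY (fun A hA B hB => R_lie_apply ρ hA hB f u) (fun A hA => ?_)
    (fun A hA => ?_) _
  · rw [evalR_apply, R_eq_zero ρ hA]
    rfl
  · refine LinearMap.ext fun B => ?_
    rw [evalB_apply, R_eq_zero ρ hA]
    rfl

/-! ## Linear independence -/

/-- Both factors vanish at u, so only the mixed products of first derivatives remain. -/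
lemma R_R_mul (Z Z' : g m) {F G : Smooth ρ} {u : NBar ρ} (hF : F u = 0) (hG : G u = 0) :
    R ρ Z (R ρ Z' (F * G)) u = R ρ Z F u * R ρ Z' G u + R ρ Z G u * R ρ Z' F u := by
  have h : R ρ Z (R ρ Z' (F * G)) = F * R ρ Z (R ρ Z' G) + R ρ Z' G * R ρ Z F
      + (G * R ρ Z (R ρ Z' F) + R ρ Z' F * R ρ Z G) := by
    rw [Derivation.leibniz, map_add, smul_eq_mul, smul_eq_mul, Derivation.leibniz,
      Derivation.leibniz]
    rfl
  rw [h]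
  have h2 : ∀ A B C D E K : Smooth ρ, (F * A + B * C + (G * D + E * K)) u
      = F u * A u + B u * C u + (G u * D u + E u * K u) := fun _ _ _ _ _ _ => rfl
  rw [h2, hF, hG]
  ring

/-- The matrix coefficient `v ↦ (u⁻¹v)_{a,b}`. -/
def entFun (u : NBar ρ) (a b : Idx m) : Smooth ρ :=
  matFun ρ (Matrix.entryLinearMap ℂ ℂ a b
    ∘ₗ LinearMap.mulLeft ℂ (((u : (Mat m)ˣ)⁻¹ : (Mat m)ˣ) : Mat m))

lemma entFun_apply_self (u : NBar ρ) {a b : Idx m} (hab : a ≠ b) : entFun ρ u a b u = 0 := by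
  change ((((u : (Mat m)ˣ)⁻¹ : (Mat m)ˣ) : Mat m) * ((u : (Mat m)ˣ) : Mat m)) a b = 0
  rw [Units.inv_mul, Matrix.one_apply_ne hab]

lemma R_entFun (u : NBar ρ) (a b : Idx m) {Z : g m} (hZ : Z ∈ nbar m) :
    R ρ Z (entFun ρ u a b) u = (Z : Mat m) a b := by
  rw [entFun, R_matFun ρ hZ]
  change ((((u : (Mat m)ˣ)⁻¹ : (Mat m)ˣ) : Mat m) * (((u : (Mat m)ˣ) : Mat m) * (Z : Mat m))) a b = _
  rw [← Matrix.mul_assoc, Units.inv_mul, Matrix.one_mul]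

lemma R_R_entFun (u : NBar ρ) (a b : Idx m) {Z Z' : g m} (hZ : Z ∈ nbar m) (hZ' : Z' ∈ nbar m) :
    R ρ Z (R ρ Z' (entFun ρ u a b)) u = ((Z : Mat m) * (Z' : Mat m)) a b := by
  rw [entFun, R_matFun ρ hZ', R_matFun ρ hZ]
  change ((((u : (Mat m)ˣ)⁻¹ : (Mat m)ˣ) : Mat m)
    * ((((u : (Mat m)ˣ) : Mat m) * (Z : Mat m)) * (Z' : Mat m))) a b = _
  rw [← Matrix.mul_assoc, ← Matrix.mul_assoc, Units.inv_mul, Matrix.one_mul]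

lemma x1Dual_apply (p : Fin m × Fin 3) (l : Fin m) (t : Fin 3) :
    (x1Dual p : Mat m) (midIdx t) (idxP l) = if p = (l, t) then (kap m)⁻¹ else 0 := by
  rw [x1Dual_eq]
  change (kap m)⁻¹ * (yv p : Mat m) (midIdx t) (idxP l) = _
  rw [yv_apply, mul_ite, mul_one, mul_zero]

/-- Products of two matrix coefficients that vanish at u have second derivatives dual to the
monomials in the basis of 𝔤(-1); each isolates one polarized coefficient, counted twice by symmetry.
-/
lemma eq_zero_of_quadL_evalB (u : NBar ρ) {Y : g m ⊗[ℂ] g m} (hY : Y ∈ WngDual m)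
    (h : ∀ f : Smooth ρ, quadL (evalB ρ f u) Y = 0) : Y = 0 := by
  refine eq_zero_of_polarCoeff hY fun p' q' => ?_
  have h1 := h (entFun ρ u (midIdx p'.2) (idxP p'.1) * entFun ρ u (midIdx q'.2) (idxP q'.1))
  have h2 : ∀ p q, evalB ρ (entFun ρ u (midIdx p'.2) (idxP p'.1)
      * entFun ρ u (midIdx q'.2) (idxP q'.1)) u (x1Dual p) (x1Dual q)
      = (if p = p' then (kap m)⁻¹ else 0) * (if q = q' then (kap m)⁻¹ else 0)
        + (if p = q' then (kap m)⁻¹ else 0) * (if q = p' then (kap m)⁻¹ else 0) := by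
    intro p q
    rw [evalB_apply, R_R_mul ρ _ _ (entFun_apply_self ρ u (midIdx_ne_idxP _ _))
      (entFun_apply_self ρ u (midIdx_ne_idxP _ _)), R_entFun ρ u _ _ (x1Dual_mem p),
      R_entFun ρ u _ _ (x1Dual_mem p), R_entFun ρ u _ _ (x1Dual_mem q),
      R_entFun ρ u _ _ (x1Dual_mem q)]
    simp only [x1Dual_apply]
  rw [quadL_apply] at h1
  simp only [h2, mul_add, Finset.sum_add_distrib, mul_ite, ite_mul, zero_mul, mul_zero,
    Finset.sum_ite_eq', Finset.mem_univ, if_true] at h1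
  rw [polarCoeff_comm Y q' p'] at h1
  have hk := kap_ne_zero (m := m)
  field_simp at h1
  linear_combination (1 / 2 : ℂ) * h1

/-! ## Invariance -/

variable {d : ℕ} (Y : Module.Basis (Fin d) ℂ (WngDual m))

lemma omega2_linearIndependent (u : NBar ρ) (c : Fin d → ℂ)
    (h : ∀ f, IsSmooth ρ f → ∑ i, c i * Omega2 ρ (Y i : g m ⊗[ℂ] g m) f u = 0) (i : Fin d) :
    c i = 0 := by
  have h1 : (∑ i, c i • Y i : WngDual m) = 0 := by
    refine Subtype.ext (eq_zero_of_quadL_evalB ρ u (∑ i, c i • Y i : WngDual m).2 fun f => ?_)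
    rw [Submodule.coe_sum, map_sum, ← h f f.isSmooth]
    refine Finset.sum_congr rfl fun i _ => ?_
    rw [Submodule.coe_smul, map_smul, Omega2_eq_quadL, smul_eq_mul]
  exact Fintype.linearIndependent_iff.1 Y.linearIndependent c h1 i

/-- The action of the `𝔤(0)`-component of `X` on an element of `W^*`. -/
def lieWngDual (y : WngDual m) : g m →ₗ[ℂ] WngDual m :=
  LinearMap.codRestrict (WngDual m)
    ((LieModule.toEnd ℂ (g m) (g m ⊗[ℂ] g m) : g m →ₗ[ℂ] Module.End ℂ (g m ⊗[ℂ] g m)).flip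
      (y : g m ⊗[ℂ] g m) ∘ₗ grProj m 0)
    fun X => lie_mem_WngDual (grProj_mem 0 X) y.2

variable {ρ} in
lemma map_eq_sum_coord (L : g m ⊗[ℂ] g m →ₗ[ℂ] ℂ) (y : WngDual m) :
    L y = ∑ j, Y.coord j y * L (Y j) := by
  conv_lhs => rw [← Y.sum_repr y, Submodule.coe_sum, map_sum]
  refine Finset.sum_congr rfl fun j _ => ?_
  rw [Submodule.coe_smul, map_smul, smul_eq_mul]
  rfl

/-- At s = 1 the first order term disappears and the commutator is Ω₂([W₀, Y_i]). Expanding [W₀,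
Y_i] in the basis of W^* gives coefficients that are linear in Ad(u⁻¹)X, hence smooth. -/
lemma isConformallyInvariant_one : IsConformallyInvariant ρ 1
    (fun i => Omega2 ρ (Y i : g m ⊗[ℂ] g m)) := by
  refine ⟨fun u c h => omega2_linearIndependent ρ Y u c h, fun X _ i =>
    ⟨fun j => adFun ρ X (Y.coord j ∘ₗ lieWngDual (Y i)), fun j => Smooth.isSmooth _,
      fun f hf u => ?_⟩⟩
  have h : ∀ F : Smooth ρ, act ρ 1 X (Omega2 ρ (Y i) F) u - Omega2 ρ (Y i) (act ρ 1 X F) u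
      = ∑ j, Y.coord j (lieWngDual (Y i) (adInv ρ u X)) * Omega2 ρ (Y j) F u := by
    intro F
    have e : ∀ A k S : ℂ, A + 2 * (1 - 1) * k * S = A := by
      intros
      ring
    refine ((act_Omega2_sub ρ 1 X (Y i).2 F u).trans (e _ _ _)).trans ?_
    refine (map_eq_sum_coord Y (quadL (evalB ρ F u)) (lieWngDual (Y i) (adInv ρ u X))).trans ?_
    exact Finset.sum_congr rfl fun j _ => congrArg _ (Omega2_eq_quadL ρ _ F u).symm
  exact h (Smooth.mk f hf)

lemma IsConformallyInvariant.exists_eq_sum {s : ℂ}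
    (h : IsConformallyInvariant ρ s (fun i => Omega2 ρ (Y i : g m ⊗[ℂ] g m))) {X : g m}
    (hX : ρ.conj X = X) (i : Fin d) (f : Smooth ρ) (u : NBar ρ) : ∃ C : Fin d → ℂ,
      quadL (evalB ρ f u) ⁅grProj m 0 (adInv ρ u X), (Y i : g m ⊗[ℂ] g m)⁆
        + 2 * (1 - s) * (kap m)⁻¹ ^ 2 * ∑ p, ∑ q, polarCoeff (Y i : g m ⊗[ℂ] g m) p q
          * ((adInv ρ u X : Mat m) (idxP p.1) (midIdx p.2) * evalR ρ f u (yv q))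
      = ∑ j, C j * quadL (evalB ρ f u) (Y j) := by
  obtain ⟨C, -, hC⟩ := h.2 X hX i
  refine ⟨fun j => C j u, ?_⟩
  refine (act_Omega2_sub ρ s X (Y i).2 f u).symm.trans ((hC f f.isSmooth u).trans ?_)
  exact Finset.sum_congr rfl fun j _ => congrArg _ (Omega2_eq_quadL ρ _ f u)

lemma mul_apply_of_gr_neg_one {Z Z' : g m} (hZ : Z ∈ gr m (-1)) (hZ' : Z' ∈ gr m (-1))
    (t : Fin 3) (l : Fin m) : ((Z : Mat m) * (Z' : Mat m)) (midIdx t) (idxP l) = 0 := by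
  rw [Matrix.mul_apply]
  refine Finset.sum_eq_zero fun c _ => ?_
  by_contra h0
  have h1 := (mem_gr_iff _ Z).1 hZ _ _ (left_ne_zero_of_mul h0)
  have h2 := (mem_gr_iff _ Z').1 hZ' _ _ (right_ne_zero_of_mul h0)
  rw [deg_midIdx] at h1
  rw [deg_idxP] at h2
  omega

/-- A linear form that vanishes on `𝔤₀` vanishes on `𝔤`. -/
lemma eq_zero_of_real {φ : g m →ₗ[ℂ] ℂ} (h : ∀ X, ρ.conj X = X → φ X = 0) : φ = 0 := by
  refine LinearMap.ext fun X => ?_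
  have h2 : starRingEnd ℂ 2 = 2 := map_ofNat _ 2
  have h3 := h (X + ρ.conj X) (by
    rw [map_add, ρ.conj_conj]
    exact add_comm _ _)
  have h4 := h (Complex.I • (X - ρ.conj X)) (by
    rw [LinearMap.map_smulₛₗ, map_sub, ρ.conj_conj, Complex.conj_I, neg_smul, ← smul_neg, neg_sub])
  rw [map_add] at h3
  rw [map_smul, map_sub, smul_eq_mul] at h4
  have h5 := (mul_eq_zero.1 h4).resolve_left Complex.I_ne_zero
  rw [LinearMap.zero_apply]
  linear_combination (1 / 2 : ℂ) * h3 + (1 / 2 : ℂ) * h5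

/-- The test function reads an entry of degree -1, while two derivatives along 𝔤(-1) produce a
product of degree -2. -/
lemma quadL_evalB_entFun (u : NBar ρ) (t : Fin 3) (l : Fin m) (T : g m ⊗[ℂ] g m) :
    quadL (evalB ρ (entFun ρ u (midIdx t) (idxP l)) u) T = 0 := by
  rw [quadL_apply]
  refine Finset.sum_eq_zero fun p _ => Finset.sum_eq_zero fun q _ => ?_
  rw [evalB_apply, R_R_entFun ρ u _ _ (x1Dual_mem p) (x1Dual_mem q),
    mul_apply_of_gr_neg_one (x1Dual_mem_gr p) (x1Dual_mem_gr q), mul_zero]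

lemma evalR_entFun_yv (u : NBar ρ) (t : Fin 3) (l : Fin m) (q : Fin m × Fin 3) :
    evalR ρ (entFun ρ u (midIdx t) (idxP l)) u (yv q) = if q = (l, t) then 1 else 0 := by
  rw [evalR_apply, R_entFun ρ u _ _ (gr_neg_one_le (yv_mem q)), yv_apply]

/-- The linear form `X ↦ ∑ polarCoeff T p q · X_p`. -/
def contract (q : Fin m × Fin 3) (X : g m) : g m ⊗[ℂ] g m →ₗ[ℂ] ℂ :=
  ∑ p : Fin m × Fin 3, (X : Mat m) (idxP p.1) (midIdx p.2) • polarLin p q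

lemma contract_apply (q : Fin m × Fin 3) (X : g m) (T : g m ⊗[ℂ] g m) :
    contract q X T = ∑ p, polarCoeff T p q * (X : Mat m) (idxP p.1) (midIdx p.2) := by
  rw [contract, LinearMap.sum_apply]
  exact Finset.sum_congr rfl fun p _ => mul_comm _ _

/-- At the identity the adjoint action is trivial. A test function without second derivatives along
𝔤(-1) annihilates the whole system there, so the first order term must vanish by itself. -/
lemma contract_eq_zero {s : ℂ} (hs : s ≠ 1)
    (h : IsConformallyInvariant ρ s (fun i => Omega2 ρ (Y i : g m ⊗[ℂ] g m))) (q : Fin m × Fin 3)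
    {X : g m} (hX : ρ.conj X = X) (i : Fin d) : contract q X (Y i : g m ⊗[ℂ] g m) = 0 := by
  have hs' : 2 * (1 - s) * (kap m)⁻¹ ^ 2 ≠ 0 :=
    mul_ne_zero (mul_ne_zero two_ne_zero fun h => hs (by linear_combination -h))
      (pow_ne_zero _ (inv_ne_zero kap_ne_zero))
  obtain ⟨C, hC⟩ := IsConformallyInvariant.exists_eq_sum ρ Y h hX i
    (entFun ρ 1 (midIdx q.2) (idxP q.1)) 1
  simp only [quadL_evalB_entFun, mul_zero, Finset.sum_const_zero, zero_add, evalR_entFun_yv,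
    mul_ite, mul_one, Finset.sum_ite_eq', Finset.mem_univ, if_true] at hC
  rw [adInv_one] at hC
  rw [contract_apply]
  exact (mul_eq_zero.1 hC).resolve_left hs'

/-- One pair of a tensor in W^* and a vector in 𝔤(1) on which the contraction is non-zero suffices.
-/
lemma eq_one_of_isConformallyInvariant (hm : 3 ≤ m) {s : ℂ}
    (h : IsConformallyInvariant ρ s (fun i => Omega2 ρ (Y i : g m ⊗[ℂ] g m))) : s = 1 := by
  by_contra hs
  let k0 : Fin m := ⟨0, by omega⟩
  let k1 : Fin m := ⟨1, by omega⟩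
  have hk : k0 ≠ k1 := by simp [k0, k1]
  have h1 : ∀ T ∈ WngDual m, ∀ X, ρ.conj X = X → contract (k1, 1) X T = 0 := by
    intro T hT X hX
    refine (map_eq_sum_coord Y (contract (k1, 1) X) ⟨T, hT⟩).trans ?_
    refine Finset.sum_eq_zero fun i _ => ?_
    rw [contract_eq_zero ρ Y hs h _ hX, mul_zero]
  have hA : (rootVec (midIdx 1) (midIdx 0) : g m) ∈ lng m := Submodule.subset_span (Or.inl rfl)
  have hz : (rootVec (idxM k0) (idxP k1) : g m) ∈ gr m (-2) := by
    have := rootVec_mem_gr (idxM k0) (idxP k1)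
    rwa [deg_idxM, deg_idxP] at this
  -- The witness is X_{α_n} ⊗ X_{-γ}, tested against the root vector of ε_1. The coefficient of T at
  -- the indices (k0, 0) and (k1, 1) is the non-zero number that remains at the end.
  set T : g m ⊗[ℂ] g m := rootVec (midIdx 1) (midIdx 0) ⊗ₜ[ℂ] rootVec (idxM k0) (idxP k1) with hT
  have hTm : T ∈ WngDual m := Submodule.apply_mem_map₂ _ hA hz
  have h2 : (∑ p : Fin m × Fin 3, polarCoeff T p (k1, 1) •
      (Matrix.entryLinearMap ℂ ℂ (idxP p.1) (midIdx p.2) ∘ₗ coeMat m)) = 0 := by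
    -- Invariance is known only for X in the real form, and the root vector need not lie there; the
    -- complex linear form extends the vanishing to 𝔤.
    refine eq_zero_of_real ρ fun X hX => ?_
    have h3 := h1 T hTm X hX
    rw [contract_apply] at h3
    rw [LinearMap.sum_apply]
    exact h3
  have h6 : ∑ p : Fin m × Fin 3, polarCoeff T p (k1, 1)
      * (x1 (k0, 0) : Mat m) (idxP p.1) (midIdx p.2) = 0 := by
    have h3 := LinearMap.congr_fun h2 (x1 (k0, 0))
    rw [LinearMap.sum_apply] at h3
    exact h3
  have e0 : ∀ p : Fin m × Fin 3, (x1 (k0, 0) : Mat m) (idxP p.1) (midIdx p.2)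
      = if p = (k0, 0) then 1 else 0 := fun p => by
    rw [x1_apply]
    exact if_congr eq_comm rfl rfl
  simp only [e0, mul_ite, mul_one, mul_zero, Finset.sum_ite_eq', Finset.mem_univ, if_true] at h6
  have e1 : ((rootVec (midIdx 1) (midIdx 0) : g m) : Mat m) (midIdx 1) (midIdx (midDual 0)) = 1 := by
    rw [rootVec_apply]
    simp [midDual, midIdx, dualIdx]
  have e2 : (rootVec (idxM k0) (idxP k1) : Mat m) (idxM k0) (idxP k1) = 1 := by
    rw [rootVec_apply]
    simp [dualIdx_idxP, dualIdx_idxM, idxM_inj, idxP_inj, hk]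
  rw [hT, polarCoeff_tmul_eq hA hz] at h6
  dsimp only at h6
  rw [e1, e2, mul_one, mul_one] at h6
  exact div_ne_zero (div_ne_zero (kap_ne_zero (m := m)) two_ne_zero) (jCoeff_ne_zero _) h6

/-- The system is conformally invariant exactly for `s = 1`. -/
theorem isConformallyInvariant_iff (hm : 3 ≤ m) (s : ℂ) :
    IsConformallyInvariant ρ s (fun i => Omega2 ρ (Y i : g m ⊗[ℂ] g m)) ↔ s = 1 :=
  ⟨eq_one_of_isConformallyInvariant ρ Y hm, fun h => h ▸ isConformallyInvariant_one ρ Y⟩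

end Omega

/-! ## Weights and roots -/

/-- The weight of the basis vector with index `a`. -/
def wt : Idx m → Weight m
  | Sum.inl _ => 0
  | Sum.inr (Sum.inl j) => eps j
  | Sum.inr (Sum.inr j) => -eps j

lemma evalWeight_sub (α β : Weight m) (h : Fin (m + 1) → ℂ) :
    evalWeight (α - β) h = evalWeight α h - evalWeight β h := by
  simp [evalWeight, sub_mul, Finset.sum_sub_distrib]

lemma evalWeight_wt (a : Idx m) (h : Fin (m + 1) → ℂ) : evalWeight (wt a) h = diagEntry h a := by
  rcases a with _ | j | j <;> simp [evalWeight, wt, diagEntry, eps, Pi.single_apply]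

lemma evalWeight_injective {α β : Weight m} (h : ∀ x, evalWeight α x = evalWeight β x) : α = β := by
  funext j
  simpa [evalWeight, Pi.single_apply] using h (Pi.single j 1)

lemma lie_cartan_apply (h : Fin (m + 1) → ℂ) (X : g m) (a b : Idx m) :
    ((⁅cartan h, X⁆ : g m) : Mat m) a b = evalWeight (wt a - wt b) h * (X : Mat m) a b := by
  rw [evalWeight_sub, evalWeight_wt, evalWeight_wt, coe_lie, Matrix.sub_apply, cartan,
    Matrix.diagonal_mul, Matrix.mul_diagonal]
  ring

lemma mem_rootSpace_iff (α : Weight m) (X : g m) :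
    X ∈ rootSpace α ↔ ∀ a b, (X : Mat m) a b ≠ 0 → wt a - wt b = α := by
  have h1 : X ∈ rootSpace α ↔ ∀ h, ⁅cartan h, X⁆ = evalWeight α h • X := by
    rw [rootSpace, Submodule.mem_iInf]
    exact forall_congr' fun h => Module.End.mem_eigenspace_iff
  rw [h1]
  constructor
  · intro hX a b hab
    refine evalWeight_injective fun h => ?_
    have h2 := congrArg (fun Z : g m => (Z : Mat m) a b) (hX h)
    rw [lie_cartan_apply] at h2
    exact mul_right_cancel₀ hab h2
  · intro hX h
    ext a b
    change ((⁅cartan h, X⁆ : g m) : Mat m) a b = evalWeight α h * (X : Mat m) a b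
    rw [lie_cartan_apply]
    by_cases hab : (X : Mat m) a b = 0
    · rw [hab, mul_zero, mul_zero]
    · rw [hX a b hab]

lemma wt_dualIdx (a : Idx m) : wt (dualIdx a) = -wt a := by
  rcases a with _ | j | j <;> simp [wt, dualIdx]

lemma rootVec_mem_rootSpace (a b : Idx m) : rootVec a b ∈ rootSpace (wt a - wt b) := by
  rw [mem_rootSpace_iff]
  intro c d hcd
  rw [rootVec_apply] at hcd
  by_cases h1 : a = c ∧ b = d
  · rw [h1.1, h1.2]
  · by_cases h2 : dualIdx b = c ∧ dualIdx a = d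
    · rw [← h2.1, ← h2.2, wt_dualIdx, wt_dualIdx]
      abel
    · simp [h1, h2] at hcd

lemma rootVec_apply_self {a b : Idx m} (h : b ≠ dualIdx a) : (rootVec a b : Mat m) a b = 1 := by
  rw [rootVec_apply]
  simp [h.symm]

lemma rootVec_ne_zero {a b : Idx m} (h : b ≠ dualIdx a) : rootVec a b ≠ 0 := by
  intro h0
  have h1 := rootVec_apply_self h
  rw [h0] at h1
  exact zero_ne_one h1

lemma apply_dualIdx_right (X : g m) (a : Idx m) : (X : Mat m) a (dualIdx a) = 0 := by
  have h := coe_apply_dualIdx X a (dualIdx a)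
  rw [dualIdx_dualIdx, jCoeff_dualIdx, div_self (jCoeff_ne_zero a)] at h
  linear_combination (1 / 2 : ℂ) * h

/-- Any non-zero entry (a, b) of a weight vector determines its weight. Entries at dual pairs vanish
by skewness, so those pairs carry no root vector. -/
lemma mem_roots_iff (α : Weight m) :
    α ∈ roots m ↔ α ≠ 0 ∧ ∃ a b, b ≠ dualIdx a ∧ α = wt a - wt b := by
  refine and_congr_right fun _ => ?_
  rw [Submodule.ne_bot_iff]
  constructor
  · rintro ⟨X, hX, h0⟩
    have h1 : ∃ a b, (X : Mat m) a b ≠ 0 := by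
      by_contra! h
      exact h0 (eq_zero_of_entries fun a b => Or.inl (h a b))
    obtain ⟨a, b, hab⟩ := h1
    refine ⟨a, b, ?_, ((mem_rootSpace_iff α X).1 hX a b hab).symm⟩
    rintro rfl
    exact hab (apply_dualIdx_right X a)
  · rintro ⟨a, b, hab, rfl⟩
    exact ⟨_, rootVec_mem_rootSpace a b, rootVec_ne_zero hab⟩

/-- The value of a weight on `H_𝔮`. -/
def wtDeg (α : Weight m) : ℂ := ∑ j : Fin m, α j.castSucc

lemma wtDeg_sub (α β : Weight m) : wtDeg (α - β) = wtDeg α - wtDeg β := by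
  simp [wtDeg, Finset.sum_sub_distrib]

lemma wtDeg_add (α β : Weight m) : wtDeg (α + β) = wtDeg α + wtDeg β := by
  simp [wtDeg, Finset.sum_add_distrib]

lemma wtDeg_eps_castSucc (j : Fin m) : wtDeg (eps j.castSucc) = 1 := by
  simp [wtDeg, eps, Pi.single_apply]

lemma wtDeg_eps_last : wtDeg (eps (Fin.last m)) = 0 := by
  simp [wtDeg, eps, Fin.castSucc_ne_last]

lemma wtDeg_wt (a : Idx m) : wtDeg (wt a) = deg a := by
  rcases a with _ | j | j
  · simp [wt, wtDeg, deg]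
  all_goals
    induction j using Fin.lastCases with
    | last => simp [wt, deg, wtDeg, eps, Fin.castSucc_ne_last]
    | cast l => simp [wt, deg, wtDeg, eps, Pi.single_apply, Fin.castSucc_ne_last]

lemma rootSpace_le_gr {α : Weight m} {k : ℤ} (h : wtDeg α = k) : rootSpace α ≤ gr m k := by
  intro X hX
  rw [mem_gr_iff]
  intro a b hab
  rw [mem_rootSpace_iff] at hX
  rw [← hX a b hab, wtDeg_sub, wtDeg_wt, wtDeg_wt] at h
  exact_mod_cast h

lemma wt_idxP (l : Fin m) : wt (idxP l) = eps l.castSucc := rfl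

lemma wt_idxM (l : Fin m) : wt (idxM l) = -eps l.castSucc := rfl

lemma eps_add_eps_mem_roots {j k : Fin (m + 1)} (h : j ≠ k) : (eps j + eps k : Weight m) ∈ roots m := by
  rw [mem_roots_iff]
  refine ⟨fun h0 => ?_, Sum.inr (Sum.inl j), Sum.inr (Sum.inr k), ?_, ?_⟩
  · have := congrFun h0 j
    simp [eps, h] at this
  · simp [dualIdx, h.symm]
  · simp [wt]

lemma eps_mem_roots (j : Fin (m + 1)) : (eps j : Weight m) ∈ roots m := by
  rw [mem_roots_iff]
  refine ⟨fun h0 => ?_, Sum.inr (Sum.inl j), Sum.inl (), ?_, ?_⟩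
  · have := congrFun h0 j
    simp [eps] at this
  · simp [dualIdx]
  · simp [wt]

/-- The roots of degree `1`. -/
lemma exists_eq_of_mem_roots {α : Weight m} (hα : α ∈ roots m) (h : wtDeg α = 1) :
    ∃ (l : Fin m) (τ : ℤ), (τ = 0 ∨ τ = 1 ∨ τ = -1) ∧
      α = eps l.castSucc + (τ : ℂ) • eps (Fin.last m) := by
  obtain ⟨-, a, b, -, rfl⟩ := (mem_roots_iff α).1 hα
  rw [wtDeg_sub, wtDeg_wt, wtDeg_wt] at h
  have h1 : deg a - deg b = 1 := by exact_mod_cast h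
  have hmid : ∀ t : Fin 3, ∃ τ : ℤ, (τ = 0 ∨ τ = 1 ∨ τ = -1) ∧
      wt (midIdx t : Idx m) = (τ : ℂ) • eps (Fin.last m) := by
    intro t
    fin_cases t
    · exact ⟨0, by simp, by simp [midIdx, wt]⟩
    · exact ⟨1, by simp, by simp [midIdx, wt]⟩
    · exact ⟨-1, by simp, by simp [midIdx, wt]⟩
  rcases deg_cases a with ha | ha | ha <;> rcases deg_cases b with hb | hb | hb <;>
    simp only [ha, hb] at h1 <;> try omega
  · obtain ⟨t, rfl⟩ := exists_midIdx ha
    obtain ⟨l, rfl⟩ := exists_idxM hb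
    obtain ⟨τ, hτ, h⟩ := hmid t
    exact ⟨l, τ, hτ, by rw [h, wt_idxM, sub_neg_eq_add, add_comm]⟩
  · obtain ⟨t, rfl⟩ := exists_midIdx hb
    obtain ⟨l, rfl⟩ := exists_idxP ha
    obtain ⟨τ, hτ, h⟩ := hmid t
    refine ⟨l, -τ, by omega, ?_⟩
    rw [h, wt_idxP]
    push_cast
    rw [neg_smul, sub_eq_add_neg]

lemma wtDeg_of_mem_rootsIn {α : Weight m} {k : ℤ} (h : α ∈ rootsIn (gr m k)) : wtDeg α = k := by
  obtain ⟨hα, hle⟩ := h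
  obtain ⟨-, a, b, hab, rfl⟩ := (mem_roots_iff α).1 hα
  have h1 := (mem_gr_iff k _).1 (hle (rootVec_mem_rootSpace a b)) a b
    (by rw [rootVec_apply_self hab]; exact one_ne_zero)
  rw [wtDeg_sub, wtDeg_wt, wtDeg_wt, ← h1]
  push_cast
  rfl

/-- The height of the weight of a basis vector: the positive root spaces are strictly upper triangular
with respect to it. -/
def ht : Idx m → ℤ
  | Sum.inl _ => 0
  | Sum.inr (Sum.inl j) => m + 1 - j
  | Sum.inr (Sum.inr j) => -(m + 1 - j)

lemma ht_lt_of_posRoots {α : Weight m} (hα : α ∈ posRoots m) {X : g m} (hX : X ∈ rootSpace α)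
    {a b : Idx m} (hab : (X : Mat m) a b ≠ 0) : ht b < ht a := by
  -- The functional is evaluated at the Cartan element with coordinates n, n - 1, …, 1. Since j
  -- counts from zero, the last coordinate is m + 1 - m = 1, so ε_n is positive as well.
  have h1 : ∀ c : Idx m, evalWeight (wt c) (fun j => ((m + 1 - j : ℤ) : ℂ)) = ht c := by
    intro c
    rw [evalWeight_wt]
    rcases c with _ | j | j <;> simp [diagEntry, ht]
  have h2 : ∃ k : ℤ, 0 < k ∧ evalWeight α (fun j => ((m + 1 - j : ℤ) : ℂ)) = k := by
    have hadd : ∀ β γ : Weight m, ∀ x, evalWeight (β + γ) x = evalWeight β x + evalWeight γ x := by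
      intro β γ x
      simp [evalWeight, add_mul, Finset.sum_add_distrib]
    have he : ∀ j : Fin (m + 1), evalWeight (eps j) (fun j => ((m + 1 - j : ℤ) : ℂ))
        = ((m + 1 - j : ℤ) : ℂ) := fun j => by simp [evalWeight, eps, Pi.single_apply]
    rcases hα with ⟨j, k, hjk, rfl | rfl⟩ | ⟨j, rfl⟩
    · refine ⟨k - j, by have : (j : ℕ) < k := hjk; omega, ?_⟩
      rw [evalWeight_sub, he, he]
      push_cast
      ring
    · refine ⟨(m + 1 - j) + (m + 1 - k), by omega, ?_⟩
      rw [hadd, he, he]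
      push_cast
      ring
    · exact ⟨m + 1 - j, by omega, he j⟩
  obtain ⟨k, hk, h2⟩ := h2
  rw [← (mem_rootSpace_iff α X).1 hX a b hab, evalWeight_sub, h1, h1] at h2
  have h3 : ht a - ht b = k := by exact_mod_cast h2
  omega

/-! ## The `𝔩`-module `W` -/

lemma lng_le_gr_zero : lng m ≤ gr m 0 := by
  intro A hA
  rw [mem_gr_iff]
  intro a b hab
  obtain ⟨h1, h2⟩ := (mem_lng_iff A).1 hA a b hab
  omega

lemma Wng_le : Wng m ≤ tens (gr m 0) (gr m 2) :=
  Submodule.map₂_le_map₂_left lng_le_gr_zero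

lemma midIdx_one : (midIdx 1 : Idx m) = idxN m := rfl

/-- The matrices in 𝔤(2) map degree -1 to degree 1 and never meet the middle block. So 𝔩_{nγ} acts
on the first factor of W only. -/
lemma lie_lng_gr_two {A z : g m} (hA : A ∈ lng m) (hz : z ∈ gr m 2) : ⁅A, z⁆ = 0 := by
  rw [mem_lng_iff] at hA
  rw [mem_gr_iff] at hz
  refine eq_zero_of_entries fun a b => Or.inl ?_
  rw [coe_lie, Matrix.sub_apply, Matrix.mul_apply, Matrix.mul_apply]
  have h1 : ∀ c, (A : Mat m) a c * (z : Mat m) c b = 0 := by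
    intro c
    by_contra h0
    have h1 := hA a c (left_ne_zero_of_mul h0)
    have h2 := hz c b (right_ne_zero_of_mul h0)
    rcases deg_cases b with h | h | h <;> omega
  have h2 : ∀ c, (z : Mat m) a c * (A : Mat m) c b = 0 := by
    intro c
    by_contra h0
    have h1 := hz a c (left_ne_zero_of_mul h0)
    have h2 := hA c b (right_ne_zero_of_mul h0)
    rcases deg_cases a with h | h | h <;> omega
  rw [Finset.sum_eq_zero fun c _ => h1 c, Finset.sum_eq_zero fun c _ => h2 c, sub_zero]

/-- Elements of the middle block have no entries in the rows or columns of degree 1, so the 𝔤𝔩-block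
acts on the second factor of W only. -/
lemma lie_rootVec_idxP_lng {A : g m} (hA : A ∈ lng m) (k l : Fin m) :
    ⁅rootVec (idxP k) (idxP l), A⁆ = 0 := by
  rw [mem_lng_iff] at hA
  have h0 : ∀ i l, (A : Mat m) i (idxP l) = 0 := fun i l => by
    by_contra h
    have := (hA _ _ h).2
    rw [deg_idxP] at this
    omega
  have h1 : ∀ i l, (A : Mat m) (idxP l) i = 0 := fun i l => by
    by_contra h
    have := (hA _ _ h).1
    rw [deg_idxP] at this
    omega
  rw [← lie_skew, lie_rootVec]
  simp only [h0, h1, zero_smul, Finset.sum_const_zero, sub_zero, neg_zero]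

lemma rootVec_idxP_idxP_mem (k l : Fin m) : (rootVec (idxP k) (idxP l) : g m) ∈ gr m 0 := by
  have := rootVec_mem_gr (idxP k) (idxP l)
  rwa [deg_idxP, deg_idxP] at this

lemma rootVec_idxP_idxM_mem (k l : Fin m) : (rootVec (idxP k) (idxM l) : g m) ∈ gr m 2 := by
  have := rootVec_mem_gr (idxP k) (idxM l)
  rwa [deg_idxP, deg_idxM] at this

lemma lie_rootVec_idxP (a b j k : Fin m) : ⁅(rootVec (idxP a) (idxP b) : g m), rootVec (idxP j) (idxM k)⁆
    = (if b = j then rootVec (idxP a) (idxM k) else 0)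
      + (if b = k then rootVec (idxP j) (idxM a) else 0) := by
  have h1 : ∀ i, (rootVec (idxP a) (idxP b) : Mat m) i (idxP j)
      = if i = idxP a then (if b = j then 1 else 0) else 0 := by
    intro i
    rw [rootVec_apply]
    simp [dualIdx_idxP, idxM_ne_idxP, idxP_inj, eq_comm (a := i), ite_and]
  have h2 : ∀ i, (rootVec (idxP a) (idxP b) : Mat m) (idxM k) i
      = if i = idxM a then (if b = k then -1 else 0) else 0 := by
    intro i
    rw [rootVec_apply]
    by_cases hbk : b = k <;> by_cases hi : i = idxM a <;>
      simp [dualIdx_idxP, idxP_ne_idxM, idxM_inj, eq_comm (b := i), jCoeff_idxP, hbk, hi]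
  rw [lie_rootVec]
  simp only [h1, h2, ite_smul, zero_smul, Finset.sum_ite_eq', Finset.mem_univ, if_true, one_smul,
    neg_smul]
  split_ifs <;> simp

lemma eq_zero_of_gr_two {X : g m} (hX : X ∈ gr m 2)
    (h : ∀ k l, (X : Mat m) (idxP k) (idxM l) = 0) : X = 0 := by
  refine eq_zero_of_entries fun a b => ?_
  by_cases hab : deg a - deg b = 2
  · rcases deg_cases a with ha | ha | ha <;> rcases deg_cases b with hb | hb | hb <;>
      simp only [ha, hb] at hab <;> try omega
    obtain ⟨l, rfl⟩ := exists_idxM hb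
    obtain ⟨t, rfl⟩ := exists_idxP ha
    exact Or.inl (h t l)
  · exact Or.inl (gr_apply_eq_zero hX hab)

lemma lie_rootVec_idxP_self_apply (j a b : Fin m) (z : g m) :
    ((⁅rootVec (idxP j) (idxP j), z⁆ : g m) : Mat m) (idxP a) (idxM b)
      = (if j = a then (z : Mat m) (idxP j) (idxM b) else 0)
        + (if j = b then (z : Mat m) (idxP a) (idxM j) else 0) := by
  rw [← lie_skew]
  change -((⁅z, rootVec (idxP j) (idxP j)⁆ : g m) : Mat m) (idxP a) (idxM b) = _
  rw [lie_rootVec_apply]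
  simp only [idxP_ne_idxM, idxM_ne_idxP, dualIdx_idxP, idxP_inj, idxM_inj, jCoeff_idxP, if_false]
  split_ifs <;> simp

/-- Each diagonal element keeps the weights of 𝔤(2) that involve its index. Two distinct ones
together project onto the weight ε_j + ε_k. -/
lemma lie_lie_rootVec_idxP_self {z : g m} (hz : z ∈ gr m 2) {j k : Fin m} (hjk : j ≠ k) :
    ⁅rootVec (idxP k) (idxP k), ⁅rootVec (idxP j) (idxP j), z⁆⁆
      = (z : Mat m) (idxP j) (idxM k) • rootVec (idxP j) (idxM k) := by
  have hD := rootVec_idxP_idxP_mem (m := m)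
  rw [← sub_eq_zero]
  refine eq_zero_of_gr_two (Submodule.sub_mem _ (lie_mem_gr_of_eq (zero_add 2) (hD k k)
    (lie_mem_gr_of_eq (zero_add 2) (hD j j) hz))
    (Submodule.smul_mem _ _ (rootVec_idxP_idxM_mem j k))) fun a b => ?_
  change ((⁅rootVec (idxP k) (idxP k), ⁅rootVec (idxP j) (idxP j), z⁆⁆ : g m) : Mat m) (idxP a) (idxM b)
    - (z : Mat m) (idxP j) (idxM k) * (rootVec (idxP j) (idxM k) : Mat m) (idxP a) (idxM b) = 0
  have hs : (z : Mat m) (idxP k) (idxM j) = -(z : Mat m) (idxP j) (idxM k) := by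
    have h := coe_apply_dualIdx z (idxP j) (idxM k)
    rwa [jCoeff_idxM, jCoeff_idxP, div_one, one_mul] at h
  rw [lie_rootVec_idxP_self_apply, lie_rootVec_idxP_self_apply, lie_rootVec_idxP_self_apply,
    rootVec_apply]
  simp only [dualIdx_idxP, dualIdx_idxM, idxP_inj, idxM_inj, jCoeff_idxP, jCoeff_idxM, div_one]
  by_cases h1 : j = a
  · subst h1
    have h2 : k ≠ j := hjk.symm
    by_cases h3 : k = b
    · subst h3
      simp [hjk, h2]
    · simp [h2, h3]
  · by_cases h2 : j = b
    · subst h2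
      by_cases h3 : k = a
      · subst h3
        simp [hjk, hs]
      · simp [h1, h3, hjk.symm]
    · by_cases h3 : k = a <;> by_cases h4 : k = b <;> simp_all

lemma exists_eq_of_mem_lng {A : g m} (hA : A ∈ lng m) : ∃ x y w : ℂ,
    x • rootVec (idxN m) (idx0 m) + y • rootVec (idxN m) (idxN m)
      + w • rootVec (idx0 m) (idxN m) = A := by
  rw [← lie_rootVec_idxN_idx0]
  exact Submodule.mem_span_triple.1 hA

lemma lie_rootVec_idxN_self (c d : Idx m) : ⁅(rootVec (idxN m) (idxN m) : g m), rootVec c d⁆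
    = ((if c = idxN m then 1 else 0) - (if c = dualIdx (idxN m) then (1 : ℂ) else 0)) • rootVec c d
      - ((if d = idxN m then 1 else 0) - (if d = dualIdx (idxN m) then (1 : ℂ) else 0))
        • rootVec c d := by
  have h : ∀ i j, (rootVec (idxN m) (idxN m) : Mat m) i j
      = if i = j then (if j = idxN m then 1 else 0) - (if j = dualIdx (idxN m) then 1 else 0)
        else 0 := by
    intro i j
    rw [rootVec_apply, div_self (jCoeff_ne_zero _)]
    by_cases hij : i = j
    · subst hij
      simp [eq_comm]
    · have h1 : ¬ (idxN m = i ∧ idxN m = j) := fun h => hij (h.1.symm.trans h.2)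
      have h2 : ¬ (dualIdx (idxN m) = i ∧ dualIdx (idxN m) = j) :=
        fun h => hij (h.1.symm.trans h.2)
      rw [if_neg h1, if_neg h2, if_neg hij, sub_zero]
  rw [lie_rootVec]
  simp only [h, ite_smul, zero_smul, Finset.sum_ite_eq, Finset.sum_ite_eq', Finset.mem_univ, if_true]

lemma idx0_ne_idxN : idx0 m ≠ idxN m := by simp [idx0, idxN]

lemma idx0_ne_dualIdx_idxN : idx0 m ≠ dualIdx (idxN m) := by simp [idx0, idxN, dualIdx]

lemma idxN_ne_dualIdx_idxN : idxN m ≠ dualIdx (idxN m) := by simp [idxN, dualIdx]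

lemma lie_idxN_idx0_idxN_self : ⁅(rootVec (idxN m) (idx0 m) : g m), rootVec (idxN m) (idxN m)⁆
    = -rootVec (idxN m) (idx0 m) := by
  rw [← lie_skew, lie_rootVec_idxN_self]
  simp [idx0_ne_idxN, idx0_ne_dualIdx_idxN, idxN_ne_dualIdx_idxN]

lemma lie_idx0_idxN_idxN_self : ⁅(rootVec (idx0 m) (idxN m) : g m), rootVec (idxN m) (idxN m)⁆
    = rootVec (idx0 m) (idxN m) := by
  rw [← lie_skew, lie_rootVec_idxN_self]
  simp [idx0_ne_idxN, idx0_ne_dualIdx_idxN, idxN_ne_dualIdx_idxN]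

/-! ### Tensor products on which a raising operator acts in one factor -/

section TensorProduct

variable {L : Type*} [LieRing L] [LieAlgebra ℂ L]

lemma add_smul_tmul (x y w : ℂ) (e h f v : L) : (x • e + y • h + w • f) ⊗ₜ[ℂ] v
    = e ⊗ₜ[ℂ] (x • v) + h ⊗ₜ[ℂ] (y • v) + f ⊗ₜ[ℂ] (w • v) := by
  rw [TensorProduct.add_tmul, TensorProduct.add_tmul, TensorProduct.smul_tmul,
    TensorProduct.smul_tmul, TensorProduct.smul_tmul]

lemma lie_tmul_of_eq_smul {X A B : L} {a b : ℂ} (hA : ⁅X, A⁆ = a • A) (hB : ⁅X, B⁆ = b • B) :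
    ⁅X, A ⊗ₜ[ℂ] B⁆ = (a + b) • A ⊗ₜ[ℂ] B := by
  rw [TensorProduct.LieModule.lie_tmul_right, hA, hB, TensorProduct.tmul_smul,
    ← TensorProduct.smul_tmul', ← add_smul]

lemma lie_tmul_eq_zero {X A B : L} (hA : ⁅X, A⁆ = 0) (hB : ⁅X, B⁆ = 0) :
    ⁅X, A ⊗ₜ[ℂ] B⁆ = 0 := by
  rw [TensorProduct.LieModule.lie_tmul_right, hA, hB, TensorProduct.zero_tmul,
    TensorProduct.tmul_zero, add_zero]

/-- Since e kills Z, it acts as the nilpotent raising operator f → h → -e on the first factor; it is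
applied until only a multiple of e survives. -/
lemma tmul_mem_of_lie_stable {U : Submodule ℂ (L ⊗[ℂ] L)} {Z : Submodule ℂ L} {e h f : L}
    (hU : ∀ v ∈ U, ⁅e, v⁆ ∈ U) (heh : ⁅e, h⁆ = -e) (hef : ⁅e, f⁆ = h) (heZ : ∀ z ∈ Z, ⁅e, z⁆ = 0)
    {x y z : L} (hx : x ∈ Z) (hy : y ∈ Z) (hz : z ∈ Z)
    (hT : e ⊗ₜ[ℂ] x + h ⊗ₜ[ℂ] y + f ⊗ₜ[ℂ] z ∈ U)
    (hT0 : e ⊗ₜ[ℂ] x + h ⊗ₜ[ℂ] y + f ⊗ₜ[ℂ] z ≠ 0) : ∃ z ∈ Z, z ≠ 0 ∧ e ⊗ₜ[ℂ] z ∈ U := by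
  have act : ∀ x ∈ Z, ∀ y ∈ Z, ∀ z ∈ Z, ⁅e, e ⊗ₜ[ℂ] x + h ⊗ₜ[ℂ] y + f ⊗ₜ[ℂ] z⁆
      = -(e ⊗ₜ[ℂ] y) + h ⊗ₜ[ℂ] z := by
    intro x hx y hy z hz
    simp only [lie_add, TensorProduct.LieModule.lie_tmul_right, heZ x hx, heZ y hy, heZ z hz,
      TensorProduct.tmul_zero, add_zero, lie_self, TensorProduct.zero_tmul, zero_add, heh, hef,
      TensorProduct.neg_tmul]
  by_cases hz0 : z = 0
  · subst hz0
    by_cases hy0 : y = 0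
    · subst hy0
      rw [TensorProduct.tmul_zero, TensorProduct.tmul_zero, add_zero, add_zero] at hT hT0
      exact ⟨x, hx, fun hx0 => hT0 (by rw [hx0, TensorProduct.tmul_zero]), hT⟩
    · refine ⟨y, hy, hy0, ?_⟩
      have h1 := hU _ hT
      rw [act x hx y hy 0 hz, TensorProduct.tmul_zero, add_zero] at h1
      exact U.neg_mem_iff.1 h1
  -- Raising twice sends the tensor to -e ⊗ z, which discards the components x and y.
  · refine ⟨z, hz, hz0, ?_⟩
    have h1 := hU _ (hU _ hT)
    rw [act x hx y hy z hz] at h1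
    have h2 := act (-y) (Z.neg_mem hy) z hz 0 Z.zero_mem
    rw [TensorProduct.tmul_zero, TensorProduct.tmul_zero, add_zero, add_zero,
      TensorProduct.tmul_neg] at h2
    rw [h2] at h1
    exact U.neg_mem_iff.1 h1

end TensorProduct

lemma exists_eq_of_mem_Wng {T : g m ⊗[ℂ] g m} (hT : T ∈ Wng m) : ∃ x ∈ gr m 2, ∃ y ∈ gr m 2,
    ∃ z ∈ gr m 2, T = rootVec (idxN m) (idx0 m) ⊗ₜ[ℂ] x + rootVec (idxN m) (idxN m) ⊗ₜ[ℂ] y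
      + rootVec (idx0 m) (idxN m) ⊗ₜ[ℂ] z := by
  have h : Wng m ≤ (gr m 2).map (TensorProduct.mk ℂ (g m) (g m) (rootVec (idxN m) (idx0 m)))
      ⊔ (gr m 2).map (TensorProduct.mk ℂ (g m) (g m) (rootVec (idxN m) (idxN m)))
      ⊔ (gr m 2).map (TensorProduct.mk ℂ (g m) (g m) (rootVec (idx0 m) (idxN m))) := by
    refine Submodule.map₂_le.2 fun A hA v hv => ?_
    obtain ⟨x, y, w, rfl⟩ := exists_eq_of_mem_lng hA
    have h1 := Submodule.add_mem_sup (Submodule.add_mem_sup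
      (Submodule.mem_map_of_mem (f := TensorProduct.mk ℂ (g m) (g m) (rootVec (idxN m) (idx0 m)))
        (Submodule.smul_mem _ x hv))
      (Submodule.mem_map_of_mem (f := TensorProduct.mk ℂ (g m) (g m) (rootVec (idxN m) (idxN m)))
        (Submodule.smul_mem _ y hv)))
      (Submodule.mem_map_of_mem (f := TensorProduct.mk ℂ (g m) (g m) (rootVec (idx0 m) (idxN m)))
        (Submodule.smul_mem _ w hv))
    have h2 := add_smul_tmul x y w (rootVec (idxN m) (idx0 m)) (rootVec (idxN m) (idxN m))
      (rootVec (idx0 m) (idxN m)) v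
    exact Eq.mpr (congrArg (· ∈ _) h2) h1
  obtain ⟨S, hS, C, hC, rfl⟩ := Submodule.mem_sup.1 (h hT)
  obtain ⟨A, hA, B, hB, rfl⟩ := Submodule.mem_sup.1 hS
  obtain ⟨x, hx, rfl⟩ := Submodule.mem_map.1 hA
  obtain ⟨y, hy, rfl⟩ := Submodule.mem_map.1 hB
  obtain ⟨z, hz, rfl⟩ := Submodule.mem_map.1 hC
  exact ⟨x, hx, y, hy, z, hz, rfl⟩

lemma lie_lng_tmul {A B z : g m} (hA : A ∈ lng m) (hz : z ∈ gr m 2) :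
    ⁅A, B ⊗ₜ[ℂ] z⁆ = ⁅A, B⁆ ⊗ₜ[ℂ] z := by
  rw [TensorProduct.LieModule.lie_tmul_right, lie_lng_gr_two hA hz, TensorProduct.tmul_zero,
    add_zero]

lemma lie_rootVec_idxP_tmul {A : g m} (hA : A ∈ lng m) (z : g m) (k l : Fin m) :
    ⁅(rootVec (idxP k) (idxP l) : g m), A ⊗ₜ[ℂ] z⁆ = A ⊗ₜ[ℂ] ⁅rootVec (idxP k) (idxP l), z⁆ := by
  rw [TensorProduct.LieModule.lie_tmul_right, lie_rootVec_idxP_lng hA, TensorProduct.zero_tmul,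
    zero_add]

lemma tmul_ne_zero {A B : g m} (hA : A ≠ 0) (hB : B ≠ 0) : A ⊗ₜ[ℂ] B ≠ 0 := by
  have h1 : ∃ a b, (A : Mat m) a b ≠ 0 := by
    by_contra! h
    exact hA (eq_zero_of_entries fun a b => Or.inl (h a b))
  have h2 : ∃ a b, (B : Mat m) a b ≠ 0 := by
    by_contra! h
    exact hB (eq_zero_of_entries fun a b => Or.inl (h a b))
  obtain ⟨a, b, h1⟩ := h1
  obtain ⟨c, d, h2⟩ := h2
  intro h
  have h3 := ent_tmul a b c d A B
  rw [h, map_zero] at h3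
  exact mul_ne_zero h1 h2 h3.symm

lemma raise_mem_lng : (rootVec (idxN m) (idx0 m) : g m) ∈ lng m := Submodule.subset_span (Or.inl rfl)

lemma lower_mem_lng : (rootVec (idx0 m) (idxN m) : g m) ∈ lng m :=
  Submodule.subset_span (Or.inr (Or.inr rfl))

section Simple

variable {U : Submodule ℂ (g m ⊗[ℂ] g m)}

/-- A stable subspace contains an element `X_{α_n} ⊗ z`, `z ≠ 0`. -/
lemma exists_raise_tmul_mem (hU : IsLStable (m := m) U) (hle : U ≤ Wng m) (h0 : U ≠ ⊥) :
    ∃ z ∈ gr m 2, z ≠ 0 ∧ rootVec (idxN m) (idx0 m) ⊗ₜ[ℂ] z ∈ U := by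
  obtain ⟨T, hT, hT0⟩ := (Submodule.ne_bot_iff U).1 h0
  obtain ⟨x, hx, y, hy, z, hz, rfl⟩ := exists_eq_of_mem_Wng (hle hT)
  exact tmul_mem_of_lie_stable (fun v hv => hU _ (lng_le_gr_zero raise_mem_lng) v hv)
    lie_idxN_idx0_idxN_self lie_rootVec_idxN_idx0 (fun z hz => lie_lng_gr_two raise_mem_lng hz)
    hx hy hz hT hT0

lemma rootVec_idxP_idxM_swap (k l : Fin m) :
    (rootVec (idxP l) (idxM k) : g m) = -rootVec (idxP k) (idxM l) := by
  have h := rootVec_dualIdx (idxP k) (idxM l)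
  rwa [jCoeff_idxM, jCoeff_idxP, div_one, neg_one_smul] at h

/-- A subspace of `𝔤(2)` that is stable under the `𝔤𝔩(n-1)`-block and non-zero contains `𝔤(2)`. -/
lemma gr_two_le {S : Submodule ℂ (g m)}
    (hS : ∀ k l, ∀ v ∈ S, ⁅(rootVec (idxP k) (idxP l) : g m), v⁆ ∈ S) {z : g m} (hz : z ∈ gr m 2)
    (hz0 : z ≠ 0) (hzS : z ∈ S) : gr m 2 ≤ S := by
  have h1 : ∃ j k, (z : Mat m) (idxP j) (idxM k) ≠ 0 := by
    by_contra! h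
    exact hz0 (eq_zero_of_gr_two hz h)
  obtain ⟨j, k, hjk⟩ := h1
  have hne : j ≠ k := by
    rintro rfl
    exact hjk (apply_dualIdx_right z (idxP j))
  -- The diagonal elements isolate a single root vector of S; the off-diagonal elements then replace
  -- its two indices one at a time.
  have h2 : rootVec (idxP j) (idxM k) ∈ S := by
    have h := hS k k _ (hS j j z hzS)
    rw [lie_lie_rootVec_idxP_self hz hne] at h
    exact (S.smul_mem_iff hjk).1 h
  have h3 : ∀ b, b ≠ j → rootVec (idxP j) (idxM b) ∈ S := by
    intro b _
    have h := hS b k _ h2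
    rw [lie_rootVec_idxP, if_neg hne.symm, if_pos rfl, zero_add] at h
    exact h
  have h4 : ∀ a b, b ≠ j → rootVec (idxP a) (idxM b) ∈ S := by
    intro a b hb
    have h := hS a j _ (h3 b hb)
    rw [lie_rootVec_idxP, if_pos rfl, if_neg hb.symm, add_zero] at h
    exact h
  have h5 : ∀ a b, rootVec (idxP a) (idxM b) ∈ S := by
    intro a b
    by_cases hb : b = j
    · by_cases ha : a = j
      · have h6 : (rootVec (idxP a) (idxM b) : g m) = 0 := by
          rw [ha, hb]
          exact rootVec_dualIdx_right (idxP j)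
        rw [h6]
        exact S.zero_mem
      · rw [rootVec_idxP_idxM_swap]
        exact S.neg_mem (h4 b a ha)
    · exact h4 a b hb
  intro w hw
  refine (S.smul_mem_iff (two_ne_zero (α := ℂ))).1 ?_
  rw [two_smul_eq_sum]
  refine Submodule.sum_mem _ fun p _ => ?_
  by_cases hp : (w : Mat m) p.1 p.2 = 0
  · rw [hp, zero_smul]
    exact S.zero_mem
  · refine S.smul_mem _ ?_
    have hd := (mem_gr_iff 2 w).1 hw _ _ hp
    have hd2 : deg p.1 = 1 ∧ deg p.2 = -1 := by
      rcases deg_cases p.1 with h | h | h <;> rcases deg_cases p.2 with h' | h' | h' <;> omega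
    obtain ⟨a, ha⟩ := exists_idxP hd2.1
    obtain ⟨b, hb⟩ := exists_idxM hd2.2
    rw [ha, hb]
    exact h5 a b

/-- The 𝔤𝔩-block spreads one vector X_{α_n} ⊗ z to X_{α_n} ⊗ 𝔤(2). Lowering by X_{-α_n} in the first
factor then reaches the other two summands of W. -/
lemma eq_Wng_of_stable (hU : IsLStable (m := m) U) (hle : U ≤ Wng m) (h0 : U ≠ ⊥) : U = Wng m := by
  obtain ⟨z, hz, hz0, hzU⟩ := exists_raise_tmul_mem hU hle h0
  have h1 : gr m 2 ≤ U.comap (TensorProduct.mk ℂ (g m) (g m) (rootVec (idxN m) (idx0 m))) := by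
    refine gr_two_le (fun k l v hv => ?_) hz hz0 hzU
    have h := hU _ (rootVec_idxP_idxP_mem k l) _ hv
    rw [TensorProduct.mk_apply, lie_rootVec_idxP_tmul raise_mem_lng] at h
    exact h
  have hf : ∀ A : g m, (∀ z ∈ gr m 2, A ⊗ₜ[ℂ] z ∈ U) →
      ∀ z ∈ gr m 2, ⁅(rootVec (idx0 m) (idxN m) : g m), A⁆ ⊗ₜ[ℂ] z ∈ U := by
    intro A hA z hz
    have h := hU _ (lng_le_gr_zero lower_mem_lng) _ (hA z hz)
    rwa [lie_lng_tmul lower_mem_lng hz] at h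
  have h2 : ∀ z ∈ gr m 2, rootVec (idxN m) (idxN m) ⊗ₜ[ℂ] z ∈ U := by
    intro z hz
    have h := hf _ h1 z hz
    rw [← lie_skew, lie_rootVec_idxN_idx0, TensorProduct.neg_tmul] at h
    exact U.neg_mem_iff.1 h
  have h3 : ∀ z ∈ gr m 2, rootVec (idx0 m) (idxN m) ⊗ₜ[ℂ] z ∈ U := by
    intro z hz
    have h := hf _ h2 z hz
    rwa [lie_idx0_idxN_idxN_self] at h
  refine le_antisymm hle fun T hT => ?_
  obtain ⟨x, hx, y, hy, w, hw, rfl⟩ := exists_eq_of_mem_Wng hT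
  exact U.add_mem (U.add_mem (h1 hx) (h2 y hy)) (h3 w hw)

end Simple

/-! ## Highest weights -/

lemma lie_cartan_rootVec (h : Fin (m + 1) → ℂ) (a b : Idx m) :
    ⁅(cartan h : g m), rootVec a b⁆ = evalWeight (wt a - wt b) h • rootVec a b := by
  ext c d
  change ((⁅(cartan h : g m), rootVec a b⁆ : g m) : Mat m) c d
    = evalWeight (wt a - wt b) h * (rootVec a b : Mat m) c d
  rw [lie_cartan_apply]
  by_cases hcd : (rootVec a b : Mat m) c d = 0
  · rw [hcd, mul_zero, mul_zero]
  · rw [(mem_rootSpace_iff _ _).1 (rootVec_mem_rootSpace a b) c d hcd]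

/-- The exceptional indices are harmless, since they multiply a vector with dual indices, which is
zero. This is what kills X_γ under the root vector of ε_1 - ε_2. -/
lemma lie_rootVec_eq_zero {X : g m} {a b : Idx m} (h1 : ∀ i, i ≠ dualIdx b → (X : Mat m) i a = 0)
    (h2 : ∀ i, i ≠ dualIdx a → (X : Mat m) b i = 0) : ⁅X, rootVec a b⁆ = 0 := by
  rw [lie_rootVec, Finset.sum_eq_zero, Finset.sum_eq_zero, sub_zero]
  · intro i _
    by_cases h : i = dualIdx a
    · rw [h, rootVec_dualIdx_right, smul_zero]
    · rw [h2 i h, zero_smul]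
  · intro i _
    by_cases h : i = dualIdx b
    · have h3 : b = dualIdx i := by rw [h, dualIdx_dualIdx]
      rw [h3, rootVec_dualIdx_right, smul_zero]
    · rw [h1 i h, zero_smul]

lemma ht_idxP (l : Fin m) : ht (idxP l : Idx m) = m + 1 - l := rfl

lemma ht_idxM (l : Fin m) : ht (idxM l : Idx m) = -(m + 1 - l) := rfl

lemma ht_midIdx (t : Fin 3) : ht (midIdx t : Idx m) = ![0, 1, -1] t := by
  fin_cases t <;> simp [ht, midIdx]

section HighestWeight

variable {X : g m}

/-- Strictly upper triangular elements of `𝔤(0)`: the first column. -/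
lemma apply_idxP_zero (hX : X ∈ gr m 0) (hup : ∀ a b, (X : Mat m) a b ≠ 0 → ht b < ht a) {l : Fin m}
    (hl : (l : ℕ) = 0) (i : Idx m) : (X : Mat m) i (idxP l) = 0 := by
  by_contra h
  have h1 := (mem_gr_iff 0 X).1 hX _ _ h
  have h2 := hup _ _ h
  rw [deg_idxP] at h1
  obtain ⟨k, rfl⟩ := exists_idxP (a := i) (by omega)
  rw [ht_idxP, ht_idxP] at h2
  omega

lemma apply_idxM_one (hX : X ∈ gr m 0) (hup : ∀ a b, (X : Mat m) a b ≠ 0 → ht b < ht a) {l k : Fin m}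
    (hl : (l : ℕ) = 1) (hk : (k : ℕ) = 0) (i : Idx m) (hi : i ≠ idxM k) :
    (X : Mat m) (idxM l) i = 0 := by
  by_contra h
  have h1 := (mem_gr_iff 0 X).1 hX _ _ h
  have h2 := hup _ _ h
  rw [deg_idxM] at h1
  obtain ⟨j, rfl⟩ := exists_idxM (a := i) (by omega)
  rw [ht_idxM, ht_idxM] at h2
  exact hi (congrArg idxM (Fin.ext (by omega)))

lemma apply_idxN_right (hX : X ∈ gr m 0) (hup : ∀ a b, (X : Mat m) a b ≠ 0 → ht b < ht a)
    (i : Idx m) : (X : Mat m) i (idxN m) = 0 := by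
  by_contra h
  have h1 := (mem_gr_iff 0 X).1 hX _ _ h
  have h2 := hup _ _ h
  rw [← midIdx_one, deg_midIdx] at h1
  obtain ⟨t, rfl⟩ := exists_midIdx (a := i) (by omega)
  rw [← midIdx_one, ht_midIdx, ht_midIdx] at h2
  fin_cases t <;> simp at h2

lemma apply_dualIdx_idxN_left (hX : X ∈ gr m 0) (hup : ∀ a b, (X : Mat m) a b ≠ 0 → ht b < ht a)
    (i : Idx m) : (X : Mat m) (dualIdx (idxN m)) i = 0 := by
  by_contra h
  have h1 := (mem_gr_iff 0 X).1 hX _ _ h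
  have h2 := hup _ _ h
  rw [← midIdx_one, dualIdx_midIdx, deg_midIdx] at h1
  obtain ⟨t, rfl⟩ := exists_midIdx (a := i) (by omega)
  rw [← midIdx_one, dualIdx_midIdx, ht_midIdx, ht_midIdx] at h2
  fin_cases t <;> simp [midDual] at h2

lemma apply_idx0_left (hX : X ∈ gr m 0) (hup : ∀ a b, (X : Mat m) a b ≠ 0 → ht b < ht a)
    (i : Idx m) (hi : i ≠ dualIdx (idxN m)) : (X : Mat m) (idx0 m) i = 0 := by
  by_contra h
  have h1 := (mem_gr_iff 0 X).1 hX _ _ h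
  have h2 := hup _ _ h
  have e : idx0 m = midIdx 0 := rfl
  rw [e, deg_midIdx] at h1
  obtain ⟨t, rfl⟩ := exists_midIdx (a := i) (by omega)
  rw [e, ht_midIdx, ht_midIdx] at h2
  fin_cases t
  · simp at h2
  · simp at h2
  · exact hi rfl

end HighestWeight

lemma eps_zero_eq (hm : 3 ≤ m) : (eps 0 : Weight m) = wt (idxP ⟨0, by omega⟩) := rfl

lemma fin_one_eq (hm : 3 ≤ m) : (1 : Fin (m + 1)) = Fin.castSucc ⟨1, by omega⟩ := by
  apply Fin.ext
  rw [Fin.val_castSucc, Fin.val_one']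
  exact Nat.mod_eq_of_lt (by omega)

lemma eps_one_eq (hm : 3 ≤ m) : (eps 1 : Weight m) = wt (idxP ⟨1, by omega⟩) := by
  rw [fin_one_eq hm]
  rfl

lemma wt_idxN : wt (idxN m) = eps (Fin.last m) := rfl

lemma wt_idx0 : wt (idx0 m) = 0 := rfl

lemma isHighestWeight_gr_one (hm : 3 ≤ m) : IsHighestWeight (gr m 1) (mu m) := by
  have hw : wt (idxP ⟨0, by omega⟩) - wt (dualIdx (idxN m)) = mu m := by
    rw [wt_dualIdx, wt_idxN, sub_neg_eq_add, mu, eps_zero_eq hm]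
  refine ⟨rootVec (idxP ⟨0, by omega⟩) (dualIdx (idxN m)), ?_, rootVec_ne_zero ?_, fun h => ?_,
    fun α hα hle X hX => ?_⟩
  · exact x1_mem (⟨0, by omega⟩, 2)
  · rw [dualIdx_idxP, ← midIdx_one, dualIdx_midIdx]
    exact midIdx_ne_idxM _ _
  · rw [lie_cartan_rootVec, hw]
  · have hup := fun a b => ht_lt_of_posRoots hα hX (a := a) (b := b)
    exact lie_rootVec_eq_zero (fun i _ => apply_idxP_zero (hle hX) hup rfl i)
      fun i _ => apply_dualIdx_idxN_left (hle hX) hup i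

/-- The vector is X_{α_n} ⊗ X_γ, of weight ε_n + ε_1 + ε_2; both factors are killed by the positive
root vectors of 𝔩. -/
lemma isHighestWeight_Wng (hm : 3 ≤ m) : IsHighestWeight (Wng m) (mu m + epsNG m) := by
  let k0 : Fin m := ⟨0, by omega⟩
  let k1 : Fin m := ⟨1, by omega⟩
  have hk : k0 ≠ k1 := by simp [k0, k1]
  have hw : (wt (idxN m) - wt (idx0 m)) + (wt (idxP k0) - wt (idxM k1)) = mu m + epsNG m := by
    have e : wt (idxM k1) = -wt (idxP k1) := rfl
    rw [wt_idxN, wt_idx0, e, mu, epsNG, eps_zero_eq hm, eps_one_eq hm]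
    abel
  have hev : ∀ α β : Weight m, ∀ h, evalWeight (α + β) h = evalWeight α h + evalWeight β h := by
    intro α β h
    simp [evalWeight, add_mul, Finset.sum_add_distrib]
  refine ⟨rootVec (idxN m) (idx0 m) ⊗ₜ[ℂ] rootVec (idxP k0) (idxM k1),
    Submodule.apply_mem_map₂ _ raise_mem_lng (rootVec_idxP_idxM_mem k0 k1),
    tmul_ne_zero (rootVec_ne_zero idx0_ne_dualIdx_idxN) (rootVec_ne_zero ?_), fun h => ?_,
    fun α hα hle X hX => ?_⟩
  · rw [dualIdx_idxP, Ne, idxM_inj]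
    exact hk.symm
  · refine (lie_tmul_of_eq_smul (lie_cartan_rootVec h _ _) (lie_cartan_rootVec h _ _)).trans
      (congrArg (· • _) ?_)
    rw [← hev, hw]
  · have hup := fun a b => ht_lt_of_posRoots hα hX (a := a) (b := b)
    exact lie_tmul_eq_zero
      (lie_rootVec_eq_zero (fun i _ => apply_idxN_right (hle hX) hup i)
        (fun i hi => apply_idx0_left (hle hX) hup i hi))
      (lie_rootVec_eq_zero (fun i _ => apply_idxP_zero (hle hX) hup rfl i)
        (fun i hi => apply_idxM_one (hle hX) hup rfl rfl i hi))

lemma isLSimple_Wng (hm : 3 ≤ m) : IsLSimple (m := m) (Wng m) := by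
  refine ⟨?_, fun X hX v hv => lie_mem_Wng hX hv, fun U hle hU => ?_⟩
  · obtain ⟨v, hv, hv0, -⟩ := isHighestWeight_Wng hm
    exact (Submodule.ne_bot_iff _).2 ⟨v, hv, hv0⟩
  · by_cases h0 : U = ⊥
    · exact Or.inl h0
    · exact Or.inr (eq_Wng_of_stable hU hle h0)

lemma zero_ne_last (hm : 3 ≤ m) : (0 : Fin (m + 1)) ≠ Fin.last m := by
  rw [Ne, Fin.ext_iff, Fin.val_last, Fin.val_zero]
  omega

lemma one_ne_last (hm : 3 ≤ m) : (1 : Fin (m + 1)) ≠ Fin.last m := by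
  rw [fin_one_eq hm]
  exact Fin.castSucc_ne_last _

lemma zero_ne_one_fin (hm : 3 ≤ m) : (0 : Fin (m + 1)) ≠ 1 := by
  rw [fin_one_eq hm, Ne, Fin.ext_iff]
  simp

/-- A root has at most two non-zero coordinates, one from each of its indices, whereas ε_1 + ε_2 +
ε_n has three. -/
lemma mu_add_epsNG_notMem_roots (hm : 3 ≤ m) : mu m + epsNG m ∉ roots m := by
  have h01 := zero_ne_one_fin hm
  have h0 := zero_ne_last hm
  have h1 := one_ne_last hm
  intro h
  obtain ⟨-, a, b, -, hab⟩ := (mem_roots_iff _).1 h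
  have e0 : wt a 0 - wt b 0 ≠ 0 := by
    rw [← Pi.sub_apply, ← hab]
    simp [mu, epsNG, eps, h0, h01]
  have e1 : wt a 1 - wt b 1 ≠ 0 := by
    rw [← Pi.sub_apply, ← hab]
    simp [mu, epsNG, eps, h01.symm, h1]
  have e2 : wt a (Fin.last m) - wt b (Fin.last m) ≠ 0 := by
    rw [← Pi.sub_apply, ← hab]
    simp [mu, epsNG, eps, h0.symm, h1.symm]
  have huniq : ∀ (c : Idx m) (i j : Fin (m + 1)), i ≠ j → wt c i ≠ 0 → wt c j = 0 := by
    intro c i j hij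
    rcases c with _ | l | l
    · simp [wt]
    all_goals
      intro hi
      have hl : i = l := by
        by_contra hne
        simp [wt, eps, hne] at hi
      subst hl
      simp [wt, eps, hij.symm]
  by_cases ha0 : wt a 0 = 0
  · have hb0 : wt b 0 ≠ 0 := fun h => e0 (by rw [ha0, h, sub_zero])
    rw [huniq b 0 1 h01 hb0, sub_zero] at e1
    rw [huniq b 0 _ h0 hb0, sub_zero] at e2
    exact e2 (huniq a 1 _ h1 e1)
  · rw [huniq a 0 1 h01 ha0, zero_sub, neg_ne_zero] at e1
    rw [huniq a 0 _ h0 ha0, zero_sub, neg_ne_zero] at e2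
    exact e2 (huniq b 1 _ h1 e1)

theorem isSpecialType1b_Wng (hm : 3 ≤ m) : IsSpecialType1b m (Wng m) (mu m) (epsNG m) where
  le := Wng_le
  simple := isLSimple_Wng hm
  highestWeight_g1 := isHighestWeight_gr_one hm
  mem := by
    refine ⟨eps_mem_roots 1, rootSpace_le_gr ?_⟩
    rw [epsNG, fin_one_eq hm, wtDeg_eps_castSucc, Int.cast_one]
  highestWeight := isHighestWeight_Wng hm
  ne_gam := fun h => by
    have h1 := congrFun h (Fin.last m)
    have h0 := (zero_ne_last hm).symm
    have h2 := (one_ne_last hm).symm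
    simp [mu, epsNG, gam, eps, h0, h2] at h1
  not_root := mu_add_epsNG_notMem_roots hm
  ne := fun h => by
    have h1 := congrFun h (Fin.last m)
    have h0 := (zero_ne_last hm).symm
    have h2 := (one_ne_last hm).symm
    simp [mu, epsNG, eps, h0, h2] at h1
  short := by
    -- The root ε_2 has squared length 1 and γ has squared length 2.
    refine Or.inr ⟨eps_mem_roots 1, eps 0 + eps 1, eps_add_eps_mem_roots (zero_ne_one_fin hm), ?_⟩
    have h01 := zero_ne_one_fin hm
    have e1 : sqLength (epsNG m) = 1 := by
      rw [sqLength, Finset.sum_eq_single 1]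
      · simp [epsNG, eps]
      · intro j _ hj
        simp [epsNG, eps, hj]
      · simp
    have e2 : (2 : ℝ) ≤ sqLength (eps 0 + eps 1 : Weight m) := by
      have h := Finset.sum_le_univ_sum_of_nonneg (s := {0, 1})
        (f := fun j => ‖(eps 0 + eps 1 : Weight m) j‖ ^ 2) (fun j => by positivity)
      rw [Finset.sum_pair h01] at h
      refine le_trans (le_of_eq ?_) h
      simp [eps, h01, h01.symm]
      norm_num
    rw [e1]
    linarith

/-! ## The number of roots -/

/-- Since ν has degree 2, both α and ν - α have degree 1, so each is ε_l + τ ε_n with τ ∈ {-1, 0,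
1}. Comparing coordinates leaves two choices of l and two of τ. -/
lemma rootsInSub_eq (hm : 3 ≤ m) : rootsInSub (mu m + epsNG m) (gr m 1)
    = Set.range fun x : Bool × Bool => (eps (if x.1 then 0 else 1)
      + if x.2 then eps (Fin.last m) else 0 : Weight m) := by
  have h01 := zero_ne_one_fin hm
  have h0 := zero_ne_last hm
  have h1 := one_ne_last hm
  have f1 := fin_one_eq hm
  have d0 : wtDeg (eps 0 : Weight m) = 1 := wtDeg_eps_castSucc (⟨0, by omega⟩ : Fin m)
  have d1 : wtDeg (eps 1 : Weight m) = 1 := by rw [f1, wtDeg_eps_castSucc]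
  have dz : wtDeg (0 : Weight m) = 0 := by simp [wtDeg]
  have hroot : ∀ x y : Bool, (eps (if x then 0 else 1)
      + if y then eps (Fin.last m) else 0 : Weight m) ∈ roots m := by
    intro x y
    cases x <;> cases y <;> simp [eps_mem_roots, eps_add_eps_mem_roots, h0, h1]
  ext α
  constructor
  · rintro ⟨hα, hν⟩
    have hd := wtDeg_of_mem_rootsIn hα
    rw [Int.cast_one] at hd
    have hd' : wtDeg (mu m + epsNG m - α) = 1 := by
      rw [wtDeg_sub, hd, wtDeg_add, mu, wtDeg_add, epsNG, d0, d1, wtDeg_eps_last]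
      norm_num
    obtain ⟨l, τ, hτ, rfl⟩ := exists_eq_of_mem_roots hα.1 hd
    obtain ⟨l', τ', hτ', h⟩ := exists_eq_of_mem_roots hν hd'
    have e0 := congrFun h 0
    have e1 := congrFun h 1
    have e2 := congrFun h (Fin.last m)
    have hl : l.castSucc = 0 ∨ l.castSucc = 1 := by
      -- Otherwise the complementary root would have to supply both ε_1 and ε_2.
      by_contra! hne
      simp [mu, epsNG, eps, h0, h01, h01.symm, h1, Pi.single_apply, hne.1.symm, hne.2.symm] at e0 e1
      have e3 : l'.castSucc = 0 := by
        by_contra h'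
        simp [Ne.symm h'] at e0
      rw [e3] at e1
      simp [h01.symm] at e1
    have hlast : ∀ l : Fin m, Fin.last m ≠ l.castSucc := fun l => (Fin.castSucc_ne_last l).symm
    have hτ2 : τ + τ' = 1 := by
      simp [mu, epsNG, eps, h0.symm, h1.symm, hlast] at e2
      have e3 : (1 : ℂ) = τ + τ' := by linear_combination e2
      exact_mod_cast e3.symm
    -- The value τ = -1 would require τ' = 2.
    have hτ3 : τ = 0 ∨ τ = 1 := by omega
    rcases hl with hl | hl <;> rcases hτ3 with rfl | rfl <;> rw [hl]
    · exact ⟨(true, false), by simp⟩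
    · exact ⟨(true, true), by simp⟩
    · exact ⟨(false, false), by simp⟩
    · exact ⟨(false, true), by simp⟩
  · rintro ⟨⟨x, y⟩, rfl⟩
    refine ⟨⟨hroot x y, rootSpace_le_gr ?_⟩, ?_⟩
    · rw [wtDeg_add]
      cases x <;> cases y <;> simp [d0, d1, dz, wtDeg_eps_last]
    · have h2 : mu m + epsNG m - (eps (if x then 0 else 1) + if y then eps (Fin.last m) else 0)
          = (eps (if !x then 0 else 1) + if !y then eps (Fin.last m) else 0 : Weight m) := by
        rw [mu, epsNG]
        cases x <;> cases y <;> simp <;> abel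
      dsimp only
      rw [h2]
      exact hroot (!x) (!y)

lemma ncard_rootsInSub (hm : 3 ≤ m) : (rootsInSub (mu m + epsNG m) (gr m 1)).ncard = 4 := by
  have h01 := zero_ne_one_fin hm
  have h0 := zero_ne_last hm
  have h1 := one_ne_last hm
  rw [rootsInSub_eq hm, ← Set.image_univ, Set.ncard_image_of_injective, Set.ncard_univ,
    Nat.card_eq_fintype_card]
  · rfl
  · rintro ⟨x, y⟩ ⟨x', y'⟩ h
    have e0 := congrFun h 0
    have e2 := congrFun h (Fin.last m)
    cases x <;> cases y <;> cases x' <;> cases y' <;>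
      simp [eps, h0, h01, h0.symm, h1.symm] at e0 e2 ⊢

end OmegaB

end

/-! ### The theorem -/

theorem theorem3p2 (m : ℕ) (hm : 3 ≤ m) :
    OmegaB.IsSpecialType1b m (OmegaB.Wng m) (OmegaB.mu m) (OmegaB.epsNG m) ∧
    (∀ (ρ : OmegaB.RealForm m) (d : ℕ) (Y : Module.Basis (Fin d) ℂ (OmegaB.WngDual m)) (s : ℂ),
      OmegaB.IsConformallyInvariant ρ s (fun i => OmegaB.Omega2 ρ (Y i : TensorProduct ℂ
        (OmegaB.g m) (OmegaB.g m))) ↔ s = 1) ∧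
    (1 : ℝ) = ((OmegaB.rootsInSub (OmegaB.mu m + OmegaB.epsNG m) (OmegaB.gr m 1)).ncard : ℝ) / 2
      - 1 := by
  exact ⟨OmegaB.isSpecialType1b_Wng hm, fun ρ _ Y s => OmegaB.isConformallyInvariant_iff ρ Y hm s,
    by rw [OmegaB.ncard_rootsInSub hm]; norm_num⟩
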